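/- Let $p,q\ge 0$, $D=p+q$, $R>0$. Let $\eta_{mn}=\mathrm{diag}(-1,\dots,-1,+1,\dots,+1)$ ($p$ minus signs, $q$ plus signs; $m,n=0,\dots,D-1$) and $\eta_{AB}=\mathrm{diag}(\eta_{mn},-1)$ ($A,B=0,\dots,D$). Repeated indices are summed, and indices are moved with $\eta$. Consider the pseudosphere $\mathbf S_{p+1,q}=\{X^AX^B\eta_{AB}=-R^2\}\subset\mathbb R^{p+1,q}$ in the stereographic coordinates $x^\mu$ with metric and frame $$g_{\mu\nu}=G^{-2}\eta_{\mu\nu},\qquad e^\mu_n=G\,\delta^\mu_n,\qquad G(x)=1-\frac{x^\mu x^\nu\eta_{\mu\nu}}{4R^2},$$ on an open set of points $x$ where $G(x)\ne0$. Put $e_n=e_n^\mu\partial_\mu$ and $x_n=\eta_{n\mu}x^\mu$. The torsion-free spin connection is $w_{knm}=\tfrac12(\mathcal E_{nmk}+\mathcal E_{kmn}-\mathcal E_{knm})$, where $[e_n,e_m]=\mathcal E_{nm}{}^{l}e_l$; explicitly, $w_{knm}=-\frac1{2R^2}(x_n\eta_{mk}-x_m\eta_{nk})$. Let $\mathcal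 F$ be a linear space (over $\mathbb R$ or $\mathbb C$) of functions $\Psi(x,\mathfrak y)$, smooth in $x$, which is stable under multiplication by the coordinates $x^\mu$ and under the derivatives $\partial_\mu$; $\mathfrak y$ are arbitrary additional variables. Let $\mathcal M_{mn}=-\mathcal M_{nm}$ be linear operators on $\mathcal F$ that commute with all $x_k$ and $\partial_k$ and satisfy $$[\mathcal M_{mn},\mathcal M_{kl}]=\eta_{nk}\mathcal M_{ml}+\eta_{ml}\mathcal M_{nk}-\eta_{nl}\mathcal M_{mk}-\eta_{mk}\mathcal M_{nl}.$$ The generators of $\mathfrak{so}(p+1,q)$ are $J_{AB}=-J_{BA}$ with $$J_{mn}=x_m\partial_n-x_n\partial_m+\mathcal M_{mn},\qquad J_{nD}=R\,P_n,\qquad P_n=e_n-\tfrac12w_{nkl}J^{kl},$$ and the Casimir operators are $$\mathcal C_{2n}=\frac{(-1)^{p+1}}{(2^nn!)^2}\sum_{\sigma\in S_{2n}}\mathrm{sgn}(\sigma)\,\delta^{A_1}_{B_{\sigma(1)}}\cdots\delta^{A_{2n}}_{B_{\sigma(2n)}}\,J_{A_1A_2}\cdots J_{A_{2n-1}A_{2n}}\,J^{B_1B_2}\cdots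 J^{B_{2n-1}B_{2n}}.$$ Define the covariant derivative $\mathcal D_n=e_n+\tfrac12w_{nkl}\mathcal M^{kl}$ and, with $\mathcal D_{mn}:=\mathcal D_m\mathcal D_n+w_{mnl}\mathcal D^l$, $$(\mathcal D)^2=\eta^{mn}\mathcal D_{mn},\qquad(\mathcal D_{(1)})^2=\mathcal M^{km}\mathcal M_k{}^{n}\mathcal D_{mn},\qquad(\mathcal D_{(2)})^2=\mathcal M^k{}_d\mathcal M^{dm}\mathcal M_{kr}\mathcal M^{rn}\mathcal D_{mn},$$ $$\mathcal M_{(2)}=\mathcal M_{mn}\mathcal M^{nm},\quad\mathcal M_{(4)}=\mathcal M_{mn}\mathcal M^{nk}\mathcal M_{kl}\mathcal M^{lm},\quad\mathcal M_{(6)}=\mathcal M_{mn}\mathcal M^{nk}\mathcal M_{kl}\mathcal M^{lr}\mathcal M_{rs}\mathcal M^{sm}.$$ Then, as operators on $\mathcal F$, $$\mathcal C_2=(-1)^p\Bigl(R^2(\mathcal D)^2+\tfrac12\mathcal M_{(2)}\Bigr),$$ $$\mathcal C_4=(-1)^{p+1}R^2\Bigl((\mathcal D_{(1)})^2+\tfrac12\mathcal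 M_{(2)}(\mathcal D)^2\Bigr)+\mathcal O_4(\mathcal M),$$ $$\mathcal C_6=(-1)^pR^2\Bigl((\mathcal D_{(2)})^2+\tfrac18\mathcal M_{(2)}^2(\mathcal D)^2-\tfrac14\mathcal M_{(4)}(\mathcal D)^2+\tfrac12\mathcal M_{(2)}(\mathcal D_{(1)})^2+\beta_1\mathcal M_{(2)}(\mathcal D)^2+\beta_2(\mathcal D_{(1)})^2\Bigr)-\mathcal O_6(\mathcal M),$$ where $$\mathcal O_4(\mathcal M)=(-1)^{p+1}\Bigl(\tfrac{(D-2)(D+1)}8\mathcal M_{(2)}+\tfrac18\mathcal M_{(2)}^2-\tfrac14\mathcal M_{(4)}\Bigr),$$ $$\mathcal O_6(\mathcal M)=(-1)^p\Bigl(\gamma_2\mathcal M_{(2)}+\gamma_{2,2}\mathcal M_{(2)}^2+\gamma_4\mathcal M_{(4)}-\tfrac1{48}\mathcal M_{(2)}^3+\tfrac18\mathcal M_{(2)}\mathcal M_{(4)}-\tfrac16\mathcal M_{(6)}\Bigr),$$ $$\beta_1=\tfrac18(D^2-5D+10),\quad\beta_2=1,\quad\gamma_2=-\tfrac1{12}(D^4-6D^3+13D^2-8D-4),$$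 $$\gamma_{2,2}=\tfrac1{48}(-3D^2+D-2),\quad\gamma_4=\tfrac16(2D^2-5D+5).$$ -/

import Mathlib

open scoped ContDiff

namespace Pseudosphere

/-! ### Metrics and index gymnastics -/

/-- Diagonal entries of the flat metric of `ℝ^{p,q}`: first `p` entries `-1`, then `q` entries `+1`. -/
def etaSign (p q : ℕ) (m : Fin (p + q)) : ℤ := if (m : ℕ) < p then -1 else 1

/-- The flat metric `η_{mn} = diag(-1,…,-1,+1,…,+1)`; it is its own inverse, so the same matrix
serves as `η^{mn}`. -/
def eta (p q : ℕ) : Matrix (Fin (p + q)) (Fin (p + q)) ℤ := Matrix.diagonal (etaSign p q)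

/-- The metric `η_{AB} = diag(-1,…,-1,+1,…,+1,-1)` of `ℝ^{p+1,q}`; also its own inverse. -/
def etaAmb (p q : ℕ) : Matrix (Fin (p + q + 1)) (Fin (p + q + 1)) ℤ :=
  Matrix.diagonal (Fin.lastCases (-1) (etaSign p q))

/-- `v^m = η^{mn} v_n`. -/
def raise {ι A : Type*} [Fintype ι] [AddCommGroup A] (η : Matrix ι ι ℤ) (v : ι → A) (m : ι) : A :=
  ∑ n, η m n • v n

/-- `T^{mn} = η^{ma} η^{nb} T_{ab}`. -/
def raise₂ {ι A : Type*} [Fintype ι] [AddCommGroup A] (η : Matrix ι ι ℤ) (T : ι → ι → A)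
    (m n : ι) : A :=
  ∑ a, ∑ b, (η m a * η n b) • T a b

/-! ### Casimir operators in terms of the antisymmetrizer -/

/-- The antisymmetrizer
`𝒜^{k₁…k_N}_{m₁…m_N} = ∑_σ sgn(σ) δ^{k₁}_{m_{σ(1)}} ⋯ δ^{k_N}_{m_{σ(N)}}`. -/
def antisymmetrizer {ι : Type*} [DecidableEq ι] {N : ℕ} (k m : Fin N → ι) : ℤ :=
  ∑ σ : Equiv.Perm (Fin N), (Equiv.Perm.sign σ : ℤ) * ∏ i, if k i = m (σ i) then 1 else 0

/-- The ordered product `J_{k₁k₂} J_{k₃k₄} ⋯ J_{k_{2n-1}k_{2n}}`. -/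
def pairProd {ι A : Type*} [Ring A] {n : ℕ} (J : ι → ι → A) (k : Fin (2 * n) → ι) : A :=
  (List.ofFn fun i : Fin n =>
    J (k ⟨2 * (i : ℕ), by omega⟩) (k ⟨2 * (i : ℕ) + 1, by omega⟩)).prod

/-- The Casimir operator of order `2n` built from generators `J_{AB}`, where `s` is the number of
negative entries of the (diagonal) metric `η`:
`(-1)^s (2ⁿ n!)⁻² 𝒜^{k₁…k_{2n}}_{m₁…m_{2n}} J_{k₁k₂} ⋯ J_{k_{2n-1}k_{2n}} J^{m₁m₂} ⋯ J^{m_{2n-1}m_{2n}}`. -/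
def casimir (𝕜 : Type*) [Field 𝕜] {ι A : Type*} [Fintype ι] [DecidableEq ι] [Ring A] [Algebra 𝕜 A]
    (η : Matrix ι ι ℤ) (s n : ℕ) (J : ι → ι → A) : A :=
  ((-1) ^ s / (2 ^ n * (n.factorial : 𝕜)) ^ 2 : 𝕜) •
    ∑ k : Fin (2 * n) → ι, ∑ m : Fin (2 * n) → ι,
      antisymmetrizer k m • (pairProd J k * pairProd (raise₂ η J) m)

/-! ### Geometry of the pseudosphere in the stereographic chart -/

variable {p q : ℕ}

/-- The coordinate partial derivative `∂_μ f` at `x`. -/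
noncomputable def pderiv {d : ℕ} {E : Type*} [NormedAddCommGroup E] [NormedSpace ℝ E]
    (μ : Fin d) (f : (Fin d → ℝ) → E) (x : Fin d → ℝ) : E :=
  fderiv ℝ f x (Pi.single μ 1)

/-- `x_n = η_{nμ} x^μ`. -/
def lowerCoord (x : Fin (p + q) → ℝ) (n : Fin (p + q)) : ℝ := raise (eta p q) x n

/-- `(x)² = x^μ x^ν η_{μν}`. -/
def sqForm (x : Fin (p + q) → ℝ) : ℝ := ∑ μ, ∑ ν, x μ * x ν * (eta p q μ ν : ℝ)

/-- `G(x) = 1 - (x)² / (4R²)`. -/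
noncomputable def G (R : ℝ) (x : Fin (p + q) → ℝ) : ℝ := 1 - sqForm x / (4 * R ^ 2)

/-- The stereographic parametrisation of the pseudosphere `X^A X^B η_{AB} = -R²`:
`X^n = x^n / G`, `X^D = R (1 + (x)²/(4R²)) / G`. -/
noncomputable def embedding (R : ℝ) (x : Fin (p + q) → ℝ) : Fin (p + q + 1) → ℝ :=
  Fin.lastCases (R * (1 + sqForm x / (4 * R ^ 2)) / G R x) (fun n => x n / G R x)

/-- The metric `g_{μν} = G⁻² η_{μν}` of the pseudosphere in these coordinates. -/
noncomputable def metric (R : ℝ) (x : Fin (p + q) → ℝ) (μ ν : Fin (p + q)) : ℝ :=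
  (G R x ^ 2)⁻¹ * (eta p q μ ν : ℝ)

/-- The frame field `e^μ_n = G δ^μ_n`. -/
noncomputable def frame (R : ℝ) (x : Fin (p + q) → ℝ) (μ n : Fin (p + q)) : ℝ :=
  if μ = n then G R x else 0

/-- The inverse frame field `e_μ^n = G⁻¹ δ_μ^n`. -/
noncomputable def coframe (R : ℝ) (x : Fin (p + q) → ℝ) (μ n : Fin (p + q)) : ℝ :=
  if μ = n then (G R x)⁻¹ else 0

/-- The anholonomy tensor `ℰ_{nm}^l = (e_n e^μ_m - e_m e^μ_n) e_μ^l`, with `e_n = e^ν_n ∂_ν`. -/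
noncomputable def anholonomy (R : ℝ) (x : Fin (p + q) → ℝ) (n m l : Fin (p + q)) : ℝ :=
  ∑ μ, ((∑ ν, frame R x ν n * pderiv ν (fun z => frame R z μ m) x)
      - (∑ ν, frame R x ν m * pderiv ν (fun z => frame R z μ n) x)) * coframe R x μ l

/-- `ℰ_{nmk} = η_{kl} ℰ_{nm}^l`. -/
noncomputable def anholonomyLow (R : ℝ) (x : Fin (p + q) → ℝ) (n m k : Fin (p + q)) : ℝ :=
  raise (eta p q) (anholonomy R x n m) k

/-- The torsion-free spin connection `w_{knm} = ½ (ℰ_{nmk} + ℰ_{kmn} - ℰ_{knm})`. -/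
noncomputable def spinConn (R : ℝ) (x : Fin (p + q) → ℝ) (k n m : Fin (p + q)) : ℝ :=
  (anholonomyLow R x n m k + anholonomyLow R x k m n - anholonomyLow R x k n m) / 2

/-! Explicit form of the spin connection (needed to see that it acts on the function spaces below). -/

theorem raise_eta {A : Type*} [AddCommGroup A] (v : Fin (p + q) → A) (m : Fin (p + q)) :
    raise (eta p q) v m = etaSign p q m • v m := by
  unfold raise eta
  rw [Finset.sum_eq_single m]
  · simp
  · intro b _ hb
    simp [Matrix.diagonal_apply_ne' _ hb]
  · simp

theorem sqForm_eq (x : Fin (p + q) → ℝ) : sqForm x = ∑ μ, (etaSign p q μ : ℝ) * x μ ^ 2 := by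
  unfold sqForm
  refine Finset.sum_congr rfl fun μ _ => ?_
  rw [Finset.sum_eq_single μ]
  · simp [eta]; ring
  · intro b _ hb
    simp [eta, Matrix.diagonal_apply_ne' _ hb]
  · simp

theorem hasFDerivAt_G (R : ℝ) (x : Fin (p + q) → ℝ) :
    HasFDerivAt (G (p := p) (q := q) R)
      (-((4 * R ^ 2)⁻¹ • ∑ μ, (etaSign p q μ : ℝ) •
        ((2 * x μ) • ContinuousLinearMap.proj (R := ℝ) (φ := fun _ : Fin (p + q) => ℝ) μ))) x := by
  have h1 : HasFDerivAt (fun x : Fin (p + q) → ℝ => ∑ μ, (etaSign p q μ : ℝ) * x μ ^ 2)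
      (∑ μ, (etaSign p q μ : ℝ) •
        ((2 * x μ) • ContinuousLinearMap.proj (R := ℝ) (φ := fun _ : Fin (p + q) => ℝ) μ)) x := by
    refine HasFDerivAt.fun_sum fun μ _ => ?_
    have h := ((ContinuousLinearMap.proj (R := ℝ) (φ := fun _ : Fin (p + q) => ℝ) μ).hasFDerivAt
      (x := x)).pow 2
    have h' := h.const_mul (etaSign p q μ : ℝ)
    simpa using h'
  have h2 : G (p := p) (q := q) R = fun x =>
      1 - (4 * R ^ 2)⁻¹ * ∑ μ, (etaSign p q μ : ℝ) * x μ ^ 2 := by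
    funext z
    rw [G, sqForm_eq, div_eq_inv_mul]
  rw [h2]
  exact (h1.const_mul _).const_sub 1

theorem pderiv_G (R : ℝ) (x : Fin (p + q) → ℝ) (ν : Fin (p + q)) :
    pderiv ν (G R) x = -(1 / (2 * R ^ 2)) * lowerCoord x ν := by
  rw [pderiv, (hasFDerivAt_G R x).fderiv, lowerCoord, raise_eta]
  simp only [neg_apply, smul_apply, sum_apply,
    ContinuousLinearMap.proj_apply, smul_eq_mul, zsmul_eq_mul]
  rw [Finset.sum_eq_single ν]
  · simp only [Pi.single_eq_same]
    ring
  · intro b _ hb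
    simp [Pi.single_eq_of_ne hb]
  · simp

theorem anholonomy_eq {R : ℝ} {x : Fin (p + q) → ℝ} (hx : G R x ≠ 0) (n m l : Fin (p + q)) :
    anholonomy R x n m l = -(1 / (2 * R ^ 2)) *
      (lowerCoord x n * (if m = l then 1 else 0) - lowerCoord x m * (if n = l then 1 else 0)) := by
  have hfr : ∀ ν μ m : Fin (p + q), pderiv ν (fun z => frame R z μ m) x =
      if μ = m then -(1 / (2 * R ^ 2)) * lowerCoord x ν else 0 := by
    intro ν μ m
    by_cases h : μ = m
    · simp only [frame, h, if_true]
      exact pderiv_G R x ν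
    · simp [frame, h, pderiv]
  unfold anholonomy
  simp only [hfr, coframe]
  rw [Finset.sum_eq_single l]
  · simp only [frame, ite_mul, zero_mul, Finset.sum_ite_eq', Finset.mem_univ, if_true,
      @eq_comm _ l]
    split_ifs <;> field_simp <;> ring
  · intro b _ hb
    simp [hb]
  · simp

theorem spinConn_eq {R : ℝ} {x : Fin (p + q) → ℝ} (hx : G R x ≠ 0) (k n m : Fin (p + q)) :
    spinConn R x k n m = -(1 / (2 * R ^ 2)) *
      (lowerCoord x n * (eta p q m k : ℝ) - lowerCoord x m * (eta p q n k : ℝ)) := by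
  have hE : ∀ a b c : Fin (p + q), anholonomyLow R x a b c = -(1 / (2 * R ^ 2)) *
      (lowerCoord x a * (eta p q b c : ℝ) - lowerCoord x b * (eta p q a c : ℝ)) := by
    intro a b c
    rw [anholonomyLow, raise_eta, anholonomy_eq hx, zsmul_eq_mul]
    simp only [eta, Matrix.diagonal_apply]
    by_cases h1 : b = c <;> by_cases h2 : a = c <;> simp [h1, h2] <;> ring
  have hs : ∀ a b : Fin (p + q), eta p q a b = eta p q b a := by
    intro a b
    simp only [eta, Matrix.diagonal_apply, @eq_comm _ a b]
    split_ifs with h <;> simp [h]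
  simp only [spinConn, hE, hs k m, hs n m, hs k n]
  ring

theorem differentiableAt_G (R : ℝ) (x : Fin (p + q) → ℝ) : DifferentiableAt ℝ (G R) x :=
  (hasFDerivAt_G R x).differentiableAt

/-- The chart lands in the pseudosphere `X^A X^B η_{AB} = -R²`. -/
theorem embedding_mem {R : ℝ} (hR : 0 < R) {x : Fin (p + q) → ℝ} (hx : G R x ≠ 0) :
    ∑ A, ∑ B, embedding R x A * embedding R x B * (etaAmb p q A B : ℝ) = -R ^ 2 := by
  have h1 : ∀ A : Fin (p + q + 1), ∑ B, embedding R x A * embedding R x B * (etaAmb p q A B : ℝ) =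
      embedding R x A ^ 2 *
        ((Fin.lastCases (motive := fun _ => ℤ) (-1) (etaSign p q) A : ℤ) : ℝ) := by
    intro A
    rw [Finset.sum_eq_single A]
    · simp only [etaAmb, Matrix.diagonal_apply_eq, sq]
    · intro b _ hb
      simp [etaAmb, Matrix.diagonal_apply_ne' _ hb]
    · simp
  rw [Finset.sum_congr rfl fun A _ => h1 A]
  simp only [Fin.sum_univ_castSucc, embedding, Fin.lastCases_castSucc, Fin.lastCases_last]
  have h2 : ∑ i : Fin (p + q), (x i / G R x) ^ 2 * (etaSign p q i : ℝ) =
      sqForm x / G R x ^ 2 := by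
    rw [sqForm_eq, Finset.sum_div]
    refine Finset.sum_congr rfl fun i _ => ?_
    ring
  rw [h2]
  have h3 : sqForm x = 4 * R ^ 2 * (1 - G R x) := by
    unfold G
    field_simp
    ring
  rw [h3]
  field_simp
  push_cast
  ring

/-- The metric `g_{μν}` is the one induced from `ℝ^{p+1,q}`. -/
theorem embedding_metric {R : ℝ} (hR : 0 < R) {x : Fin (p + q) → ℝ} (hx : G R x ≠ 0)
    (μ ν : Fin (p + q)) :
    ∑ A, ∑ B, pderiv μ (fun z => embedding R z A) x * pderiv ν (fun z => embedding R z B) x *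
      (etaAmb p q A B : ℝ) = metric R x μ ν := by
  have h1 : ∀ A : Fin (p + q + 1), ∑ B, pderiv μ (fun z => embedding R z A) x *
      pderiv ν (fun z => embedding R z B) x * (etaAmb p q A B : ℝ) =
      pderiv μ (fun z => embedding R z A) x * pderiv ν (fun z => embedding R z A) x *
        ((Fin.lastCases (motive := fun _ => ℤ) (-1) (etaSign p q) A : ℤ) : ℝ) := by
    intro A
    rw [Finset.sum_eq_single A]
    · simp [etaAmb]
    · intro b _ hb
      simp [etaAmb, Matrix.diagonal_apply_ne' _ hb]
    · simp
  have hinv : HasFDerivAt (fun z : Fin (p + q) → ℝ => (G R z)⁻¹)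
      (-(G R x ^ 2)⁻¹ • fderiv ℝ (G R) x) x :=
    (hasDerivAt_inv hx).comp_hasFDerivAt x (differentiableAt_G R x).hasFDerivAt
  have hn : ∀ (μ n : Fin (p + q)), pderiv μ (fun z => embedding R z n.castSucc) x =
      (if n = μ then 1 else 0) * (G R x)⁻¹ - x n * (G R x ^ 2)⁻¹ *
        (-(1 / (2 * R ^ 2)) * lowerCoord x μ) := by
    intro μ n
    rw [← pderiv_G]
    simp only [embedding, Fin.lastCases_castSucc, div_eq_mul_inv]
    have h := ((ContinuousLinearMap.proj (R := ℝ) (φ := fun _ : Fin (p + q) => ℝ) n).hasFDerivAt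
      (x := x)).mul hinv
    have h' : HasFDerivAt (fun z : Fin (p + q) → ℝ => z n * (G R z)⁻¹) _ x := h
    simp only [pderiv]
    rw [h'.fderiv]
    simp [Pi.single_apply]
    ring
  have hl : ∀ μ : Fin (p + q), pderiv μ (fun z => embedding R z (Fin.last (p + q))) x =
      -(2 * R * (G R x ^ 2)⁻¹ * (-(1 / (2 * R ^ 2)) * lowerCoord x μ)) := by
    intro μ
    rw [← pderiv_G]
    have he : (fun z : Fin (p + q) → ℝ => embedding R z (Fin.last (p + q))) = fun z =>
        R * ((2 - G R z) * (G R z)⁻¹) := by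
      funext z
      simp only [embedding, Fin.lastCases_last, G]
      ring
    have h := (((differentiableAt_G R x).hasFDerivAt.const_sub 2).mul hinv).const_mul R
    have h' : HasFDerivAt (fun z : Fin (p + q) → ℝ => R * ((2 - G R z) * (G R z)⁻¹)) _ x := h
    rw [he]
    simp only [pderiv]
    rw [h'.fderiv]
    simp
    field_simp
    ring
  simp only [h1, Fin.sum_univ_castSucc, hn, hl, Fin.lastCases_castSucc, Fin.lastCases_last]
  have key : ∀ c d : ℝ, ∑ i : Fin (p + q),
      ((if i = μ then 1 else 0) * (G R x)⁻¹ - x i * (G R x ^ 2)⁻¹ * c) *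
      ((if i = ν then 1 else 0) * (G R x)⁻¹ - x i * (G R x ^ 2)⁻¹ * d) * (etaSign p q i : ℝ) =
      (eta p q μ ν : ℝ) * (G R x)⁻¹ ^ 2 - lowerCoord x μ * (G R x)⁻¹ * (G R x ^ 2)⁻¹ * d
        - lowerCoord x ν * (G R x)⁻¹ * (G R x ^ 2)⁻¹ * c
        + sqForm x * (G R x ^ 2)⁻¹ ^ 2 * c * d := by
    intro c d
    have e1 : (eta p q μ ν : ℝ) * (G R x)⁻¹ ^ 2 = ∑ i : Fin (p + q), (if i = μ then 1 else 0) *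
        (if i = ν then 1 else 0) * (etaSign p q i : ℝ) * (G R x)⁻¹ ^ 2 := by
      by_cases h : μ = ν
      · simp [eta, h]
      · simp [eta, h, Ne.symm h]
    have e2 : ∀ (μ : Fin (p + q)) (r : ℝ), lowerCoord x μ * r = ∑ i : Fin (p + q),
        (if i = μ then 1 else 0) * (etaSign p q i : ℝ) * x i * r := by
      intro μ r
      simp [lowerCoord, raise_eta]
    rw [e1, mul_assoc (lowerCoord x μ), mul_assoc (lowerCoord x μ), e2 μ,
      mul_assoc (lowerCoord x ν), mul_assoc (lowerCoord x ν), e2 ν,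
      sqForm_eq, Finset.sum_mul, Finset.sum_mul, Finset.sum_mul, ← Finset.sum_sub_distrib,
      ← Finset.sum_sub_distrib, ← Finset.sum_add_distrib]
    refine Finset.sum_congr rfl fun i _ => ?_
    ring
  rw [key]
  have h3 : sqForm x = 4 * R ^ 2 * (1 - G R x) := by
    unfold G
    field_simp
    ring
  rw [h3, metric]
  push_cast
  field_simp
  ring

/-- The frame fields are orthonormal: `e^μ_n e^ν_m g_{μν} = η_{nm}`. -/
theorem frame_orthonormal {R : ℝ} {x : Fin (p + q) → ℝ} (hx : G R x ≠ 0) (n m : Fin (p + q)) :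
    ∑ μ, ∑ ν, frame R x μ n * frame R x ν m * metric R x μ ν = (eta p q n m : ℝ) := by
  simp [frame, metric]
  field_simp

/-! ### Spaces of functions `Ψ(x, 𝔶)` -/

/-- An open set of points of the stereographic chart of the pseudosphere of radius `R`. -/
structure ChartDomain (p q : ℕ) (R : ℝ) where
  carrier : Set (Fin (p + q) → ℝ)
  isOpen : IsOpen carrier
  G_ne_zero : ∀ x ∈ carrier, G R x ≠ 0

variable {R : ℝ} {𝕜 : Type*} [RCLike 𝕜] {C : ChartDomain p q R} {Y : Type*}

/-- The function `x ↦ Ψ(x, 𝔶)`, extended by zero outside of the (open) domain. -/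
noncomputable def slice (Ψ : C.carrier → Y → 𝕜) (y : Y) : (Fin (p + q) → ℝ) → 𝕜 :=
  Function.extend Subtype.val (fun x => Ψ x y) 0

/-- `(∂_μ Ψ)(x, 𝔶)`. -/
noncomputable def partialX (μ : Fin (p + q)) (Ψ : C.carrier → Y → 𝕜) : C.carrier → Y → 𝕜 :=
  fun x y => pderiv μ (slice Ψ y) x

/-- `f(x) Ψ(x, 𝔶)` for a real function `f` of the coordinates. -/
def mulX (f : (Fin (p + q) → ℝ) → ℝ) (Ψ : C.carrier → Y → 𝕜) : C.carrier → Y → 𝕜 :=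
  fun x y => (f x : 𝕜) * Ψ x y

/-- A space of functions `Ψ(x, 𝔶)`, smooth in `x`, on which the coordinates and their derivatives
act. The additional variables `𝔶` range over an arbitrary set `Y`, and the dependence on `𝔶` is
restricted only by membership in the space. -/
structure FieldSpace (𝕜 : Type*) [RCLike 𝕜] {p q : ℕ} {R : ℝ} (C : ChartDomain p q R)
    (Y : Type*) where
  carrier : Submodule 𝕜 (C.carrier → Y → 𝕜)
  contDiffOn : ∀ Ψ ∈ carrier, ∀ y, ContDiffOn ℝ ∞ (slice Ψ y) C.carrier
  coord_mem : ∀ Ψ ∈ carrier, ∀ μ, mulX (fun x => x μ) Ψ ∈ carrier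
  partial_mem : ∀ Ψ ∈ carrier, ∀ μ, partialX μ Ψ ∈ carrier

/-- Operators on a space of functions. -/
abbrev FieldSpace.Op (F : FieldSpace 𝕜 C Y) : Type _ := Module.End 𝕜 F.carrier

theorem slice_differentiableAt (F : FieldSpace 𝕜 C Y) {Ψ : C.carrier → Y → 𝕜}
    (hΨ : Ψ ∈ F.carrier) (y : Y) (x : C.carrier) : DifferentiableAt ℝ (slice Ψ y) x :=
  ((F.contDiffOn Ψ hΨ y).contDiffAt (C.isOpen.mem_nhds x.2)).differentiableAt (by simp)

theorem slice_add (Ψ Φ : C.carrier → Y → 𝕜) (y : Y) :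
    slice (Ψ + Φ) y = slice Ψ y + slice Φ y := by
  funext x
  by_cases hx : x ∈ C.carrier
  · lift x to C.carrier using hx
    simp [slice]
  · have h : ¬ ∃ a : C.carrier, a.1 = x := by
      rintro ⟨a, rfl⟩
      exact hx a.2
    simp [slice, Function.extend_apply' _ _ _ h]

theorem slice_smul (c : 𝕜) (Ψ : C.carrier → Y → 𝕜) (y : Y) :
    slice (c • Ψ) y = c • slice Ψ y := by
  funext x
  by_cases hx : x ∈ C.carrier
  · lift x to C.carrier using hx
    simp [slice]
  · have h : ¬ ∃ a : C.carrier, a.1 = x := by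
      rintro ⟨a, rfl⟩
      exact hx a.2
    simp [slice, Function.extend_apply' _ _ _ h]

namespace FieldSpace

/-- The operator `∂_μ`. -/
noncomputable def partialOp (F : FieldSpace 𝕜 C Y) (μ : Fin (p + q)) : F.Op where
  toFun Ψ := ⟨partialX μ Ψ.1, F.partial_mem _ Ψ.2 μ⟩
  map_add' Ψ Φ := by
    ext x y
    simp only [partialX, pderiv, Submodule.coe_add, Pi.add_apply, slice_add]
    rw [fderiv_add (slice_differentiableAt F Ψ.2 y x) (slice_differentiableAt F Φ.2 y x)]
    simp
  map_smul' c Ψ := by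
    ext x y
    simp only [partialX, pderiv, Submodule.coe_smul, Pi.smul_apply, slice_smul, RingHom.id_apply]
    rw [fderiv_const_smul (slice_differentiableAt F Ψ.2 y x)]
    simp

/-- Real functions of the coordinates that act on the space `F` by multiplication. -/
def IsMultiplier (F : FieldSpace 𝕜 C Y) (f : (Fin (p + q) → ℝ) → ℝ) : Prop :=
  ∀ Ψ ∈ F.carrier, mulX f Ψ ∈ F.carrier

/-- Multiplication by a function of the coordinates. -/
def mulOp (F : FieldSpace 𝕜 C Y) (f : (Fin (p + q) → ℝ) → ℝ) (hf : F.IsMultiplier f) : F.Op where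
  toFun Ψ := ⟨mulX f Ψ.1, hf _ Ψ.2⟩
  map_add' Ψ Φ := by
    ext x y
    simp [mulX, mul_add]
  map_smul' c Ψ := by
    ext x y
    simp [mulX, mul_left_comm]

theorem isMultiplier_coord (F : FieldSpace 𝕜 C Y) (μ : Fin (p + q)) :
    F.IsMultiplier fun x => x μ := fun Ψ hΨ => F.coord_mem Ψ hΨ μ

theorem isMultiplier_const (F : FieldSpace 𝕜 C Y) (c : ℝ) : F.IsMultiplier fun _ => c :=
  fun _ hΨ => F.carrier.smul_mem (c : 𝕜) hΨ

theorem IsMultiplier.add {F : FieldSpace 𝕜 C Y} {f g : (Fin (p + q) → ℝ) → ℝ}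
    (hf : F.IsMultiplier f) (hg : F.IsMultiplier g) : F.IsMultiplier fun x => f x + g x := by
  intro Ψ hΨ
  have h : mulX (fun x => f x + g x) Ψ = mulX f Ψ + mulX g Ψ := by
    funext x y
    simp [mulX, add_mul]
  rw [h]
  exact F.carrier.add_mem (hf Ψ hΨ) (hg Ψ hΨ)

theorem IsMultiplier.mul {F : FieldSpace 𝕜 C Y} {f g : (Fin (p + q) → ℝ) → ℝ}
    (hf : F.IsMultiplier f) (hg : F.IsMultiplier g) : F.IsMultiplier fun x => f x * g x := by
  intro Ψ hΨ
  have h : mulX (fun x => f x * g x) Ψ = mulX f (mulX g Ψ) := by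
    funext x y
    simp [mulX, mul_assoc]
  rw [h]
  exact hf _ (hg Ψ hΨ)

theorem isMultiplier_sum (F : FieldSpace 𝕜 C Y) {ι : Type*} (s : Finset ι)
    {f : ι → (Fin (p + q) → ℝ) → ℝ} (hf : ∀ i, F.IsMultiplier (f i)) :
    F.IsMultiplier fun x => ∑ i ∈ s, f i x := by
  classical
  induction s using Finset.induction_on with
  | empty => simpa using F.isMultiplier_const 0
  | insert a s ha ih =>
    simp only [Finset.sum_insert ha]
    exact (hf a).add ih

theorem IsMultiplier.congr {F : FieldSpace 𝕜 C Y} {f g : (Fin (p + q) → ℝ) → ℝ}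
    (hg : F.IsMultiplier g) (h : ∀ x ∈ C.carrier, f x = g x) : F.IsMultiplier f := by
  intro Ψ hΨ
  have h : mulX f Ψ = mulX g Ψ := by
    funext x y
    simp [mulX, h x.1 x.2]
  rw [h]
  exact hg Ψ hΨ

theorem isMultiplier_lowerCoord (F : FieldSpace 𝕜 C Y) (n : Fin (p + q)) :
    F.IsMultiplier fun x => lowerCoord x n :=
  ((F.isMultiplier_const (etaSign p q n)).mul (F.isMultiplier_coord n)).congr fun x _ => by
    simp [lowerCoord, raise_eta]

theorem isMultiplier_frame (F : FieldSpace 𝕜 C Y) (μ n : Fin (p + q)) :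
    F.IsMultiplier fun x => frame R x μ n := by
  by_cases h : μ = n
  · refine IsMultiplier.congr (g := fun x => 1 + (-(4 * R ^ 2)⁻¹) *
      ∑ μ, (etaSign p q μ : ℝ) * (x μ * x μ)) ?_ ?_
    · exact (F.isMultiplier_const 1).add ((F.isMultiplier_const _).mul
        (F.isMultiplier_sum _ fun i => (F.isMultiplier_const _).mul
          ((F.isMultiplier_coord i).mul (F.isMultiplier_coord i))))
    · intro x _
      simp only [frame, h, if_true, G, sqForm_eq, pow_two, div_eq_mul_inv]
      ring
  · simpa [frame, h] using F.isMultiplier_const 0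

theorem isMultiplier_spinConn (F : FieldSpace 𝕜 C Y) (k n m : Fin (p + q)) :
    F.IsMultiplier fun x => spinConn R x k n m := by
  refine IsMultiplier.congr (g := fun x => -(1 / (2 * R ^ 2)) *
    (lowerCoord x n * (eta p q m k : ℝ) + (-1) * (lowerCoord x m * (eta p q n k : ℝ)))) ?_ ?_
  · exact (F.isMultiplier_const _).mul (((F.isMultiplier_lowerCoord n).mul
      (F.isMultiplier_const _)).add ((F.isMultiplier_const _).mul
        ((F.isMultiplier_lowerCoord m).mul (F.isMultiplier_const _))))
  · intro x hx
    rw [spinConn_eq (C.G_ne_zero x hx)]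
    ring

/-! ### Generators and covariant derivative -/

/-- Multiplication by `x_n`. -/
noncomputable def coordOp (F : FieldSpace 𝕜 C Y) (n : Fin (p + q)) : F.Op :=
  F.mulOp (fun x => lowerCoord x n) (F.isMultiplier_lowerCoord n)

/-- The vielbein `e_n = e^μ_n ∂_μ`. -/
noncomputable def vielbein (F : FieldSpace 𝕜 C Y) (n : Fin (p + q)) : F.Op :=
  ∑ μ, F.mulOp (fun x => frame R x μ n) (F.isMultiplier_frame μ n) * F.partialOp μ

/-- Multiplication by `w_{knm}`. -/
noncomputable def spinConnOp (F : FieldSpace 𝕜 C Y) (k n m : Fin (p + q)) : F.Op :=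
  F.mulOp (fun x => spinConn R x k n m) (F.isMultiplier_spinConn k n m)

/-- `M_{mn}` is the spin part of the generators: an antisymmetric family of operators which commute
with the coordinates and their derivatives and satisfy the `𝔰𝔬(p,q)` relations. -/
structure IsSpinPart (F : FieldSpace 𝕜 C Y) (M : Fin (p + q) → Fin (p + q) → F.Op) : Prop where
  antisymm : ∀ m n, M m n = -M n m
  comm_coord : ∀ m n k, M m n * F.coordOp k = F.coordOp k * M m n
  comm_partial : ∀ m n k, M m n * F.partialOp k = F.partialOp k * M m n
  bracket : ∀ m n k l, M m n * M k l - M k l * M m n =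
    eta p q n k • M m l + eta p q m l • M n k - eta p q n l • M m k - eta p q m k • M n l

variable (F : FieldSpace 𝕜 C Y) (M : Fin (p + q) → Fin (p + q) → F.Op)

/-- `J_{mn} = x_m ∂_n - x_n ∂_m + M_{mn}`. -/
noncomputable def genJ (m n : Fin (p + q)) : F.Op :=
  F.coordOp m * F.partialOp n - F.coordOp n * F.partialOp m + M m n

/-- `P_n = e_n - ½ w_{nkl} J^{kl}`. -/
noncomputable def genP (n : Fin (p + q)) : F.Op :=
  F.vielbein n - (1 / 2 : 𝕜) • ∑ k, ∑ l, F.spinConnOp n k l * raise₂ (eta p q) (F.genJ M) k l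

/-- The generators `J_{AB}` of `𝔰𝔬(p+1,q)`: the `J_{mn}` together with
`J_{nD} = -J_{Dn} = R P_n` and `J_{DD} = 0`. -/
noncomputable def genAmb : Fin (p + q + 1) → Fin (p + q + 1) → F.Op :=
  Fin.lastCases
    (Fin.lastCases 0 fun n => -((R : 𝕜) • F.genP M n))
    (fun m => Fin.lastCases ((R : 𝕜) • F.genP M m) fun n => F.genJ M m n)

/-- The Casimir operator `𝒞_{2n}` of `𝔰𝔬(p+1,q)`; the metric `η_{AB}` has `p+1` negative entries. -/
noncomputable def casimirOp (n : ℕ) : F.Op :=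
  casimir 𝕜 (etaAmb p q) (p + 1) n (F.genAmb M)

/-- The covariant derivative `𝒟_n = e_n + ½ w_{nkl} M^{kl}`. -/
noncomputable def covD (n : Fin (p + q)) : F.Op :=
  F.vielbein n + (1 / 2 : 𝕜) • ∑ k, ∑ l, F.spinConnOp n k l * raise₂ (eta p q) M k l

/-- `𝒟_m 𝒟_n + w_{mnl} 𝒟^l`. -/
noncomputable def covD₂ (m n : Fin (p + q)) : F.Op :=
  F.covD M m * F.covD M n + ∑ l, F.spinConnOp m n l * raise (eta p q) (F.covD M) l

/-- `(𝒟)² = η^{mn} (𝒟_m 𝒟_n + w_{mnl} 𝒟^l)`. -/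
noncomputable def covDSq : F.Op := ∑ m, ∑ n, eta p q m n • F.covD₂ M m n

/-- `(𝒟₍₁₎)² = M^{km} M_k^n (𝒟_m 𝒟_n + w_{mnl} 𝒟^l)`. -/
noncomputable def covDSq₁ : F.Op :=
  ∑ k, ∑ m, ∑ n, raise₂ (eta p q) M k m * raise (eta p q) (M k) n * F.covD₂ M m n

/-- `(𝒟₍₂₎)² = M^k_d M^{dm} M_{kr} M^{rn} (𝒟_m 𝒟_n + w_{mnl} 𝒟^l)`. -/
noncomputable def covDSq₂ : F.Op :=
  ∑ k, ∑ d, ∑ m, ∑ r, ∑ n,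
    raise (eta p q) (fun a => M a d) k * raise₂ (eta p q) M d m * M k r *
      raise₂ (eta p q) M r n * F.covD₂ M m n

/-- `M₍₂₎ = M_{mn} M^{nm}`. -/
def spin₂ : F.Op := ∑ m, ∑ n, M m n * raise₂ (eta p q) M n m

/-- `M₍₄₎ = M_{mn} M^{nk} M_{kl} M^{lm}`. -/
def spin₄ : F.Op :=
  ∑ m, ∑ n, ∑ k, ∑ l, M m n * raise₂ (eta p q) M n k * M k l * raise₂ (eta p q) M l m

/-- `M₍₆₎ = M_{mn} M^{nk} M_{kl} M^{lr} M_{rs} M^{sm}`. -/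
def spin₆ : F.Op :=
  ∑ m, ∑ n, ∑ k, ∑ l, ∑ r, ∑ s,
    M m n * raise₂ (eta p q) M n k * M k l * raise₂ (eta p q) M l r * M r s *
      raise₂ (eta p q) M s m

/-- `𝒪₄(M) = (-1)^{p+1} (⅛ (D-2)(D+1) M₍₂₎ + ⅛ M₍₂₎² - ¼ M₍₄₎)`, with `D = p + q`. -/
noncomputable def spinO₄ : F.Op :=
  let D : 𝕜 := (p : 𝕜) + q
  (-1 : 𝕜) ^ (p + 1) • (((D - 2) * (D + 1) / 8) • F.spin₂ M + (1 / 8 : 𝕜) • F.spin₂ M ^ 2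
    - (1 / 4 : 𝕜) • F.spin₄ M)

/-- `𝒪₆(M) = (-1)^p (γ₂ M₍₂₎ + γ₂,₂ M₍₂₎² + γ₄ M₍₄₎ - M₍₂₎³/48 + M₍₂₎ M₍₄₎/8 - M₍₆₎/6)`, with
`D = p + q` and
`γ₂ = -(D⁴ - 6D³ + 13D² - 8D - 4)/12`, `γ₂,₂ = (-3D² + D - 2)/48`, `γ₄ = (2D² - 5D + 5)/6`. -/
noncomputable def spinO₆ : F.Op :=
  let D : 𝕜 := (p : 𝕜) + q
  let γ₂ : 𝕜 := -(D ^ 4 - 6 * D ^ 3 + 13 * D ^ 2 - 8 * D - 4) / 12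
  let γ₂₂ : 𝕜 := (-3 * D ^ 2 + D - 2) / 48
  let γ₄ : 𝕜 := (2 * D ^ 2 - 5 * D + 5) / 6
  (-1 : 𝕜) ^ p • (γ₂ • F.spin₂ M + γ₂₂ • F.spin₂ M ^ 2 + γ₄ • F.spin₄ M
    - (1 / 48 : 𝕜) • F.spin₂ M ^ 3 + (1 / 8 : 𝕜) • (F.spin₂ M * F.spin₄ M)
    - (1 / 6 : 𝕜) • F.spin₆ M)

end FieldSpace

end Pseudosphere

/-! The Casimir sum is an antisymmetrised contraction, so a pseudo-orthogonal change of the ambient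
basis with scalar coefficients leaves it unchanged (`casimirSum_rotate`). At each point of the chart
take the basis formed by the orthonormal frame and the normalised radius vector (`frameMatrix`). In
this basis the rotated `J_{mn}` fix the point: their orbital part vanishes there and only `M_{mn}`
remains, while the rotated `J_{nD}` becomes `R 𝒟_n`. The product of two rotated translations, in
reversed order, evaluates to `R² (𝒟_m 𝒟_n + w_{mnl} 𝒟^l)` (`IsEvalAt.map_frameGen_mul_eq`); here the
derivative in the left factor acts on the coefficient functions of the right one, and the resulting
terms combine into the connection term. "Value at a point" means the class of an operator modulo the
right ideal generated by the `x_k - a_k`; operators that agree modulo these ideals at all points of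
the chart are equal (`FieldSpace.eq_of_mkQ_eq`).

What remains is an identity that uses only the orthogonal Lie algebra relations (`casimirSum_eq`):
the Casimir sum is to be written with spin generators on the left and at most two translations on
the right. Over the algebraic closure, rescaling by square roots of the metric signs makes the
metric Euclidean. There the antisymmetrised products are ordered noncommutative Pfaffians `pf₄` and
`pf₆`, with shifts produced by the commutators (`six_self`, `sum_pairs`). Antisymmetrised sums
vanish on coincident indices, so the last index fills at most one slot of a multi-index, and by
symmetry all slots contribute equally. The contractions become traces and quadratic forms in powers
of the matrix `X` of spin generators (`IsSO.sum_mul_six`, `IsSO.sum_mul_pf₆`, `trace_mul_wedge`).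
The recursion for transposes of powers, `IsSO.transpose_pow_succ`, removes the odd traces. Every
lower-order coefficient in the final formulas comes from such reorderings. -/

namespace Pseudosphere

/-! ### Laplace expansion of the antisymmetrizer -/

section Laplace

variable {κ A : Type*} [DecidableEq κ]

theorem antisymmetrizer_eq_det {N : ℕ} (k m : Fin N → κ) :
    antisymmetrizer k m =
      (Matrix.of fun i j => if k j = m i then (1 : ℤ) else 0).det := by
  simp [antisymmetrizer, Matrix.det_apply']

theorem antisymmetrizer_succ {N : ℕ} (k m : Fin (N + 1) → κ) :
    antisymmetrizer k m = ∑ j : Fin (N + 1), (-1) ^ (j : ℕ) * (if k j = m 0 then 1 else 0) *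
      antisymmetrizer (fun i => k (j.succAbove i)) (fun i => m i.succ) := by
  simp only [antisymmetrizer_eq_det]
  rw [Matrix.det_succ_row_zero]
  rfl

theorem antisymmetrizer_perm {N : ℕ} (k m : Fin N → κ) (σ : Equiv.Perm (Fin N)) :
    antisymmetrizer (k ∘ σ) m = (Equiv.Perm.sign σ : ℤ) * antisymmetrizer k m := by
  simp only [antisymmetrizer_eq_det]
  exact Matrix.det_permute' σ (Matrix.of fun i j => if k j = m i then (1 : ℤ) else 0)

theorem antisymmetrizer_eq_zero {N : ℕ} (k m : Fin N → κ) {i j : Fin N} (hij : i ≠ j)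
    (h : k i = k j) : antisymmetrizer k m = 0 := by
  rw [antisymmetrizer_eq_det]
  exact Matrix.det_zero_of_column_eq hij fun r => by simp [h]

theorem sum_fin_succ_fun {κ M : Type*} [Fintype κ] [AddCommMonoid M] {N : ℕ}
    (f : (Fin (N + 1) → κ) → M) :
    ∑ k, f k = ∑ a, ∑ k : Fin N → κ, f (Matrix.vecCons a k) := by
  rw [← Fintype.sum_prod_type', ← (Fin.consEquiv fun _ : Fin (N + 1) => κ).sum_comp]
  rfl

variable [Fintype κ]

/-- The sum `∑_m 𝒜^{k}_{m} f(m)`. -/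
def altSum [AddCommGroup A] {N : ℕ} (f : (Fin N → κ) → A) (k : Fin N → κ) : A :=
  ∑ m, antisymmetrizer k m • f m

theorem altSum_perm [AddCommGroup A] {N : ℕ} (f : (Fin N → κ) → A) (k : Fin N → κ)
    (σ : Equiv.Perm (Fin N)) :
    altSum f (k ∘ σ) = (Equiv.Perm.sign σ : ℤ) • altSum f k := by
  simp only [altSum, antisymmetrizer_perm, mul_smul, Finset.smul_sum]

theorem altSum_eq_zero [AddCommGroup A] {N : ℕ} (f : (Fin N → κ) → A) (k : Fin N → κ)
    {i j : Fin N} (hij : i ≠ j) (h : k i = k j) : altSum f k = 0 := by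
  simp [altSum, antisymmetrizer_eq_zero k _ hij h]

/-- Expansion of the determinant along the row of the first lower index; the delta sets this index
to `k j`. -/
theorem altSum_succ [AddCommGroup A] {N : ℕ} (f : (Fin (N + 1) → κ) → A) (k : Fin (N + 1) → κ) :
    altSum f k = ∑ j : Fin (N + 1), (-1 : ℤ) ^ (j : ℕ) •
      altSum (fun m => f (Matrix.vecCons (k j) m)) (fun i => k (j.succAbove i)) := by
  simp only [altSum, antisymmetrizer_succ, Finset.sum_smul, sum_fin_succ_fun (N := N)]
  simp only [Matrix.cons_val_zero, Matrix.cons_val_succ, Finset.smul_sum]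
  rw [Finset.sum_congr rfl fun a _ => Finset.sum_comm, Finset.sum_comm]
  refine Finset.sum_congr rfl fun j _ => ?_
  rw [Finset.sum_comm]
  refine Finset.sum_congr rfl fun m _ => ?_
  rw [Finset.sum_eq_single (k j)]
  · simp [mul_smul]
  · intro b _ hb
    simp [hb.symm]
  · simp

theorem altSum_zero [AddCommGroup A] (f : (Fin 0 → κ) → A) (k : Fin 0 → κ) :
    altSum f k = f k := by
  simp [altSum, antisymmetrizer, Subsingleton.elim default k]

theorem altSum_mul_left [Ring A] {N : ℕ} (a : A) (f : (Fin N → κ) → A) (k : Fin N → κ) :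
    altSum (fun m => a * f m) k = a * altSum f k := by
  simp only [altSum, Finset.mul_sum, mul_smul_comm]

theorem pairProd_cons {κ A : Type*} [Ring A] {n : ℕ} (J : κ → κ → A) (a b : κ)
    (m : Fin (2 * n) → κ) :
    pairProd (n := n + 1) J (Matrix.vecCons a (Matrix.vecCons b m) : Fin (2 * n + 2) → κ) =
      J a b * pairProd J m := by
  unfold pairProd
  rw [List.ofFn_succ, List.prod_cons]
  congr 1

theorem pairProd_zero {κ A : Type*} [Ring A] (J : κ → κ → A) (m : Fin (2 * 0) → κ) :
    pairProd (n := 0) J m = 1 := by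
  simp [pairProd]

variable [Ring A]

/-- Two Laplace steps peel off one generator, which gives a recursion on the number of generators.
-/
theorem altSum_pairProd_succ {n : ℕ} (J : κ → κ → A) (k : Fin (2 * n + 2) → κ) :
    altSum (pairProd (n := n + 1) J) k = ∑ i : Fin (2 * n + 2), ∑ j : Fin (2 * n + 1),
      (-1 : ℤ) ^ (i + j : ℕ) • (J (k i) (k (i.succAbove j)) *
        altSum (pairProd (n := n) J) fun r => k (i.succAbove (j.succAbove r))) := by
  rw [altSum_succ (N := 2 * n + 1)]
  refine Finset.sum_congr rfl fun i _ => ?_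
  rw [altSum_succ, Finset.smul_sum]
  refine Finset.sum_congr rfl fun j _ => ?_
  rw [smul_smul, ← pow_add]
  congr 1
  simp only [pairProd_cons, altSum_mul_left]

end Laplace

/-- The Kronecker symbol with integer values. -/
def kd {κ : Type*} [DecidableEq κ] (a b : κ) : ℤ := if a = b then 1 else 0

theorem kd_comm {κ : Type*} [DecidableEq κ] (a b : κ) : kd a b = kd b a := by
  simp [kd, eq_comm]

theorem sum_kd_smul {κ A : Type*} [DecidableEq κ] [Fintype κ] [AddCommGroup A] (a : κ)
    (f : κ → A) : ∑ b, kd a b • f b = f a := by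
  simp [kd]

theorem sum_kd_smul' {κ A : Type*} [DecidableEq κ] [Fintype κ] [AddCommGroup A] (a : κ)
    (f : κ → A) : ∑ b, kd b a • f b = f a := by
  simp [kd]

/-- Generators of the orthogonal Lie algebra of the Euclidean metric. -/
structure IsSO {κ A : Type*} [DecidableEq κ] [Ring A] (J : κ → κ → A) : Prop where
  antisymm : ∀ a b, J a b = -J b a
  diag : ∀ a, J a a = 0
  bracket : ∀ a b c d, J a b * J c d - J c d * J a b =
    kd b c • J a d + kd a d • J b c - kd b d • J a c - kd a c • J b d

/-! ### Ordered noncommutative Pfaffians -/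

section Pfaffian

variable {κ A : Type*} [DecidableEq κ] [Ring A] {J : κ → κ → A}

theorem IsSO.comm (h : IsSO J) (a b c d : κ) : J a b * J c d = J c d * J a b +
    (kd b c • J a d + kd a d • J b c - kd b d • J a c - kd a c • J b d) := by
  rw [← h.bracket]; abel

theorem IsSO.comm_assoc (h : IsSO J) (a b c d : κ) (z : A) :
    J a b * (J c d * z) = J c d * (J a b * z) +
    (kd b c • J a d + kd a d • J b c - kd b d • J a c - kd a c • J b d) * z := by
  rw [← mul_assoc, h.comm, add_mul, mul_assoc]

/-- The ordered antisymmetrised product of two generators. -/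
def pf₄ (J : κ → κ → A) (a b c d : κ) : A :=
  (J a b - kd a b • 1) * J c d - (J a c - kd a c • 1) * J b d + (J a d - kd a d • 1) * J b c

/-- The ordered antisymmetrised product of three generators. -/
def pf₆ (J : κ → κ → A) (a b c d e f : κ) : A :=
  (J a b - (2 * kd a b) • 1) * pf₄ J c d e f - (J a c - (2 * kd a c) • 1) * pf₄ J b d e f
    + (J a d - (2 * kd a d) • 1) * pf₄ J b c e f - (J a e - (2 * kd a e) • 1) * pf₄ J b c d f
    + (J a f - (2 * kd a f) • 1) * pf₄ J b c d e

/-- The six ways of distributing four indices over two antisymmetric tensors. -/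
def six (S T : κ → κ → A) (a b c d : κ) : A :=
  S a b * T c d + S c d * T a b - S a c * T b d - S b d * T a c + S a d * T b c + S b c * T a d

/-- In three of the six products the factors are exchanged so that the generator with index `a`
comes first. The delta terms of these commutators add up to exactly the shifts in `pf₄`. -/
theorem six_self (h : IsSO J) (a b c d : κ) : six J J a b c d = 2 • pf₄ J a b c d := by
  unfold six pf₄
  rw [h.comm c d a b, h.comm b d a c, h.comm b c a d]
  rw [h.antisymm d c, h.antisymm c b, h.antisymm d b, h.antisymm d a, h.antisymm c a, 
    h.antisymm b a, kd_comm d a, kd_comm d b, kd_comm d c, kd_comm c a, kd_comm c b, kd_comm b a]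
  simp only [sub_mul, smul_mul_assoc, one_mul]
  module

/-- The five pairs that contain `a` reproduce `pf₆` up to shifts. In the other ten the generator
with index `a` is moved to the front, where `six_self` regroups them into twice the same terms;
hence the factor three. -/
theorem sum_pairs (h : IsSO J) (a b c d e f : κ) :
    J a b * pf₄ J c d e f - J a c * pf₄ J b d e f + J a d * pf₄ J b c e f - J a e * pf₄ J b c d f
      + J a f * pf₄ J b c d e + J b c * pf₄ J a d e f - J b d * pf₄ J a c e f
      + J b e * pf₄ J a c d f - J b f * pf₄ J a c d e + J c d * pf₄ J a b e f
      - J c e * pf₄ J a b d f + J c f * pf₄ J a b d e + J d e * pf₄ J a b c f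
      - J d f * pf₄ J a b c e + J e f * pf₄ J a b c d = 3 • pf₆ J a b c d e f := by
  have hb := six_self h c d e f
  have hc := six_self h b d e f
  have hd := six_self h b c e f
  have he := six_self h b c d f
  have hf := six_self h b c d e
  have pf_a : ∀ x y z, pf₄ J a x y z = J a x * J y z - kd a x • J y z -
      (J a y * J x z - kd a y • J x z) + (J a z * J x y - kd a z • J x y) := fun x y z => by
    simp only [pf₄, sub_mul, smul_mul_assoc, one_mul]
  simp only [six] at hb hc hd he hf
  rw [pf₆]
  simp only [pf_a]
  -- Of the shift `3 * kd`, one unit is the shift inside the Pfaffians that start with `a`, and two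
  -- units are the commutators met on moving the generator with index `a` to the front.
  have lc := congrArg₂ (· + ·) (congrArg₂ (· + ·) (congrArg₂ (· + ·) (congrArg₂ (· + ·)
    (congrArg ((J a b - (3 * kd a b) • 1) * ·) hb) (congrArg (-(J a c - (3 * kd a c) • 1) * ·) hc))
    (congrArg ((J a d - (3 * kd a d) • 1) * ·) hd)) (congrArg (-(J a e - (3 * kd a e) • 1) * ·) he))
    (congrArg ((J a f - (3 * kd a f) • 1) * ·) hf)
  rw [← sub_eq_zero] at lc ⊢
  rw [← lc]
  clear lc hb hc hd he hf
  simp only [mul_add, mul_sub, sub_mul, neg_mul, mul_smul_comm, smul_mul_assoc, one_mul]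
  simp only [
    h.comm_assoc b c a d, h.comm_assoc b c a e, h.comm_assoc b c a f, h.comm_assoc b d a c,
    h.comm_assoc b d a e, h.comm_assoc b d a f, h.comm_assoc b e a c, h.comm_assoc b e a d,
    h.comm_assoc b e a f, h.comm_assoc b f a c, h.comm_assoc b f a d, h.comm_assoc b f a e,
    h.comm_assoc c d a b, h.comm_assoc c d a e, h.comm_assoc c d a f, h.comm_assoc c e a b,
    h.comm_assoc c e a d, h.comm_assoc c e a f, h.comm_assoc c f a b, h.comm_assoc c f a d,
    h.comm_assoc c f a e, h.comm_assoc d e a b, h.comm_assoc d e a c, h.comm_assoc d e a f,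
    h.comm_assoc d f a b, h.comm_assoc d f a c, h.comm_assoc d f a e, h.comm_assoc e f a b,
    h.comm_assoc e f a c, h.comm_assoc e f a d]
  simp only [add_mul, sub_mul, smul_mul_assoc]
  simp only [
    kd_comm b a, kd_comm c a, kd_comm d a, kd_comm e a, kd_comm f a, kd_comm c b, kd_comm d b,
    kd_comm e b, kd_comm f b, kd_comm d c, kd_comm e c, kd_comm f c, kd_comm e d, kd_comm f d,
    kd_comm f e]
  simp only [
    h.antisymm b a, h.antisymm c a, h.antisymm d a, h.antisymm e a, h.antisymm f a,
    h.antisymm c b, h.antisymm d b, h.antisymm e b, h.antisymm f b, h.antisymm d c,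
    h.antisymm e c, h.antisymm f c, h.antisymm e d, h.antisymm f d, h.antisymm f e, neg_mul]
  module

variable [Fintype κ]

theorem altSum_pairProd_two (h : IsSO J) (k : Fin 2 → κ) :
    altSum (pairProd (n := 1) J) k = 2 • J (k 0) (k 1) := by
  have H : altSum (pairProd (n := 1) J) k = ∑ i : Fin 2, ∑ j : Fin 1,
      (-1 : ℤ) ^ (i + j : ℕ) • (J (k i) (k (i.succAbove j)) *
        altSum (pairProd (n := 0) J) fun r => k (i.succAbove (j.succAbove r))) :=
    altSum_pairProd_succ (n := 0) J k
  rw [H]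
  simp [altSum_zero, pairProd_zero, Fin.sum_univ_two]
  rw [h.antisymm (k 1) (k 0)]
  noncomm_ring

/-- Each pair occurs in both orders and its complement contributes a factor two, so `4 * six = 8 *
pf₄`, where `8 = 2² · 2!`. -/
theorem altSum_pairProd_four (h : IsSO J) (k : Fin 4 → κ) :
    altSum (pairProd (n := 2) J) k = 8 • pf₄ J (k 0) (k 1) (k 2) (k 3) := by
  have H : altSum (pairProd (n := 2) J) k = ∑ i : Fin 4, ∑ j : Fin 3,
      (-1 : ℤ) ^ (i + j : ℕ) • (J (k i) (k (i.succAbove j)) *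
        altSum (pairProd (n := 1) J) fun r => k (i.succAbove (j.succAbove r))) :=
    altSum_pairProd_succ (n := 1) J k
  rw [H]
  simp only [altSum_pairProd_two h]
  simp only [Fin.sum_univ_four, Fin.sum_univ_three]
  simp [Fin.succAbove]
  have H := six_self h (k 0) (k 1) (k 2) (k 3)
  unfold six at H
  rw [h.antisymm (k 1) (k 0), h.antisymm (k 2) (k 0), h.antisymm (k 3) (k 0),
    h.antisymm (k 2) (k 1), h.antisymm (k 3) (k 1), h.antisymm (k 3) (k 2)]
  linear_combination (norm := noncomm_ring) (4 : A) * H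

/-- Each of the fifteen pairs occurs in both orders with `8 • pf₄` of its complement; the factor
three of `sum_pairs` completes `48 = 2³ · 3!`. -/
theorem altSum_pairProd_six (h : IsSO J) (k : Fin 6 → κ) :
    altSum (pairProd (n := 3) J) k = 48 • pf₆ J (k 0) (k 1) (k 2) (k 3) (k 4) (k 5) := by
  have H : altSum (pairProd (n := 3) J) k = ∑ i : Fin 6, ∑ j : Fin 5,
      (-1 : ℤ) ^ (i + j : ℕ) • (J (k i) (k (i.succAbove j)) *
        altSum (pairProd (n := 2) J) fun r => k (i.succAbove (j.succAbove r))) :=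
    altSum_pairProd_succ (n := 2) J k
  rw [H]
  simp only [altSum_pairProd_four h]
  simp only [Fin.sum_univ_six, Fin.sum_univ_five]
  simp [Fin.succAbove]
  have H := sum_pairs h (k 0) (k 1) (k 2) (k 3) (k 4) (k 5)
  rw [h.antisymm (k 1) (k 0), h.antisymm (k 2) (k 0), h.antisymm (k 3) (k 0),
    h.antisymm (k 4) (k 0), h.antisymm (k 5) (k 0), h.antisymm (k 2) (k 1), h.antisymm (k 3) (k 1),
    h.antisymm (k 4) (k 1), h.antisymm (k 5) (k 1), h.antisymm (k 3) (k 2), h.antisymm (k 4) (k 2),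
    h.antisymm (k 5) (k 2), h.antisymm (k 4) (k 3), h.antisymm (k 5) (k 3), h.antisymm (k 5) (k 4)]
  linear_combination (norm := noncomm_ring) (16 : A) * H

end Pfaffian

open Matrix

/-! ### Tensors and invariants under the commutator action -/

section Calculus

variable {ι A : Type*} [DecidableEq ι] [Ring A]

/-- `T` transforms as a tensor of rank two under the commutator with the generators `X`. -/
def IsTensor (X T : Matrix ι ι A) : Prop := ∀ a b c d,
  X a b * T c d - T c d * X a b =
    kd b c • T a d - kd a c • T b d + kd b d • T c a - kd a d • T c b

/-- `c` commutes with the generators `X`. -/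
def IsInvariant (X : Matrix ι ι A) (c : A) : Prop := ∀ a b, X a b * c = c * X a b

variable {X T S : Matrix ι ι A}

theorem IsSO.isTensor (h : IsSO X) : IsTensor X X := fun a b c d => by
  rw [h.bracket, h.antisymm c a, h.antisymm c b]
  module

theorem IsTensor.add (hT : IsTensor X T) (hS : IsTensor X S) : IsTensor X (T + S) :=
  fun a b c d => by
    have h1 := hT a b c d
    have h2 := hS a b c d
    simp only [Matrix.add_apply]
    linear_combination (norm := skip) h1 + h2
    simp only [mul_add, add_mul]
    module

theorem IsTensor.smul (n : ℤ) (hT : IsTensor X T) : IsTensor X (n • T) :=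
  fun a b c d => by
    have h1 := congrArg (n • ·) (hT a b c d)
    simp only [Matrix.smul_apply]
    linear_combination (norm := skip) h1
    simp only [mul_smul_comm, smul_mul_assoc]
    module

theorem IsTensor.sub (hT : IsTensor X T) (hS : IsTensor X S) : IsTensor X (T - S) := by
  have := hT.add (hS.smul (-1))
  rwa [neg_one_smul, ← sub_eq_add_neg] at this

theorem IsTensor.transpose (hT : IsTensor X T) : IsTensor X Tᵀ := fun a b c d => by
  simp only [transpose_apply]
  rw [hT]
  module

theorem isTensor_one : IsTensor X 1 := fun a b c d => by
  have h : ∀ i j : ι, (1 : Matrix ι ι A) i j = kd i j • 1 := fun i j => by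
    simp [kd, Matrix.one_apply]
  simp only [h, mul_smul_comm, smul_mul_assoc, one_mul, mul_one, smul_smul, sub_self]
  rw [kd_comm a d, kd_comm c a, kd_comm c b, kd_comm b d]
  module

theorem IsSO.transpose_eq (h : IsSO X) : Xᵀ = -X := by
  ext a b
  exact h.antisymm b a

variable [Fintype ι]

theorem IsTensor.mul (hT : IsTensor X T) (hS : IsTensor X S) : IsTensor X (T * S) :=
  fun a b c d => by
    have h1 : ∀ e, X a b * (T c e * S e d) - T c e * S e d * X a b =
        (kd b c • T a e - kd a c • T b e + kd b e • T c a - kd a e • T c b) * S e d +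
        T c e * (kd b e • S a d - kd a e • S b d + kd b d • S e a - kd a d • S e b) := fun e => by
      rw [← hT, ← hS]
      noncomm_ring
    simp only [Matrix.mul_apply, Finset.mul_sum, Finset.sum_mul, ← Finset.sum_sub_distrib, h1]
    simp only [mul_add, mul_sub, add_mul, sub_mul, smul_mul_assoc, mul_smul_comm,
      Finset.sum_add_distrib, Finset.sum_sub_distrib, sum_kd_smul, ← Finset.smul_sum]
    abel

theorem IsTensor.pow (hT : IsTensor X T) (k : ℕ) : IsTensor X (T ^ k) := by
  induction k with
  | zero => simpa using isTensor_one
  | succ k ih => rw [pow_succ]; exact ih.mul hT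

theorem IsTensor.trace (hT : IsTensor X T) : IsInvariant X T.trace := fun a b => by
  rw [← sub_eq_zero]
  simp only [Matrix.trace, Matrix.diag_apply, Finset.mul_sum, Finset.sum_mul,
    ← Finset.sum_sub_distrib, hT a b]
  simp only [Finset.sum_add_distrib, Finset.sum_sub_distrib, sum_kd_smul]
  abel

theorem IsInvariant.mul_scalar {c : A} (hc : IsInvariant X c) :
    X * Matrix.scalar ι c = Matrix.scalar ι c * X := by
  ext a b
  simp [hc a b]

theorem trace_scalar_mul (c : A) (T : Matrix ι ι A) :
    (Matrix.scalar ι c * T).trace = c * T.trace := by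
  simp [Matrix.trace, Finset.mul_sum]

theorem trace_scalar (c : A) : (Matrix.scalar ι c).trace = (Fintype.card ι : ℤ) • c := by
  rw [Matrix.scalar_apply, Matrix.trace_diagonal]
  simp

/-- Reversing the order of multiplication by the generators. -/
theorem IsSO.transpose_mul_transpose (h : IsSO X) (hT : IsTensor X T) :
    (Tᵀ * X)ᵀ = ((Fintype.card ι : ℤ) - 1) • T + Tᵀ - Matrix.scalar ι T.trace - X * T := by
  ext a d
  have h1 : (Tᵀ * X)ᵀ a d = -∑ b, T b d * X a b := by
    simp only [transpose_apply, Matrix.mul_apply, ← Finset.sum_neg_distrib]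
    exact Finset.sum_congr rfl fun b _ => by rw [h.antisymm b a, mul_neg]
  -- Under the contraction `kd b b` sums to `card ι` and `kd a b` takes away one copy of `T`, which
  -- is the origin of the coefficient `card ι - 1`.
  have h2 : (X * T) a d - ∑ b, T b d * X a b =
      ∑ b, (kd b b • T a d - kd a b • T b d + kd b d • T b a - kd a d • T b b) := by
    simp only [Matrix.mul_apply, ← Finset.sum_sub_distrib, hT a _ _ d]
  simp only [Finset.sum_add_distrib, Finset.sum_sub_distrib, sum_kd_smul, sum_kd_smul',
    ← Finset.smul_sum, ← Finset.sum_smul] at h2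
  have h3 : (Matrix.scalar ι T.trace) a d = kd a d • ∑ b, T b b := by
    rw [Matrix.scalar_apply, Matrix.diagonal_apply]
    simp [Matrix.trace, kd]
  have h4 : ∑ b : ι, kd b b = (Fintype.card ι : ℤ) := by simp [kd]
  rw [h4] at h2
  simp only [Matrix.sub_apply, Matrix.add_apply, Matrix.smul_apply, h1, h3, transpose_apply]
  linear_combination (norm := skip) h2
  module

/-- The case `T = (X ^ k)ᵀ` of `IsSO.transpose_mul_transpose`. Iterated, it turns every transposed
power into ordinary powers and invariant traces. -/
theorem IsSO.transpose_pow_succ (h : IsSO X) {k l : ℕ} (hl : l = k + 1) :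
    (X ^ l)ᵀ = ((Fintype.card ι : ℤ) - 1) • (X ^ k)ᵀ + X ^ k
      - Matrix.scalar ι (X ^ k).trace - X * (X ^ k)ᵀ := by
  subst hl
  have := h.transpose_mul_transpose (h.isTensor.pow k).transpose
  rwa [transpose_transpose, ← pow_succ, Matrix.trace_transpose] at this

theorem IsSO.isInvariant (h : IsSO X) (k : ℕ) : IsInvariant X (X ^ k).trace :=
  (h.isTensor.pow k).trace

end Calculus

/-! ### Transposes and traces of powers -/

section Powers

variable {ι A : Type*} [DecidableEq ι] [Fintype ι] [Ring A] {X : Matrix ι ι A}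

theorem IsSO.trace_eq_zero (h : IsSO X) : X.trace = 0 :=
  Finset.sum_eq_zero fun a _ => h.diag a

theorem IsSO.transpose_sq (h : IsSO X) :
    (X ^ 2)ᵀ = X ^ 2 - ((Fintype.card ι : ℤ) - 2) • X := by
  have := h.transpose_pow_succ (show 2 = 1 + 1 from rfl)
  rw [pow_one, h.transpose_eq, h.trace_eq_zero, map_zero] at this
  rw [this, pow_two, mul_neg]
  module

theorem IsSO.transpose_cube (h : IsSO X) :
    (X ^ 3)ᵀ = -X ^ 3 + (2 * (Fintype.card ι : ℤ) - 2) • X ^ 2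
      - (((Fintype.card ι : ℤ) - 1) * ((Fintype.card ι : ℤ) - 2)) • X
      - Matrix.scalar ι (X ^ 2).trace := by
  have := h.transpose_pow_succ (show 3 = 2 + 1 from rfl)
  rw [h.transpose_sq] at this
  rw [this]
  simp only [mul_sub, mul_smul_comm, ← pow_succ', ← pow_two]
  module

theorem IsSO.transpose_four (h : IsSO X) :
    (X ^ 4)ᵀ = ((Fintype.card ι : ℤ) - 1) • (X ^ 3)ᵀ + X ^ 3 - Matrix.scalar ι (X ^ 3).trace
      + X ^ 4 - (2 * (Fintype.card ι : ℤ) - 2) • X ^ 3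
      + (((Fintype.card ι : ℤ) - 1) * ((Fintype.card ι : ℤ) - 2)) • X ^ 2
      + Matrix.scalar ι (X ^ 2).trace * X := by
  have := h.transpose_pow_succ (show 4 = 3 + 1 from rfl)
  rw [this]
  -- Only the copy multiplied by `X` is expanded; the other one stays folded until traces are taken.
  nth_rw 2 [h.transpose_cube]
  simp only [mul_sub, mul_add, mul_neg, mul_smul_comm, ← pow_succ', ← pow_two,
    (h.isInvariant 2).mul_scalar]
  module

/-- A trace is unchanged by transposition, whereas the transposed cube starts with `-X ^ 3`;
comparing the two lowers the degree. -/
theorem IsSO.trace_cube (h : IsSO X) :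
    2 • (X ^ 3).trace = ((Fintype.card ι : ℤ) - 2) • (X ^ 2).trace := by
  have := congrArg Matrix.trace h.transpose_cube
  simp only [Matrix.trace_transpose, Matrix.trace_sub, Matrix.trace_add, Matrix.trace_smul,
    Matrix.trace_neg, h.trace_eq_zero] at this
  rw [trace_scalar] at this
  linear_combination (norm := skip) this
  module

/-- The traces of `X ^ 4` on the right cancel. As `(X ^ 4)ᵀ` starts with `X ^ 4`, the last term is
minus the left side up to lower degree, so the relation can be solved for the trace of the fifth
power, as in `IsSO.trace_five'`. -/
theorem IsSO.trace_five (h : IsSO X) :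
    (X ^ 5).trace = ((Fintype.card ι : ℤ) - 1) • (X ^ 4).trace
      + (X ^ 4).trace - (Fintype.card ι : ℤ) • (X ^ 4).trace - (X * (X ^ 4)ᵀ).trace := by
  rw [← Matrix.trace_transpose (X ^ 5), h.transpose_pow_succ (show 5 = 4 + 1 from rfl),
    Matrix.trace_sub, Matrix.trace_sub, Matrix.trace_add, Matrix.trace_smul,
    Matrix.trace_transpose (X ^ 4), trace_scalar]

end Powers

/-! ### Contraction of two generators with a distributed product -/

section Contraction

section Swap

variable {ι M : Type*} [Fintype ι] [AddCommMonoid M]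

theorem sum_swap₁₂ (f : ι → ι → ι → ι → M) :
    ∑ a, ∑ b, ∑ c, ∑ d, f a b c d = ∑ a, ∑ b, ∑ c, ∑ d, f b a c d :=
  Finset.sum_comm

theorem sum_swap₂₃ (f : ι → ι → ι → ι → M) :
    ∑ a, ∑ b, ∑ c, ∑ d, f a b c d = ∑ a, ∑ b, ∑ c, ∑ d, f a c b d :=
  Finset.sum_congr rfl fun _ _ => Finset.sum_comm

theorem sum_swap₃₄ (f : ι → ι → ι → ι → M) :
    ∑ a, ∑ b, ∑ c, ∑ d, f a b c d = ∑ a, ∑ b, ∑ c, ∑ d, f a b d c :=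
  Finset.sum_congr rfl fun _ _ => Finset.sum_congr rfl fun _ _ => Finset.sum_comm

end Swap

variable {ι A : Type*} [DecidableEq ι] [Fintype ι] [Ring A] {X : Matrix ι ι A}

theorem IsSO.sum_mul_cross (h : IsSO X) (F : Matrix ι ι A) :
    ∑ a, ∑ b, ∑ c, ∑ d, X c d * X a b * (X a c * F b d) = (X * (X ^ 2)ᵀ * F).trace := by
  rw [sum_swap₁₂, sum_swap₂₃, sum_swap₁₂, sum_swap₃₄, sum_swap₂₃, sum_swap₁₂]
  have h1 : ∀ b c, ∑ a, X a b * X a c = -(X ^ 2)ᵀ c b := fun b c => by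
    rw [transpose_apply, pow_two, Matrix.mul_apply, ← Finset.sum_neg_distrib]
    exact Finset.sum_congr rfl fun a _ => by rw [h.antisymm b a, neg_mul, neg_neg]
  have h2 : ∀ d c b, ∑ a, X c d * X a b * (X a c * F b d) = X d c * (X ^ 2)ᵀ c b * F b d :=
    fun d c b => by
    have : ∑ a, X c d * X a b * (X a c * F b d) = X c d * (∑ a, X a b * X a c) * F b d := by
      simp only [Finset.mul_sum, Finset.sum_mul, mul_assoc]
    rw [this, h1, h.antisymm c d]
    noncomm_ring
  simp only [h2, Matrix.trace, Matrix.diag_apply, Matrix.mul_apply, Finset.sum_mul]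
  refine Finset.sum_congr rfl fun d _ => ?_
  rw [Finset.sum_comm]

/-- The matrix `G` of the contraction of two generators with a distributed product. -/
def contr (X : Matrix ι ι A) : Matrix ι ι A :=
  -(4 : ℤ) • X ^ 3 + (4 * (Fintype.card ι : ℤ) - 8) • X ^ 2
    + (2 : ℤ) • (Matrix.scalar ι (X ^ 2).trace * X) - (2 * (Fintype.card ι : ℤ) - 4) • X

/-- The four crossed products of `six` agree up to sign, by the antisymmetry of `X` and relabelling,
and produce the transpose of `X ^ 2`. The two uncrossed ones give a product of traces, the second
only after one generator has been moved past another. -/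
theorem IsSO.sum_mul_six (h : IsSO X) {F : Matrix ι ι A} (hF : ∀ a b, F a b = -F b a) :
    ∑ a, ∑ b, ∑ c, ∑ d, X c d * X a b * six X F a b c d = (contr X * F).trace := by
  have e1 : ∑ a, ∑ b, ∑ c, ∑ d, X c d * X a b * (X b d * F a c) =
      ∑ a, ∑ b, ∑ c, ∑ d, X c d * X a b * (X a c * F b d) := by
    rw [sum_swap₁₂, sum_swap₃₄]
    refine Finset.sum_congr rfl fun a _ => Finset.sum_congr rfl fun b _ =>
      Finset.sum_congr rfl fun c _ => Finset.sum_congr rfl fun d _ => ?_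
    rw [h.antisymm d c, h.antisymm b a, neg_mul_neg]
  have e2 : ∑ a, ∑ b, ∑ c, ∑ d, X c d * X a b * (X a d * F b c) =
      -∑ a, ∑ b, ∑ c, ∑ d, X c d * X a b * (X a c * F b d) := by
    rw [sum_swap₃₄]
    simp only [← Finset.sum_neg_distrib]
    refine Finset.sum_congr rfl fun a _ => Finset.sum_congr rfl fun b _ =>
      Finset.sum_congr rfl fun c _ => Finset.sum_congr rfl fun d _ => ?_
    rw [h.antisymm d c, neg_mul, neg_mul]
  have e3 : ∑ a, ∑ b, ∑ c, ∑ d, X c d * X a b * (X b c * F a d) =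
      -∑ a, ∑ b, ∑ c, ∑ d, X c d * X a b * (X a c * F b d) := by
    rw [sum_swap₁₂]
    simp only [← Finset.sum_neg_distrib]
    refine Finset.sum_congr rfl fun a _ => Finset.sum_congr rfl fun b _ =>
      Finset.sum_congr rfl fun c _ => Finset.sum_congr rfl fun d _ => ?_
    rw [h.antisymm b a, mul_neg, neg_mul]
  have ht : ∑ a, ∑ b, X a b * X a b = -(X ^ 2).trace := by
    simp only [pow_two, Matrix.trace, Matrix.diag_apply, Matrix.mul_apply,
      ← Finset.sum_neg_distrib]
    refine Finset.sum_congr rfl fun a _ => Finset.sum_congr rfl fun b _ => ?_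
    rw [h.antisymm b a, mul_neg, neg_neg]
  have hXF : ∑ c, ∑ d, X c d * F c d = -(X * F).trace := by
    simp only [Matrix.trace, Matrix.diag_apply, Matrix.mul_apply, ← Finset.sum_neg_distrib]
    refine Finset.sum_congr rfl fun a _ => Finset.sum_congr rfl fun b _ => ?_
    rw [hF b a, mul_neg, neg_neg]
  have e4 : ∑ a, ∑ b, ∑ c, ∑ d, X c d * X a b * (X a b * F c d) =
      (X ^ 2).trace * (X * F).trace := by
    have h1 : ∀ c d, ∑ a, ∑ b, X c d * X a b * (X a b * F c d) =
        -((X ^ 2).trace * (X c d * F c d)) := fun c d => by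
      have : ∑ a, ∑ b, X c d * X a b * (X a b * F c d) =
          X c d * (∑ a, ∑ b, X a b * X a b) * F c d := by
        simp only [Finset.mul_sum, Finset.sum_mul, mul_assoc]
      rw [this, ht, mul_neg, h.isInvariant 2 c d, neg_mul, mul_assoc]
    rw [sum_swap₂₃, sum_swap₁₂, sum_swap₃₄, sum_swap₂₃]
    simp only [h1, Finset.sum_neg_distrib, ← Finset.mul_sum, hXF]
    rw [mul_neg, neg_neg]
  have e5 : ∑ a, ∑ b, ∑ c, ∑ d, X c d * X a b * (X c d * F a b) =
      (X ^ 2).trace * (X * F).trace - (2 * (Fintype.card ι : ℤ) - 4) • (X * F).trace := by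
    -- A generator sandwiched in a quadratic Casimir. The constant `2 * card ι - 4` is, up to sign,
    -- half the eigenvalue of `∑ X_{cd}²` in the adjoint representation.
    have h1 : ∀ a b, ∑ c, ∑ d, X c d * X a b * X c d =
        -((X ^ 2).trace * X a b) + (2 * (Fintype.card ι : ℤ) - 4) • X a b := fun a b => by
      have h2 : ∀ c d, X c d * X a b * X c d = X c d * X c d * X a b + X c d *
          (kd b c • X a d + kd a d • X b c - kd b d • X a c - kd a c • X b d) := fun c d => by
        rw [← h.bracket]
        noncomm_ring
      have h3 : ∀ a b, ∑ c, X a c * X b c = -(X ^ 2) a b := fun a b => by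
        rw [pow_two, Matrix.mul_apply, ← Finset.sum_neg_distrib]
        exact Finset.sum_congr rfl fun c _ => by rw [h.antisymm b c, mul_neg]
      have h4 : ∀ a b, ∑ c, X c a * X b c = (X ^ 2) b a - ((Fintype.card ι : ℤ) - 2) • X b a :=
        fun a b => by
        rw [← Matrix.smul_apply, ← Matrix.sub_apply, ← h.transpose_sq, transpose_apply, pow_two,
          Matrix.mul_apply]
        exact Finset.sum_congr rfl fun c _ => by
          rw [h.antisymm c a, h.antisymm b c, neg_mul_neg]
      simp only [h2, Finset.sum_add_distrib, ← Finset.sum_mul, ht, mul_add, mul_sub,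
        Finset.sum_sub_distrib, mul_smul_comm, sum_kd_smul, ← Finset.smul_sum]
      simp only [h3, h4, h.antisymm b a, neg_mul]
      module
    have h5 : ∑ a, ∑ b, ∑ c, ∑ d, X c d * X a b * (X c d * F a b) =
        ∑ a, ∑ b, (∑ c, ∑ d, X c d * X a b * X c d) * F a b := by
      simp only [Finset.sum_mul, mul_assoc]
    rw [h5]
    simp only [h1, add_mul, neg_mul, Finset.sum_add_distrib, Finset.sum_neg_distrib,
      smul_mul_assoc, ← Finset.smul_sum]
    simp only [mul_assoc, ← Finset.mul_sum, hXF, mul_neg]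
    module
  have e6 := h.sum_mul_cross F
  have e7 : X * (X ^ 2 - ((Fintype.card ι : ℤ) - 2) • X) * F =
      X ^ 3 * F - ((Fintype.card ι : ℤ) - 2) • (X ^ 2 * F) := by
    rw [mul_sub, mul_smul_comm, ← pow_succ', ← pow_two, sub_mul, smul_mul_assoc]
  rw [h.transpose_sq, e7] at e6
  simp only [six, mul_add, mul_sub, Finset.sum_add_distrib, Finset.sum_sub_distrib, e1, e2, e3, e4,
    e5, e6, contr]
  simp only [add_mul, sub_mul, smul_mul_assoc, Matrix.trace_add, Matrix.trace_sub,
    Matrix.trace_smul, Matrix.mul_assoc, trace_scalar_mul]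
  module

end Contraction

/-! ### Contractions of the Pfaffians of the spin block -/

section Spin

variable {ι A : Type*} [DecidableEq ι] [Ring A] {X : Matrix ι ι A}

/-- The six commutators consist of delta terms that cancel by antisymmetry. This lets a composite
tensor be put to the right of the generators, where `IsSO.sum_mul_six` applies. -/
theorem IsTensor.six_comm {F : Matrix ι ι A} (hT : IsTensor X F) (hF : ∀ a b, F a b = -F b a)
    (a b c d : ι) : six F X a b c d = six X F a b c d := by
  have h1 := hT a b c d
  have h2 := hT c d a b
  have h3 := hT a c b d
  have h4 := hT b d a c
  have h5 := hT a d b c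
  have h6 := hT b c a d
  unfold six
  rw [← sub_eq_zero]
  have : F a b * X c d + F c d * X a b - F a c * X b d - F b d * X a c + F a d * X b c
      + F b c * X a d - (X a b * F c d + X c d * F a b - X a c * F b d - X b d * F a c
      + X a d * F b c + X b c * F a d) =
    -(X a b * F c d - F c d * X a b) - (X c d * F a b - F a b * X c d)
    + (X a c * F b d - F b d * X a c) + (X b d * F a c - F a c * X b d)
    - (X a d * F b c - F b c * X a d) - (X b c * F a d - F a d * X b c) := by abel
  rw [this, h1, h2, h3, h4, h5, h6]
  simp only [hF b a, hF c a, hF c b, hF d b, hF d c, kd_comm b a, kd_comm c a, kd_comm d a,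
    kd_comm c b, kd_comm d b, kd_comm d c]
  module

variable [Fintype ι]

/-- The matrix `H` of the contraction of two generators with one of the factors of `pf₆`. -/
def contrH (X : Matrix ι ι A) : Matrix ι ι A := (2 : ℤ) • X - X ^ 2

/-- The antisymmetric tensor in the contraction of one generator with `pf₆`. -/
def contrW (X : Matrix ι ι A) : Matrix ι ι A :=
  (contrH X)ᵀ * (X - 1) - ((contrH X)ᵀ * (X - 1))ᵀ

theorem IsSO.sum_mul_shift (h : IsSO X) (b c : ι) :
    ∑ a, X a b * (X a c - (2 * kd a c) • 1) = contrH X b c := by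
  simp only [mul_sub, Finset.sum_sub_distrib, contrH, Matrix.sub_apply, Matrix.smul_apply, pow_two,
    Matrix.mul_apply, mul_smul_comm, mul_one, mul_smul, ← Finset.smul_sum, sum_kd_smul']
  have : ∑ a, X a b * X a c = - ∑ a, X b a * X a c := by
    rw [← Finset.sum_neg_distrib]
    exact Finset.sum_congr rfl fun a _ => by rw [h.antisymm a b, neg_mul]
  rw [this, h.antisymm c b]
  module

theorem sum_mul_pf₄ (H : Matrix ι ι A) (c d e f : ι) :
    ∑ b, H b c * pf₄ X b d e f = (Hᵀ * (X - 1)) c d * X e f - (Hᵀ * (X - 1)) c e * X d f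
      + (Hᵀ * (X - 1)) c f * X d e := by
  have h1 : ∀ b d : ι, X b d - kd b d • 1 = (X - 1) b d := fun b d => by
    simp [kd, Matrix.one_apply]
  simp only [pf₄, h1, Matrix.mul_apply, transpose_apply, Finset.sum_mul, mul_add, mul_sub,
    Finset.sum_add_distrib, Finset.sum_sub_distrib, mul_assoc]

theorem IsSO.sum_mul_self (h : IsSO X) : ∑ a, ∑ b, X a b * X a b = -(X ^ 2).trace := by
  simp only [pow_two, Matrix.trace, Matrix.diag_apply, Matrix.mul_apply, ← Finset.sum_neg_distrib]
  refine Finset.sum_congr rfl fun a _ => Finset.sum_congr rfl fun b _ => ?_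
  rw [h.antisymm b a, mul_neg, neg_neg]

/-- The term of `pf₆` pairing `a` with `b` yields the trace. In the other four, summing over `a`
gives `contrH`, and summing over `b` joins it to the first index of `pf₄`. The antisymmetrised
remainder is `six` with the tensor `contrW X`. -/
theorem IsSO.sum_mul_pf₆ (h : IsSO X) (c d e f : ι) :
    ∑ a, ∑ b, X a b * pf₆ X a b c d e f =
      -(X ^ 2).trace * pf₄ X c d e f - six (contrW X) X c d e f := by
  have h0 : ∑ a, ∑ b, X a b * ((X a b - (2 * kd a b) • 1) * pf₄ X c d e f) =
      -(X ^ 2).trace * pf₄ X c d e f := by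
    simp only [← mul_assoc, ← Finset.sum_mul, mul_sub, Finset.sum_sub_distrib, h.sum_mul_self,
      mul_smul_comm, mul_one, mul_smul, ← Finset.smul_sum, sum_kd_smul, h.diag]
    simp
  have h1 : ∀ c d e f, ∑ a, ∑ b, X a b * ((X a c - (2 * kd a c) • 1) * pf₄ X b d e f) =
      ((contrH X)ᵀ * (X - 1)) c d * X e f - ((contrH X)ᵀ * (X - 1)) c e * X d f
      + ((contrH X)ᵀ * (X - 1)) c f * X d e := fun c d e f => by
    rw [← sum_mul_pf₄, Finset.sum_comm]
    simp only [← mul_assoc, ← Finset.sum_mul, h.sum_mul_shift]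
  have h2 : ∀ a b, X a b * pf₆ X a b c d e f =
      X a b * ((X a b - (2 * kd a b) • 1) * pf₄ X c d e f)
      - X a b * ((X a c - (2 * kd a c) • 1) * pf₄ X b d e f)
      + X a b * ((X a d - (2 * kd a d) • 1) * pf₄ X b c e f)
      - X a b * ((X a e - (2 * kd a e) • 1) * pf₄ X b c d f)
      + X a b * ((X a f - (2 * kd a f) • 1) * pf₄ X b c d e) := fun a b => by
    simp only [pf₆, mul_add, mul_sub]
  simp only [h2, Finset.sum_add_distrib, Finset.sum_sub_distrib, h0, h1]
  simp only [six, contrW]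
  generalize (contrH X)ᵀ * (X - 1) = Z
  simp only [Matrix.sub_apply, transpose_apply]
  noncomm_ring

theorem contrW_antisymm (a b : ι) : contrW X a b = -contrW X b a := by
  simp [contrW]

theorem IsSO.isTensor_contrH (h : IsSO X) : IsTensor X (contrH X) :=
  (h.isTensor.smul 2).sub (h.isTensor.pow 2)

theorem IsSO.isTensor_contrW (h : IsSO X) : IsTensor X (contrW X) := by
  have := h.isTensor_contrH.transpose.mul (h.isTensor.sub isTensor_one)
  exact this.sub this.transpose

theorem IsSO.sum_pf₄ (h : IsSO X) :
    2 • ∑ a, ∑ b, ∑ c, ∑ d, X c d * X a b * pf₄ X a b c d = (contr X * X).trace := by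
  rw [← h.sum_mul_six h.antisymm]
  simp only [six_self h, mul_smul_comm, ← Finset.smul_sum]

/-- Invariance of the trace carries it to the left of the generators, and `IsTensor.six_comm` moves
`contrW X` to the right, so both remaining contractions are instances of `IsSO.sum_mul_six`. -/
theorem IsSO.sum_pf₆ (h : IsSO X) :
    2 • ∑ c, ∑ d, ∑ e, ∑ f, X e f * X c d * ∑ a, ∑ b, X a b * pf₆ X a b c d e f =
      -(X ^ 2).trace * (contr X * X).trace - 2 • (contr X * contrW X).trace := by
  have h1 : ∀ c d e f, X e f * X c d * ∑ a, ∑ b, X a b * pf₆ X a b c d e f =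
      -(X ^ 2).trace * (X e f * X c d * pf₄ X c d e f) -
        X e f * X c d * six X (contrW X) c d e f := fun c d e f => by
    rw [h.sum_mul_pf₆, h.isTensor_contrW.six_comm contrW_antisymm, mul_sub, neg_mul, mul_neg,
      neg_mul, mul_assoc, ← mul_assoc (X c d), h.isInvariant 2, mul_assoc, ← mul_assoc (X e f),
      h.isInvariant 2]
    simp only [mul_assoc]
  simp only [h1, Finset.sum_sub_distrib, ← Finset.mul_sum, h.sum_mul_six contrW_antisymm]
  rw [← h.sum_pf₄, smul_sub, mul_smul_comm]

end Spin

/-! ### Translations as a vector over the spin block -/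

section Mixed

variable {N : ℕ} {A : Type*} [Ring A] {J : Fin (N + 1) → Fin (N + 1) → A}

/-- The generators with both indices different from the last one. -/
def spinBlock (J : Fin (N + 1) → Fin (N + 1) → A) : Matrix (Fin N) (Fin N) A :=
  fun a b => J a.castSucc b.castSucc

/-- The generators of the translations. -/
def transl (J : Fin (N + 1) → Fin (N + 1) → A) : Fin N → A :=
  fun a => J a.castSucc (Fin.last N)

/-- `v` transforms as a vector under the commutator with the generators `X`. -/
def IsVector {ι : Type*} [DecidableEq ι] (X : Matrix ι ι A) (v : ι → A) : Prop := ∀ a b c,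
  X a b * v c - v c * X a b = kd b c • v a - kd a c • v b

theorem kd_castSucc (a b : Fin N) : kd a.castSucc b.castSucc = kd a b := by
  simp [kd]

theorem kd_castSucc_last (a : Fin N) : kd a.castSucc (Fin.last N) = 0 := by
  simp [kd, (Fin.castSucc_lt_last a).ne]

theorem kd_last_castSucc (a : Fin N) : kd (Fin.last N) a.castSucc = 0 := by
  rw [kd_comm, kd_castSucc_last]

theorem IsSO.isSO_spinBlock (h : IsSO J) : IsSO (spinBlock J) where
  antisymm a b := h.antisymm _ _
  diag a := h.diag _
  bracket a b c d := by
    simp only [spinBlock, h.bracket, kd_castSucc]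

theorem IsSO.isVector_transl (h : IsSO J) : IsVector (spinBlock J) (transl J) := fun a b c => by
  simp only [spinBlock, transl, h.bracket, kd_castSucc, kd_castSucc_last]
  module

theorem IsSO.transl_comm (h : IsSO J) (a b : Fin N) :
    transl J a * transl J b -
      transl J b * transl J a = -spinBlock J a b := by
  simp only [spinBlock, transl, h.bracket, kd_last_castSucc,
    kd_castSucc_last, h.diag]
  simp [kd]

variable {ι : Type*} [DecidableEq ι] {X : Matrix ι ι A} {v w : ι → A}

theorem IsVector.isTensor (hv : IsVector X v) (hw : IsVector X w) :
    IsTensor X (Matrix.of fun a b => v a * w b) := fun a b c d => by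
  have h1 : X a b * (v c * w d) - v c * w d * X a b = (X a b * v c - v c * X a b) * w d +
    v c * (X a b * w d - w d * X a b) := by noncomm_ring
  simp only [Matrix.of_apply, h1, hv a b c, hw a b d]
  simp only [sub_mul, mul_sub, smul_mul_assoc, mul_smul_comm]
  module

theorem IsVector.sub (hv : IsVector X v) (hw : IsVector X w) : IsVector X (v - w) :=
  fun a b c => by
    have h1 := hv a b c
    have h2 := hw a b c
    simp only [Pi.sub_apply]
    linear_combination (norm := skip) h1 - h2
    simp only [mul_sub, sub_mul]
    module

theorem IsVector.smul (n : ℤ) (hv : IsVector X v) : IsVector X (n • v) :=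
  fun a b c => by
    have h1 := congrArg (n • ·) (hv a b c)
    simp only [Pi.smul_apply]
    linear_combination (norm := skip) h1
    simp only [mul_smul_comm, smul_mul_assoc]
    module

variable [Fintype ι]

theorem IsTensor.mulVec {T : Matrix ι ι A} (hT : IsTensor X T) (hv : IsVector X v) :
    IsVector X (T *ᵥ v) := fun a b c => by
  have h1 : ∀ e, X a b * (T c e * v e) - T c e * v e * X a b =
      (kd b c • T a e - kd a c • T b e + kd b e • T c a - kd a e • T c b) * v e +
      T c e * (kd b e • v a - kd a e • v b) := fun e => by
    rw [← hT, ← hv]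
    noncomm_ring
  simp only [Matrix.mulVec, dotProduct, Finset.mul_sum, Finset.sum_mul, ← Finset.sum_sub_distrib, h1]
  simp only [mul_sub, add_mul, sub_mul, smul_mul_assoc, mul_smul_comm,
    Finset.sum_add_distrib, Finset.sum_sub_distrib, sum_kd_smul, ← Finset.smul_sum]
  abel

theorem IsVector.isInvariant (hv : IsVector X v) : IsInvariant X (∑ a, v a * v a) := by
  have := (hv.isTensor hv).trace
  exact this

/-- Multiplying a vector by the generators from the right. -/
theorem IsVector.sum_mul (hX : IsSO X) (hv : IsVector X v) (c : ι) :
    ∑ e, v e * X e c = ((Fintype.card ι : ℤ) - 1) • v c - (X *ᵥ v) c := by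
  have h1 : ∀ e, v e * X e c = -(X c e * v e) - (kd c e • v e - kd e e • v c) := fun e => by
    rw [← hv, hX.antisymm c e]
    noncomm_ring
  have h4 : ∑ b : ι, kd b b = (Fintype.card ι : ℤ) := by simp [kd]
  simp only [h1, Finset.sum_sub_distrib, sum_kd_smul, ← Finset.sum_smul, h4,
    Finset.sum_neg_distrib, Matrix.mulVec, dotProduct]
  module

/-- The wedge product of two vectors. -/
def wedge (v w : ι → A) : Matrix ι ι A := Matrix.of fun a b => v a * w b - v b * w a

theorem wedge_antisymm (v w : ι → A) (a b : ι) : wedge v w a b = -wedge v w b a := by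
  simp [wedge]

theorem IsVector.isTensor_wedge (hv : IsVector X v) (hw : IsVector X w) : IsTensor X (wedge v w) :=
  (hv.isTensor hw).sub (hv.isTensor hw).transpose

/-- The vector `∑_b v_b (X_{bc} - n δ_{bc})`. -/
def shiftVec (X : Matrix ι ι A) (n : ℤ) (v : ι → A) : ι → A :=
  ((Fintype.card ι : ℤ) - 1 - n) • v - X *ᵥ v

theorem IsVector.isVector_shiftVec (hX : IsSO X) (hv : IsVector X v) (n : ℤ) :
    IsVector X (shiftVec X n v) :=
  (hv.smul _).sub (hX.isTensor.mulVec hv)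

theorem IsVector.sum_mul_shift (hX : IsSO X) (hv : IsVector X v) (n : ℤ) (c : ι) :
    ∑ b, v b * (X b c - (n * kd b c) • 1) = shiftVec X n v c := by
  simp only [mul_sub, Finset.sum_sub_distrib, hv.sum_mul hX, mul_smul_comm, mul_one, mul_smul,
    ← Finset.smul_sum, sum_kd_smul', shiftVec, Pi.sub_apply, Pi.smul_apply]
  module

end Mixed

/-! ### Pfaffians with one index in the last direction -/

section Block

variable {N : ℕ} {A : Type*} [Ring A] {J : Fin (N + 1) → Fin (N + 1) → A}

theorem pf₄_castSucc (a b c d : Fin N) :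
    pf₄ J a.castSucc b.castSucc c.castSucc d.castSucc = pf₄ (spinBlock J) a b c d := by
  simp only [pf₄, kd_castSucc]
  rfl

theorem pf₆_castSucc (a b c d e f : Fin N) :
    pf₆ J a.castSucc b.castSucc c.castSucc d.castSucc e.castSucc f.castSucc =
      pf₆ (spinBlock J) a b c d e f := by
  simp only [pf₆, kd_castSucc, pf₄_castSucc]
  rfl

theorem IsSO.last_castSucc (h : IsSO J) (a : Fin N) :
    J (Fin.last N) a.castSucc = -transl J a := h.antisymm _ _

theorem IsSO.pf₄_last (h : IsSO J) (c d e : Fin N) :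
    pf₄ J (Fin.last N) c.castSucc d.castSucc e.castSucc =
      -(transl J c * spinBlock J d e
        - transl J d * spinBlock J c e
        + transl J e * spinBlock J c d) := by
  simp only [pf₄, kd_last_castSucc, h.last_castSucc, spinBlock, zero_smul, sub_zero]
  noncomm_ring

/-- Pairing `b` with the last index gives the square of the translations. In the other pairings `b`
meets a shifted generator, so the translations are absorbed into `shiftVec`; the shift is the one in
the Pfaffian, here `1`, and `2` for `pf₆`. -/
theorem IsSO.sum_transl_mul_pf₄ (h : IsSO J) (c d : Fin N) :
    ∑ b, transl J b * pf₄ J b.castSucc (Fin.last N) c.castSucc d.castSucc =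
      (∑ b, transl J b * transl J b) * spinBlock J c d +
        wedge (shiftVec (spinBlock J) 1 (transl J)) (transl J) c d := by
  have h1 : ∀ b, transl J b * pf₄ J b.castSucc (Fin.last N) c.castSucc d.castSucc =
      transl J b * transl J b * spinBlock J c d
      + transl J b * (spinBlock J b c - (1 * kd b c) • 1) * transl J d
      - transl J b * (spinBlock J b d - (1 * kd b d) • 1) * transl J c := fun b => by
    simp only [pf₄, kd_castSucc_last, kd_castSucc, h.last_castSucc, one_mul, zero_smul, sub_zero]
    simp only [transl, spinBlock]
    noncomm_ring
  simp only [h1, Finset.sum_add_distrib, Finset.sum_sub_distrib, ← Finset.sum_mul,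
    h.isVector_transl.sum_mul_shift h.isSO_spinBlock, wedge, Matrix.of_apply]
  abel

theorem IsSO.sum_transl_mul_pf₆ (h : IsSO J) (c d e f : Fin N) :
    ∑ b, transl J b * pf₆ J b.castSucc (Fin.last N) c.castSucc d.castSucc e.castSucc f.castSucc =
      (∑ b, transl J b * transl J b) * pf₄ (spinBlock J) c d e f +
        six (wedge (shiftVec (spinBlock J) 2 (transl J)) (transl J))
          (spinBlock J) c d e f := by
  set X := spinBlock J with hX
  set Q := transl J with hQ
  have h1 : ∀ b,
      Q b * pf₆ J b.castSucc (Fin.last N) c.castSucc d.castSucc e.castSucc f.castSucc =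
      Q b * Q b * pf₄ X c d e f
      + Q b * (X b c - (2 * kd b c) • 1) * (Q d * X e f - Q e * X d f + Q f * X d e)
      - Q b * (X b d - (2 * kd b d) • 1) * (Q c * X e f - Q e * X c f + Q f * X c e)
      + Q b * (X b e - (2 * kd b e) • 1) * (Q c * X d f - Q d * X c f + Q f * X c d)
      - Q b * (X b f - (2 * kd b f) • 1) * (Q c * X d e - Q d * X c e + Q e * X c d) :=
    fun b => by
    simp only [pf₆, kd_castSucc_last, kd_castSucc, h.pf₄_last, pf₄_castSucc, ← hX, ← hQ]
    have e1 : J b.castSucc (Fin.last N) = Q b := rfl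
    have e2 : ∀ c : Fin N, J b.castSucc c.castSucc = X b c := fun _ => rfl
    simp only [e1, e2, mul_zero, zero_smul, sub_zero]
    noncomm_ring
  have h2 := h.isVector_transl.sum_mul_shift h.isSO_spinBlock 2
  rw [← hX, ← hQ] at h2
  simp only [h1, Finset.sum_add_distrib, Finset.sum_sub_distrib, ← Finset.sum_mul, h2,
    six, wedge, Matrix.of_apply]
  noncomm_ring

/-- The contraction of a tensor with the product of two translations. -/
def translForm (J : Fin (N + 1) → Fin (N + 1) → A) (T : Matrix (Fin N) (Fin N) A) : A :=
  ∑ a, ∑ b, T a b * (transl J b * transl J a)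

theorem translForm_add (S T : Matrix (Fin N) (Fin N) A) :
    translForm J (S + T) = translForm J S + translForm J T := by
  simp [translForm, add_mul, Finset.sum_add_distrib]

theorem translForm_sub (S T : Matrix (Fin N) (Fin N) A) :
    translForm J (S - T) = translForm J S - translForm J T := by
  simp [translForm, sub_mul, Finset.sum_sub_distrib]

theorem translForm_neg (T : Matrix (Fin N) (Fin N) A) :
    translForm J (-T) = -translForm J T := by
  simp [translForm]

theorem translForm_smul (n : ℤ) (T : Matrix (Fin N) (Fin N) A) :
    translForm J (n • T) = n • translForm J T := by
  simp only [translForm, Matrix.smul_apply, smul_mul_assoc, Finset.smul_sum]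

theorem translForm_scalar_mul (c : A) (T : Matrix (Fin N) (Fin N) A) :
    translForm J (Matrix.scalar (Fin N) c * T) = c * translForm J T := by
  simp [translForm, Finset.mul_sum, mul_assoc]

theorem translForm_one : translForm J 1 = ∑ b, transl J b * transl J b := by
  simp [translForm, Matrix.one_apply]

/-- Transposing exchanges the two translations, and their commutator is a spin generator. -/
theorem IsSO.translForm_transpose (h : IsSO J) (T : Matrix (Fin N) (Fin N) A) :
    translForm J Tᵀ = translForm J T + (T * spinBlock J).trace := by
  have h1 : translForm J Tᵀ = ∑ a, ∑ b, T a b * (transl J a * transl J b) := by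
    rw [translForm, Finset.sum_comm]
    rfl
  have h2 : ∀ a b, T a b * (transl J a * transl J b) =
      T a b * (transl J b * transl J a) + T a b * spinBlock J b a := fun a b => by
    rw [h.isSO_spinBlock.antisymm b a, ← h.transl_comm a b]
    noncomm_ring
  rw [h1]
  simp only [h2, Finset.sum_add_distrib, translForm, Matrix.trace, Matrix.diag_apply,
    Matrix.mul_apply]

/-- The wedge antisymmetrises `T`, and `shiftVec` acts on a translation as the matrix `(N - 1 - n) -
X`, which is absorbed into `T` from the right. -/
theorem trace_mul_wedge (T : Matrix (Fin N) (Fin N) A) (n : ℤ) :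
    (T * wedge (shiftVec (spinBlock J) n (transl J)) (transl J)).trace =
      translForm J ((T - Tᵀ) * (((N : ℤ) - 1 - n) • 1 - spinBlock J)) := by
  have h1 : ∀ T : Matrix (Fin N) (Fin N) A, ∑ a, ∑ b, T a b *
      (shiftVec (spinBlock J) n (transl J) b * transl J a) =
      translForm J (T * (((N : ℤ) - 1 - n) • 1 - spinBlock J)) := fun T => by
    have h2 : ∀ b a, shiftVec (spinBlock J) n (transl J) b * transl J a =
        ∑ c, (((N : ℤ) - 1 - n) • (1 : Matrix (Fin N) (Fin N) A) - spinBlock J) b c *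
          (transl J c * transl J a) := fun b a => by
      simp only [← mul_assoc, ← Finset.sum_mul]
      congr 1
      have h3 : ∀ c, (1 : Matrix (Fin N) (Fin N) A) b c = kd b c • 1 := fun c => by
        simp [kd, Matrix.one_apply]
      simp only [shiftVec, Matrix.sub_apply, Matrix.smul_apply, h3, sub_mul, smul_mul_assoc,
        one_mul, Finset.sum_sub_distrib, ← Finset.smul_sum, sum_kd_smul, Pi.sub_apply,
        Pi.smul_apply, Matrix.mulVec, dotProduct, Fintype.card_fin]
    simp only [h2, translForm, Matrix.mul_apply, Finset.sum_mul, Finset.mul_sum]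
    refine Finset.sum_congr rfl fun a _ => ?_
    rw [Finset.sum_comm]
    simp only [mul_assoc]
  rw [sub_mul, translForm_sub, ← h1, ← h1, Finset.sum_comm (f := fun a b => Tᵀ a b * _)]
  simp only [Matrix.trace, Matrix.diag_apply, Matrix.mul_apply, wedge, Matrix.of_apply, mul_sub,
    Finset.sum_sub_distrib, transpose_apply]

theorem IsSO.isInvariant_transl (h : IsSO J) :
    IsInvariant (spinBlock J) (∑ b, transl J b * transl J b) :=
  h.isVector_transl.isInvariant

end Block

/-! ### Sums in which the last index occurs at most once -/

section Split

variable {N : ℕ} {M : Type*} [AddCommMonoid M]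

theorem sum_fun_castSucc {L : ℕ} (g : (Fin L → Fin (N + 1)) → M)
    (hg : ∀ k i, k i = Fin.last N → g k = 0) :
    ∑ k, g k = ∑ k : Fin L → Fin N, g fun i => (k i).castSucc := by
  induction L with
  | zero =>
    simp only [Finset.univ_unique, Finset.sum_singleton]
    congr 1
    exact Subsingleton.elim _ _
  | succ L ih =>
    rw [sum_fin_succ_fun, sum_fin_succ_fun, Fin.sum_univ_castSucc]
    rw [Finset.sum_eq_zero (s := (Finset.univ : Finset (Fin L → Fin (N + 1))))
      (fun k _ => hg _ 0 (by simp)), add_zero]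
    refine Finset.sum_congr rfl fun a _ => ?_
    rw [ih (fun k => g (Matrix.vecCons a.castSucc k))
      fun k i hk => hg _ i.succ (by simpa using hk)]
    refine Finset.sum_congr rfl fun k _ => congrArg g ?_
    funext i
    refine Fin.cases ?_ (fun i => ?_) i <;> simp

/-- A sum over functions with at most one value equal to the last index. -/
theorem sum_fun_split {L : ℕ} (g : (Fin (L + 1) → Fin (N + 1)) → M)
    (hg : ∀ k i j, i ≠ j → k i = Fin.last N → k j = Fin.last N → g k = 0) :
    ∑ k, g k = ∑ k : Fin (L + 1) → Fin N, g (fun i => (k i).castSucc) +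
      ∑ i : Fin (L + 1), ∑ k : Fin L → Fin N,
        g (i.insertNth (Fin.last N) fun j => (k j).castSucc) := by
  induction L with
  | zero =>
    rw [sum_fin_succ_fun, sum_fin_succ_fun, Fin.sum_univ_castSucc]
    simp only [Finset.univ_unique, Finset.sum_singleton]
    congr 1
    · refine Finset.sum_congr rfl fun a _ => congrArg g ?_
      funext i
      rw [Subsingleton.elim i 0]
      rfl
    · rw [Fin.sum_univ_succ]
      simp only [Finset.univ_eq_empty, Finset.sum_empty, add_zero]
      refine congrArg g ?_
      funext i
      rw [Subsingleton.elim i 0]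
      rfl
  | succ L ih =>
    rw [sum_fin_succ_fun, sum_fin_succ_fun, Fin.sum_univ_castSucc, Fin.sum_univ_succ (n := L + 1),
      sum_fun_castSucc (fun k => g (Matrix.vecCons (Fin.last N) k))
        fun k i hk => hg _ 0 i.succ (Fin.succ_ne_zero i).symm (by simp) (by simpa using hk)]
    have h1 : ∀ a : Fin N, ∑ k, g (Matrix.vecCons a.castSucc k) =
        ∑ k : Fin (L + 1) → Fin N, g (Matrix.vecCons a.castSucc fun i => (k i).castSucc) +
        ∑ i : Fin (L + 1), ∑ k : Fin L → Fin N,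
          g (Matrix.vecCons a.castSucc (i.insertNth (Fin.last N) fun j => (k j).castSucc)) :=
      fun a => ih (fun k => g (Matrix.vecCons a.castSucc k)) fun k i j hij hi hj =>
        hg _ i.succ j.succ (by simpa using hij) (by simpa using hi) (by simpa using hj)
    simp only [h1, Finset.sum_add_distrib]
    rw [add_assoc]
    congr 1
    · refine Finset.sum_congr rfl fun a _ => Finset.sum_congr rfl fun k _ => congrArg g ?_
      funext i
      refine Fin.cases ?_ (fun i => ?_) i <;> simp
    · rw [add_comm]
      congr 1
      · refine Finset.sum_congr rfl fun k _ => congrArg g ?_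
        rw [Fin.insertNth_zero]
        rfl
      · rw [Finset.sum_comm]
        refine Finset.sum_congr rfl fun i _ => ?_
        rw [sum_fin_succ_fun]
        refine Finset.sum_congr rfl fun a _ => Finset.sum_congr rfl fun k _ => congrArg g ?_
        have : (fun j => (Matrix.vecCons a k j).castSucc) =
            (Fin.cons a.castSucc fun j => (k j).castSucc : Fin (L + 1) → Fin (N + 1)) := by
          funext j
          refine Fin.cases ?_ (fun j => ?_) j <;> simp
        rw [this, Fin.insertNth_succ_cons]
        rfl

/-- A symmetry `σ` of the summand carries the last index from slot `i` to slot `j`; `τ` is the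
permutation it induces on the other slots. -/
theorem sum_insertNth_congr {L : ℕ} (g : (Fin (L + 1) → Fin (N + 1)) → M)
    (σ : Equiv.Perm (Fin (L + 1))) (hg : ∀ k, g (k ∘ σ) = g k) (i j : Fin (L + 1))
    (τ : Equiv.Perm (Fin L))
    (H : ∀ k : Fin L → Fin (N + 1),
      (i.insertNth (Fin.last N) k : Fin (L + 1) → Fin (N + 1)) ∘ σ =
        j.insertNth (Fin.last N) (k ∘ τ)) :
    ∑ k : Fin L → Fin N, g (i.insertNth (Fin.last N) fun r => (k r).castSucc) =
      ∑ k : Fin L → Fin N, g (j.insertNth (Fin.last N) fun r => (k r).castSucc) := by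
  rw [← (Equiv.arrowCongr τ (Equiv.refl (Fin N))).sum_comp]
  refine Finset.sum_congr rfl fun k _ => ?_
  rw [← hg, H]
  congr 2
  funext r
  simp [Equiv.arrowCongr]

end Split

/-! ### The Casimir summand and its symmetries -/

section Euclid

variable {κ A : Type*} [DecidableEq κ] [Fintype κ] [Ring A] {J : κ → κ → A}

/-- Every term of the commutator carries the delta of two different slots, and when these hold equal
indices `w` vanishes. In front of an alternating factor, generators with disjoint slots therefore
commute. -/
theorem IsSO.comm_of_alternating (h : IsSO J) {L : ℕ} {k : Fin L → κ} {w : A}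
    (hw : ∀ u v, u ≠ v → k u = k v → w = 0) {i j r s : Fin L}
    (hir : i ≠ r) (his : i ≠ s) (hjr : j ≠ r) (hjs : j ≠ s) :
    J (k i) (k j) * (J (k r) (k s) * w) = J (k r) (k s) * (J (k i) (k j) * w) := by
  have h0 : ∀ {u v : Fin L} (_ : u ≠ v) (z : A), kd (k u) (k v) • z * w = 0 :=
    fun {u v} huv z => by
    by_cases hk : k u = k v
    · rw [hw u v huv hk, mul_zero]
    · simp [kd, hk]
  rw [h.comm_assoc]
  simp only [add_mul, sub_mul, h0 hir, h0 his, h0 hjr, h0 hjs]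
  abel

/-- The unnormalised Casimir operator for the Euclidean metric, by multi-indices. -/
def casimirTerm (n : ℕ) (J : κ → κ → A) (k : Fin (2 * n) → κ) : A :=
  pairProd J k * altSum (pairProd J) k

theorem pairProd_one {κ A : Type*} [Ring A] (J : κ → κ → A) (k : Fin 2 → κ) :
    pairProd (n := 1) J k = J (k 0) (k 1) := by
  simp [pairProd]

theorem pairProd_two {κ A : Type*} [Ring A] (J : κ → κ → A) (k : Fin 4 → κ) :
    pairProd (n := 2) J k = J (k 0) (k 1) * J (k 2) (k 3) := by
  simp [pairProd, List.ofFn_succ]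

theorem pairProd_three {κ A : Type*} [Ring A] (J : κ → κ → A) (k : Fin 6 → κ) :
    pairProd (n := 3) J k = J (k 0) (k 1) * (J (k 2) (k 3) * J (k 4) (k 5)) := by
  simp [pairProd, List.ofFn_succ]

theorem casimirTerm_eq_zero (n : ℕ) (J : κ → κ → A) (k : Fin (2 * n) → κ) {i j : Fin (2 * n)}
    (hij : i ≠ j) (hk : k i = k j) : casimirTerm n J k = 0 := by
  rw [casimirTerm, altSum_eq_zero _ k hij hk, mul_zero]

theorem casimirTerm_one (h : IsSO J) (k : Fin 2 → κ) :
    casimirTerm 1 J k = 2 • (J (k 0) (k 1) * J (k 0) (k 1)) := by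
  have h1 := altSum_pairProd_two h k
  have h2 : casimirTerm 1 J k = J (k 0) (k 1) * altSum (pairProd (n := 1) J) k := by
    rw [← pairProd_one J]
    rfl
  rw [h2, h1, mul_smul_comm]

/-- The generators are put in reverse order, so that the pair in slots `0` and `1` stands next to
the Pfaffian and is contracted first; `casimirTerm_three` does the same. -/
theorem casimirTerm_two (h : IsSO J) (k : Fin 4 → κ) :
    casimirTerm 2 J k =
      8 • (J (k 2) (k 3) * (J (k 0) (k 1) * pf₄ J (k 0) (k 1) (k 2) (k 3))) := by
  have h1 := altSum_pairProd_four h k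
  have h2 : casimirTerm 2 J k =
      J (k 0) (k 1) * (J (k 2) (k 3) * altSum (pairProd (n := 2) J) k) := by
    rw [← mul_assoc, ← pairProd_two J]
    rfl
  rw [h2, h.comm_of_alternating (w := altSum (pairProd (n := 2) J) k)
    (fun u v huv hk => altSum_eq_zero _ k huv hk)
    (by decide) (by decide) (by decide) (by decide), h1]
  simp only [mul_smul_comm]

theorem casimirTerm_three_eq (J : κ → κ → A) (k : Fin 6 → κ) : casimirTerm 3 J k =
    J (k 0) (k 1) * (J (k 2) (k 3) * (J (k 4) (k 5) * altSum (pairProd (n := 3) J) k)) := by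
  rw [← mul_assoc (J (k 2) (k 3)), ← mul_assoc, ← pairProd_three J]
  rfl

theorem casimirTerm_three_aux (h : IsSO J) (k : Fin 6 → κ) :
    casimirTerm 3 J k =
      J (k 2) (k 3) * (J (k 0) (k 1) * (J (k 4) (k 5) * altSum (pairProd (n := 3) J) k)) ∧
    casimirTerm 3 J k =
      J (k 4) (k 5) * (J (k 2) (k 3) * (J (k 0) (k 1) * altSum (pairProd (n := 3) J) k)) := by
  have h2 := casimirTerm_three_eq J k
  have h0 : ∀ z u v, u ≠ v → k u = k v → z * altSum (pairProd (n := 3) J) k = 0 :=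
    fun z u v huv hk => by rw [altSum_eq_zero _ k huv hk, mul_zero]
  have h0' : ∀ u v, u ≠ v → k u = k v → altSum (pairProd (n := 3) J) k = 0 :=
    fun u v huv hk => altSum_eq_zero _ k huv hk
  constructor
  · rw [h2, h.comm_of_alternating (h0 _) (by decide) (by decide) (by decide) (by decide)]
  · rw [h2, h.comm_of_alternating (i := 2) (j := 3) (r := 4) (s := 5) h0' (by decide) (by decide)
      (by decide) (by decide), h.comm_of_alternating (i := 0) (j := 1) (r := 4) (s := 5) (h0 _)
      (by decide) (by decide) (by decide) (by decide), h.comm_of_alternating (i := 0) (j := 1)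
      (r := 2) (s := 3) h0' (by decide) (by decide) (by decide) (by decide)]

theorem casimirTerm_three (h : IsSO J) (k : Fin 6 → κ) :
    casimirTerm 3 J k =
      48 • (J (k 4) (k 5) * (J (k 2) (k 3) * (J (k 0) (k 1) *
        pf₆ J (k 0) (k 1) (k 2) (k 3) (k 4) (k 5)))) := by
  rw [(casimirTerm_three_aux h k).2, altSum_pairProd_six h k]
  simp only [mul_smul_comm]

/-- Exchange of the indices of the first pair. -/
theorem casimirTerm_swap (h : IsSO J) {n : ℕ} (k : Fin (2 * n + 2) → κ) :
    casimirTerm (n + 1) J (k ∘ Equiv.swap 0 1) = casimirTerm (n + 1) J k := by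
  have h1 := altSum_perm (pairProd (n := n + 1) J) k (Equiv.swap 0 1)
  have h2 : ∀ k : Fin (2 * n + 2) → κ, pairProd (n := n + 1) J k =
      J (k 0) (k 1) * pairProd (n := n) J fun i => k i.succ.succ := fun k => by
    rw [← pairProd_cons]
    congr 1
    funext i
    refine Fin.cases rfl (fun i => Fin.cases rfl (fun i => rfl) i) i
  have h3 : pairProd (n := n + 1) J (k ∘ Equiv.swap 0 1) = -pairProd (n := n + 1) J k := by
    rw [h2, h2]
    simp only [Function.comp_apply, Equiv.swap_apply_left, Equiv.swap_apply_right]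
    rw [h.antisymm, neg_mul]
    congr 3
  rw [Equiv.Perm.sign_swap (by simp)] at h1
  unfold casimirTerm
  rw [h3]
  refine (congrArg (-pairProd (n := n + 1) J k * ·) h1).trans ?_
  simp

/-- Exchange of the first two pairs of four indices. -/
def swapPairs₄ : Equiv.Perm (Fin 4) := ⟨![2, 3, 0, 1], ![2, 3, 0, 1], by decide, by decide⟩

/-- Exchange of the first two pairs of six indices. -/
def swapPairs₆ : Equiv.Perm (Fin 6) :=
  ⟨![2, 3, 0, 1, 4, 5], ![2, 3, 0, 1, 4, 5], by decide, by decide⟩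

/-- Exchange of the outer pairs of six indices. -/
def swapOuter₆ : Equiv.Perm (Fin 6) :=
  ⟨![4, 5, 2, 3, 0, 1], ![4, 5, 2, 3, 0, 1], by decide, by decide⟩

theorem casimirTerm_swapPairs₄ (h : IsSO J) (k : Fin 4 → κ) :
    casimirTerm 2 J (k ∘ swapPairs₄) = casimirTerm 2 J k := by
  have h1 := altSum_perm (pairProd (n := 2) J) k swapPairs₄
  have hs : Equiv.Perm.sign swapPairs₄ = 1 := by decide
  rw [hs] at h1
  have h2 : ∀ k : Fin 4 → κ, casimirTerm 2 J k =
      J (k 0) (k 1) * (J (k 2) (k 3) * altSum (pairProd (n := 2) J) k) := fun k => by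
    rw [← mul_assoc, ← pairProd_two J]
    rfl
  rw [h2 k, h2, h1, h.comm_of_alternating (k := k) (i := 0) (j := 1) (r := 2) (s := 3)
    (w := altSum (pairProd (n := 2) J) k)
    (fun u v huv hk => altSum_eq_zero _ k huv hk)
    (by decide) (by decide) (by decide) (by decide)]
  simp [swapPairs₄]

theorem casimirTerm_swapPairs₆ (h : IsSO J) (k : Fin 6 → κ) :
    casimirTerm 3 J (k ∘ swapPairs₆) = casimirTerm 3 J k := by
  have h1 := altSum_perm (pairProd (n := 3) J) k swapPairs₆
  have hs : Equiv.Perm.sign swapPairs₆ = 1 := by decide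
  rw [hs] at h1
  rw [(casimirTerm_three_aux h k).1, casimirTerm_three_eq, h1]
  simp [swapPairs₆]

theorem casimirTerm_swapOuter₆ (h : IsSO J) (k : Fin 6 → κ) :
    casimirTerm 3 J (k ∘ swapOuter₆) = casimirTerm 3 J k := by
  have h1 := altSum_perm (pairProd (n := 3) J) k swapOuter₆
  have hs : Equiv.Perm.sign swapOuter₆ = 1 := by decide
  rw [hs] at h1
  rw [(casimirTerm_three_aux h k).2, casimirTerm_three_eq, h1]
  simp [swapOuter₆]

end Euclid

/-! ### Reindexing of nested sums -/

section Nested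

variable {ι M : Type*} [Fintype ι] [AddCommMonoid M]

theorem sum_rotate₃ (f : ι → ι → ι → M) :
    ∑ a, ∑ b, ∑ c, f a b c = ∑ b, ∑ c, ∑ a, f a b c := by
  rw [Finset.sum_comm]
  exact Finset.sum_congr rfl fun b _ => Finset.sum_comm

theorem sum_rotate₅ (f : ι → ι → ι → ι → ι → M) :
    ∑ a, ∑ b, ∑ c, ∑ d, ∑ e, f a b c d e = ∑ b, ∑ c, ∑ d, ∑ e, ∑ a, f a b c d e := by
  rw [sum_rotate₃]
  exact Finset.sum_congr rfl fun b _ => Finset.sum_congr rfl fun c _ => sum_rotate₃ _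

theorem sum_fin_three (f : ι → ι → ι → M) :
    ∑ k : Fin 3 → ι, f (k 0) (k 1) (k 2) = ∑ b, ∑ c, ∑ a, f a b c := by
  rw [← sum_rotate₃]
  simp [sum_fin_succ_fun]

theorem sum_fin_five (f : ι → ι → ι → ι → ι → M) :
    ∑ k : Fin 5 → ι, f (k 0) (k 1) (k 2) (k 3) (k 4) =
      ∑ b, ∑ c, ∑ d, ∑ e, ∑ a, f a b c d e := by
  rw [← sum_rotate₅]
  simp [sum_fin_succ_fun]

theorem sum_fin_six (f : ι → ι → ι → ι → ι → ι → M) :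
    ∑ k : Fin 6 → ι, f (k 0) (k 1) (k 2) (k 3) (k 4) (k 5) =
      ∑ c, ∑ d, ∑ e, ∑ f', ∑ a, ∑ b, f a b c d e f' := by
  rw [← sum_rotate₅]
  refine Eq.trans ?_ (Finset.sum_congr rfl fun a _ => sum_rotate₅ _)
  simp [sum_fin_succ_fun]

end Nested

/-! ### The Casimir sums as traces and quadratic forms -/

section Total

variable {N : ℕ} {A : Type*} [Ring A] {J : Fin (N + 1) → Fin (N + 1) → A}

theorem sum_casimirTerm_one (h : IsSO J) :
    ∑ k, casimirTerm 1 J k = -2 • (spinBlock J ^ 2).trace + 4 • translForm J 1 := by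
  have h1 : ∑ k, casimirTerm 1 J k = ∑ a, ∑ b, 2 • (J a b * J a b) := by
    have : ∑ k, casimirTerm 1 J k = ∑ k : Fin 2 → Fin (N + 1), 2 • (J (k 0) (k 1) * J (k 0) (k 1)) :=
      Finset.sum_congr rfl fun k _ => casimirTerm_one h k
    rw [this]
    simp [sum_fin_succ_fun]
  have h2 := h.isSO_spinBlock.sum_mul_self
  rw [h1]
  simp only [Fin.sum_univ_castSucc, Finset.sum_add_distrib, h.diag, h.last_castSucc, neg_mul_neg,
    ← Finset.smul_sum]
  have h3 : ∑ a : Fin N, ∑ b : Fin N, J a.castSucc b.castSucc * J a.castSucc b.castSucc =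
    -(spinBlock J ^ 2).trace := h2
  have h4 : ∑ a : Fin N, J a.castSucc (Fin.last N) * J a.castSucc (Fin.last N) =
    translForm J 1 := (translForm_one).symm
  have h5 : ∑ a : Fin N, transl J a * transl J a = translForm J 1 := (translForm_one).symm
  rw [h3, h4, h5, mul_zero]
  module

/-- The four slots for the last index contribute equally, whence `64 = 2 · 4 · 8`. Doubling avoids
the halves that would arise from `IsSO.sum_pf₄`. -/
theorem sum_casimirTerm_two (h : IsSO J) :
    2 • ∑ k, casimirTerm 2 J k = 8 • (contr (spinBlock J) * spinBlock J).trace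
      - 64 • ((spinBlock J ^ 2).trace * translForm J 1
        + translForm J ((spinBlock J - (spinBlock J)ᵀ) *
          (((N : ℤ) - 1 - 1) • 1 - spinBlock J))) := by
  set X := spinBlock J with hX
  have hsp := sum_fun_split (L := 3) (casimirTerm 2 J) fun k i j hij hi hj =>
    casimirTerm_eq_zero 2 J k hij (hi.trans hj.symm)
  -- The symmetries carry the last index from every slot to slot `1`, where `m1` evaluates the sum.
  have c01 := sum_insertNth_congr (L := 3) (casimirTerm 2 J) (Equiv.swap 0 1)
    (casimirTerm_swap (n := 1) h) 0 1 1 fun k => by funext i; fin_cases i <;> rfl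
  have c20 := sum_insertNth_congr (L := 3) (casimirTerm 2 J) swapPairs₄
    (casimirTerm_swapPairs₄ h) 2 0 ⟨![2, 0, 1], ![1, 2, 0], by decide, by decide⟩
    fun k => by funext i; fin_cases i <;> rfl
  have c31 := sum_insertNth_congr (L := 3) (casimirTerm 2 J) swapPairs₄
    (casimirTerm_swapPairs₄ h) 3 1 ⟨![2, 0, 1], ![1, 2, 0], by decide, by decide⟩
    fun k => by funext i; fin_cases i <;> rfl
  have m1 : ∑ k : Fin 3 → Fin N, casimirTerm 2 J
      (Fin.insertNth 1 (Fin.last N) fun r => (k r).castSucc : Fin 4 → Fin (N + 1)) = 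
      -8 • ((X ^ 2).trace * translForm J 1
        + translForm J ((X - Xᵀ) * (((N : ℤ) - 1 - 1) • 1 - X))) := by
    have h1 : ∀ k : Fin 3 → Fin N, casimirTerm 2 J
        (Fin.insertNth 1 (Fin.last N) fun r => (k r).castSucc : Fin 4 → Fin (N + 1)) =
        8 • (X (k 1) (k 2) * (transl J (k 0) *
          pf₄ J (k 0).castSucc (Fin.last N) (k 1).castSucc (k 2).castSucc)) :=
      fun k => casimirTerm_two h _
    have h2 : ∀ c d, X c d * ((∑ b, transl J b * transl J b) * X c d) =
        X c d * X c d * ∑ b, transl J b * transl J b := fun c d => by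
      rw [← h.isInvariant_transl, mul_assoc]
    have h3 : ∀ w : Matrix (Fin N) (Fin N) A, (∀ a b, w a b = -w b a) →
        ∑ c, ∑ d, X c d * w c d = -(X * w).trace := fun w hw => by
      simp only [Matrix.trace, Matrix.diag_apply, Matrix.mul_apply, ← Finset.sum_neg_distrib]
      refine Finset.sum_congr rfl fun a _ => Finset.sum_congr rfl fun b _ => ?_
      rw [hw b a, mul_neg, neg_neg]
    have hs : IsSO X := h.isSO_spinBlock
    have ht := trace_mul_wedge (J := J) X 1
    rw [← hX] at ht
    simp only [h1]
    rw [sum_fin_three fun a b c => 8 • (X b c * (transl J a *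
      pf₄ J a.castSucc (Fin.last N) b.castSucc c.castSucc))]
    simp only [← Finset.smul_sum, ← Finset.mul_sum, h.sum_transl_mul_pf₄, ← hX, mul_add, h2,
      Finset.sum_add_distrib, ← Finset.sum_mul, hs.sum_mul_self, h3 _ (wedge_antisymm _ _)]
    rw [ht, translForm_one, neg_mul]
    module
  have s1 : ∑ k : Fin 4 → Fin N, casimirTerm 2 J (fun i => (k i).castSucc) =
      8 • ∑ a, ∑ b, ∑ c, ∑ d, X c d * X a b * pf₄ X a b c d := by
    have : ∀ k : Fin 4 → Fin N, casimirTerm 2 J (fun i => (k i).castSucc) =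
        8 • (X (k 2) (k 3) * (X (k 0) (k 1) * pf₄ X (k 0) (k 1) (k 2) (k 3))) := fun k => by
      rw [hX, ← pf₄_castSucc]
      exact casimirTerm_two h _
    simp only [this]
    simp [sum_fin_succ_fun, Finset.smul_sum, mul_assoc]
  rw [hsp, Fin.sum_univ_four, c20, c31, c01, m1, s1, smul_add, smul_comm, h.isSO_spinBlock.sum_pf₄]
  module

/-- Here six slots contribute equally, and `288 = 6 · 48`. -/
theorem sum_casimirTerm_three (h : IsSO J) :
    2 • ∑ k, casimirTerm 3 J k =
      48 • (-(spinBlock J ^ 2).trace * (contr (spinBlock J) * spinBlock J).trace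
        - 2 • (contr (spinBlock J) * contrW (spinBlock J)).trace)
      + 288 • ((contr (spinBlock J) * spinBlock J).trace * translForm J 1
        + 2 • translForm J ((contr (spinBlock J) - (contr (spinBlock J))ᵀ) *
          (((N : ℤ) - 1 - 2) • 1 - spinBlock J))) := by
  set X := spinBlock J with hX
  have hsp := sum_fun_split (L := 5) (casimirTerm 3 J) fun k i j hij hi hj =>
    casimirTerm_eq_zero 3 J k hij (hi.trans hj.symm)
  have c01 := sum_insertNth_congr (L := 5) (casimirTerm 3 J) (Equiv.swap 0 1)
    (casimirTerm_swap (n := 2) h) 0 1 1 fun k => by funext i; fin_cases i <;> rfl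
  have c20 := sum_insertNth_congr (L := 5) (casimirTerm 3 J) swapPairs₆
    (casimirTerm_swapPairs₆ h) 2 0
    ⟨![2, 0, 1, 3, 4], ![1, 2, 0, 3, 4], by decide, by decide⟩
    fun k => by funext i; fin_cases i <;> rfl
  have c31 := sum_insertNth_congr (L := 5) (casimirTerm 3 J) swapPairs₆
    (casimirTerm_swapPairs₆ h) 3 1
    ⟨![2, 0, 1, 3, 4], ![1, 2, 0, 3, 4], by decide, by decide⟩
    fun k => by funext i; fin_cases i <;> rfl
  have c40 := sum_insertNth_congr (L := 5) (casimirTerm 3 J) swapOuter₆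
    (casimirTerm_swapOuter₆ h) 4 0
    ⟨![4, 2, 3, 0, 1], ![3, 4, 1, 2, 0], by decide, by decide⟩
    fun k => by funext i; fin_cases i <;> rfl
  have c51 := sum_insertNth_congr (L := 5) (casimirTerm 3 J) swapOuter₆
    (casimirTerm_swapOuter₆ h) 5 1
    ⟨![4, 2, 3, 0, 1], ![3, 4, 1, 2, 0], by decide, by decide⟩
    fun k => by funext i; fin_cases i <;> rfl
  have m1 : 2 • ∑ k : Fin 5 → Fin N, casimirTerm 3 J
      (Fin.insertNth 1 (Fin.last N) fun r => (k r).castSucc : Fin 6 → Fin (N + 1)) =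
      48 • ((contr X * X).trace * translForm J 1
        + 2 • translForm J ((contr X - (contr X)ᵀ) * (((N : ℤ) - 1 - 2) • 1 - X))) := by
    have h1 : ∀ k : Fin 5 → Fin N, casimirTerm 3 J
        (Fin.insertNth 1 (Fin.last N) fun r => (k r).castSucc : Fin 6 → Fin (N + 1)) =
        48 • (X (k 3) (k 4) * (X (k 1) (k 2) * (transl J (k 0) *
          pf₆ J (k 0).castSucc (Fin.last N) (k 1).castSucc (k 2).castSucc (k 3).castSucc
            (k 4).castSucc))) :=
      fun k => casimirTerm_three h _
    -- The square of the translations commutes with each spin generator, hence with `pf₄`, and can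
    -- stand on the right as in the final formula.
    have h2 : ∀ a b c d, (∑ b, transl J b * transl J b) * pf₄ X a b c d =
        pf₄ X a b c d * ∑ b, transl J b * transl J b := fun a b c d => by
      have hq := h.isInvariant_transl
      rw [← hX] at hq
      generalize ∑ b, transl J b * transl J b = z at hq ⊢
      have hq' : ∀ a b, Commute z (X a b) := fun a b => (hq a b).symm
      have hk : ∀ n : ℤ, Commute z (n • 1) := fun n => by
        rw [Commute, SemiconjBy, mul_smul_comm, smul_mul_assoc, mul_one, one_mul]
      exact (((((hq' _ _).sub_right (hk _)).mul_right (hq' _ _)).sub_right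
        (((hq' _ _).sub_right (hk _)).mul_right (hq' _ _))).add_right
        (((hq' _ _).sub_right (hk _)).mul_right (hq' _ _))).eq
    have hw := (h.isVector_transl.isVector_shiftVec h.isSO_spinBlock 2).isTensor_wedge
      h.isVector_transl
    rw [← hX] at hw
    simp only [h1]
    rw [sum_fin_five fun a b c d e => 48 • (X d e * (X b c * (transl J a *
      pf₆ J a.castSucc (Fin.last N) b.castSucc c.castSucc d.castSucc e.castSucc)))]
    simp only [← Finset.smul_sum, ← Finset.mul_sum, h.sum_transl_mul_pf₆, ← hX, h2,
      hw.six_comm (wedge_antisymm _ _)]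
    simp only [← mul_assoc, mul_add, Finset.sum_add_distrib, ← Finset.sum_mul]
    rw [smul_comm, smul_add, ← smul_mul_assoc 2, hX, h.isSO_spinBlock.sum_pf₄,
      h.isSO_spinBlock.sum_mul_six (wedge_antisymm _ _), trace_mul_wedge, translForm_one]
  have s1 : 2 • ∑ k : Fin 6 → Fin N, casimirTerm 3 J (fun i => (k i).castSucc) =
      48 • (-(X ^ 2).trace * (contr X * X).trace - 2 • (contr X * contrW X).trace) := by
    have h1 : ∀ k : Fin 6 → Fin N, casimirTerm 3 J (fun i => (k i).castSucc) =
        48 • (X (k 4) (k 5) * (X (k 2) (k 3) * (X (k 0) (k 1) *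
          pf₆ X (k 0) (k 1) (k 2) (k 3) (k 4) (k 5)))) := fun k => by
      rw [hX, ← pf₆_castSucc]
      exact casimirTerm_three h _
    simp only [h1]
    rw [sum_fin_six fun a b c d e f => 48 • (X e f * (X c d * (X a b * pf₆ X a b c d e f)))]
    simp only [← Finset.smul_sum, ← Finset.mul_sum]
    rw [smul_comm, hX, ← h.isSO_spinBlock.sum_pf₆]
    simp only [mul_assoc]
  rw [hsp, Fin.sum_univ_six, c20, c31, c40, c51, c01]
  linear_combination (norm := module) s1 + (6 : ℤ) • m1

end Total

theorem pow_mul_pow_eq {M : Type*} [Monoid M] (x : M) {a b c : ℕ} (h : a + b = c) :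
    x ^ a * x ^ b = x ^ c := by
  rw [← pow_add, h]

/-! ### Closed forms of the trace contractions -/

section Explicit

variable {ι A : Type*} [DecidableEq ι] [Fintype ι] [Ring A] {X : Matrix ι ι A}

theorem IsSO.trace_five' (h : IsSO X) :
    2 • (X ^ 5).trace = -(((Fintype.card ι : ℤ) - 1) • (-(X ^ 4).trace
      + (2 * (Fintype.card ι : ℤ) - 2) • (X ^ 3).trace
      - (((Fintype.card ι : ℤ) - 1) * ((Fintype.card ι : ℤ) - 2)) • (X ^ 2).trace)
      + (X ^ 4).trace - (2 * (Fintype.card ι : ℤ) - 2) • (X ^ 4).trace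
      + (((Fintype.card ι : ℤ) - 1) * ((Fintype.card ι : ℤ) - 2)) • (X ^ 3).trace
      + (X ^ 2).trace * (X ^ 2).trace) := by
  have h1 := h.trace_five
  have p2 : X * X = X ^ 2 := (pow_two X).symm
  have p3 : X * X ^ 2 = X ^ 3 := (pow_succ' X 2).symm
  have p4 : X * X ^ 3 = X ^ 4 := (pow_succ' X 3).symm
  have p5 : X * X ^ 4 = X ^ 5 := (pow_succ' X 4).symm
  have e1 : ∀ k, X * Matrix.scalar ι (X ^ k).trace = Matrix.scalar ι (X ^ k).trace * X :=
    fun k => (h.isInvariant k).mul_scalar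
  have e2 : X * (Matrix.scalar ι (X ^ 2).trace * X) = Matrix.scalar ι (X ^ 2).trace * X ^ 2 := by
    rw [← mul_assoc, e1, mul_assoc, p2]
  rw [h.transpose_four, h.transpose_cube] at h1
  simp only [mul_add, mul_sub, mul_neg, mul_smul_comm, p2, p3, p4, p5, e1, e2,
    Matrix.trace_add, Matrix.trace_sub, Matrix.trace_neg, Matrix.trace_smul, trace_scalar_mul,
    h.trace_eq_zero, mul_zero] at h1
  linear_combination (norm := module) h1

theorem IsSO.contrW_eq (h : IsSO X) : contrW X =
    -(2 : ℤ) • X ^ 3 + (2 * (Fintype.card ι : ℤ) - 2) • X ^ 2 - (4 * (Fintype.card ι : ℤ) - 12) • X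
      - Matrix.scalar ι (X ^ 2).trace := by
  have p2 : X * X = X ^ 2 := (pow_two X).symm
  have p3 : X ^ 2 * X = X ^ 3 := (pow_succ X 2).symm
  have h1 : (contrH X)ᵀ * (X - 1) = ((Fintype.card ι : ℤ) - 3) • X ^ 2 - X ^ 3
      - ((Fintype.card ι : ℤ) - 4) • X := by
    rw [contrH, Matrix.transpose_sub, Matrix.transpose_smul, h.transpose_eq, h.transpose_sq]
    simp only [mul_sub, sub_mul, smul_mul_assoc, neg_mul, mul_one, p2, p3, smul_neg]
    module
  rw [contrW, h1]
  simp only [Matrix.transpose_sub, Matrix.transpose_smul, h.transpose_eq, h.transpose_sq,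
    h.transpose_cube]
  module

theorem transpose_scalar_mul (c : A) (T : Matrix ι ι A) :
    (Matrix.scalar ι c * T)ᵀ = Matrix.scalar ι c * Tᵀ := by
  ext a b
  simp

theorem IsSO.contr_sub_transpose (h : IsSO X) : contr X - (contr X)ᵀ =
    -(8 : ℤ) • X ^ 3 + (8 * (Fintype.card ι : ℤ) - 8) • X ^ 2
      + (4 : ℤ) • (Matrix.scalar ι (X ^ 2).trace * X) - (8 * (Fintype.card ι : ℤ) - 16) • X
      - (4 : ℤ) • Matrix.scalar ι (X ^ 2).trace := by
  simp only [contr, Matrix.transpose_sub, Matrix.transpose_add, Matrix.transpose_smul,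
    transpose_scalar_mul, h.transpose_eq, h.transpose_sq, h.transpose_cube, mul_neg]
  module

theorem IsSO.trace_contr_mul (h : IsSO X) : (contr X * X).trace =
    -(4 : ℤ) • (X ^ 4).trace + (2 * ((Fintype.card ι : ℤ) - 2) * ((Fintype.card ι : ℤ) - 3)) •
      (X ^ 2).trace + (2 : ℤ) • ((X ^ 2).trace * (X ^ 2).trace) := by
  have p2 : X * X = X ^ 2 := (pow_two X).symm
  have p3 : X ^ 2 * X = X ^ 3 := (pow_succ X 2).symm
  have p4 : X ^ 3 * X = X ^ 4 := (pow_succ X 3).symm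
  have t3 := h.trace_cube
  simp only [contr, add_mul, sub_mul, smul_mul_assoc, mul_assoc, p2, p3, p4,
    Matrix.trace_add, Matrix.trace_sub, Matrix.trace_smul, trace_scalar_mul]
  linear_combination (norm := module) (2 * (Fintype.card ι : ℤ) - 4) • t3

theorem IsSO.trace_contr_mul_contrW (h : IsSO X) {n : ℤ} (hn : n = Fintype.card ι) :
    (contr X * contrW X).trace =
    (8 : ℤ) • (X ^ 6).trace - (16 * n - 24) • (X ^ 5).trace
      - (4 : ℤ) • ((X ^ 2).trace * (X ^ 4).trace)
      + (2 * (2 * n - 4) + (2 * n - 2) * (4 * n - 8) + 4 * (4 * n - 12)) • (X ^ 4).trace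
      + (4 * n) • ((X ^ 2).trace * (X ^ 3).trace)
      - ((2 * n - 2) * (2 * n - 4) + (4 * n - 12) * (4 * n - 8)) • (X ^ 3).trace
      - (2 * (4 * n - 12) + (4 * n - 8)) • ((X ^ 2).trace * (X ^ 2).trace)
      + ((4 * n - 12) * (2 * n - 4)) • (X ^ 2).trace := by
  have p2 : X * X = X ^ 2 := (pow_two X).symm
  have p3 : X ^ 2 * X = X ^ 3 := (pow_succ X 2).symm
  have p3' : X * X ^ 2 = X ^ 3 := (pow_succ' X 2).symm
  have p4 : X ^ 3 * X = X ^ 4 := (pow_succ X 3).symm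
  have p4' : X * X ^ 3 = X ^ 4 := (pow_succ' X 3).symm
  have p4'' : X ^ 2 * X ^ 2 = X ^ 4 := pow_mul_pow_eq X rfl
  have p5 : X ^ 2 * X ^ 3 = X ^ 5 := pow_mul_pow_eq X rfl
  have p5' : X ^ 3 * X ^ 2 = X ^ 5 := pow_mul_pow_eq X rfl
  have p6 : X ^ 3 * X ^ 3 = X ^ 6 := pow_mul_pow_eq X rfl
  have e1 : X * Matrix.scalar ι (X ^ 2).trace = Matrix.scalar ι (X ^ 2).trace * X :=
    (h.isInvariant 2).mul_scalar
  have e2 : ∀ k, X ^ k * Matrix.scalar ι (X ^ 2).trace = Matrix.scalar ι (X ^ 2).trace * X ^ k :=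
    fun k => (Commute.pow_left (show Commute X _ from e1) k).eq
  rw [h.contrW_eq, ← hn]
  simp only [contr, ← hn, add_mul, sub_mul, mul_add, mul_sub, smul_mul_assoc, mul_smul_comm, mul_assoc,
    e1, e2, p2, p3, p3', p4, p4', p4'', p5, p5', p6,
    Matrix.trace_add, Matrix.trace_sub, Matrix.trace_smul, trace_scalar_mul, h.trace_eq_zero, mul_zero,
    smul_zero]
  module

end Explicit

/-! ### Elimination of odd powers -/

section Formula

variable {N : ℕ} {A : Type*} [Ring A] {J : Fin (N + 1) → Fin (N + 1) → A}

/-- Transposition negates `X`, so the transposition rule determines this quadratic form as half a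
trace. -/
theorem IsSO.translForm_self (h : IsSO J) :
    2 • translForm J (spinBlock J) = -(spinBlock J ^ 2).trace := by
  have h1 := h.translForm_transpose (spinBlock J)
  rw [h.isSO_spinBlock.transpose_eq, translForm_neg, ← pow_two] at h1
  linear_combination (norm := module) -(1 : ℤ) • h1

/-- The transposed cube starts with `-X ^ 3`, so the same rule reduces the cubic form to lower
degree. -/
theorem IsSO.translForm_cube (h : IsSO J) :
    2 • translForm J (spinBlock J ^ 3) = (2 * (N : ℤ) - 2) • translForm J (spinBlock J ^ 2)
      - (((N : ℤ) - 1) * ((N : ℤ) - 2)) • translForm J (spinBlock J)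
      - (spinBlock J ^ 2).trace * translForm J 1 - (spinBlock J ^ 4).trace := by
  have h1 := h.translForm_transpose (spinBlock J ^ 3)
  have h2 : Matrix.scalar (Fin N) (spinBlock J ^ 2).trace =
    Matrix.scalar (Fin N) (spinBlock J ^ 2).trace * 1 := (mul_one _).symm
  rw [h.isSO_spinBlock.transpose_cube, ← pow_succ, h2] at h1
  simp only [translForm_sub, translForm_add, translForm_smul, translForm_neg, Fintype.card_fin,
    translForm_scalar_mul] at h1
  linear_combination (norm := module) -(1 : ℤ) • h1

theorem IsSO.sum_casimirTerm_two_eq (h : IsSO J) :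
    2 • ∑ k, casimirTerm 2 J k = (2 : ℤ) • ((64 : ℤ) • translForm J (spinBlock J ^ 2)
      - (32 : ℤ) • ((spinBlock J ^ 2).trace * translForm J 1)
      + (8 * ((N : ℤ) - 2) * ((N : ℤ) + 1)) • (spinBlock J ^ 2).trace
      + (8 : ℤ) • ((spinBlock J ^ 2).trace * (spinBlock J ^ 2).trace)
      - (16 : ℤ) • (spinBlock J ^ 4).trace) := by
  have e0 := sum_casimirTerm_two h
  have e1 := h.translForm_self
  have p2 : spinBlock J * spinBlock J = spinBlock J ^ 2 := (pow_two _).symm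
  rw [h.isSO_spinBlock.transpose_eq, h.isSO_spinBlock.trace_contr_mul] at e0
  simp only [sub_neg_eq_add, mul_sub, add_mul, mul_smul_comm, mul_one, p2, Fintype.card_fin,
    translForm_sub, translForm_add, translForm_smul] at e0
  linear_combination (norm := module) e0 - (64 * ((N : ℤ) - 2)) • e1

/-- The quartic form is kept in the combination `X ^ 4 - (N - 2) X ^ 3 = (X ^ 2)ᵀ * X ^ 2`, whose
index pattern is that of `spinForm₂`. -/
theorem IsSO.sum_casimirTerm_three_eq (h : IsSO J) :
    2 • ∑ k, casimirTerm 3 J k = (2 : ℤ) • (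
      (2304 : ℤ) • (translForm J (spinBlock J ^ 4)
        - ((N : ℤ) - 2) • translForm J (spinBlock J ^ 3))
      + (288 : ℤ) • ((spinBlock J ^ 2).trace * (spinBlock J ^ 2).trace * translForm J 1)
      - (576 : ℤ) • ((spinBlock J ^ 4).trace * translForm J 1)
      - (1152 : ℤ) • ((spinBlock J ^ 2).trace * translForm J (spinBlock J ^ 2))
      + (288 * ((N : ℤ) ^ 2 - 5 * N + 10)) • ((spinBlock J ^ 2).trace * translForm J 1)
      - (2304 : ℤ) • translForm J (spinBlock J ^ 2)
      - (192 * ((N : ℤ) ^ 4 - 6 * (N : ℤ) ^ 3 + 13 * (N : ℤ) ^ 2 - 8 * N - 4)) •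
        (spinBlock J ^ 2).trace
      + (48 * (-3 * (N : ℤ) ^ 2 + N - 2)) • ((spinBlock J ^ 2).trace * (spinBlock J ^ 2).trace)
      + (384 * (2 * (N : ℤ) ^ 2 - 5 * N + 5)) • (spinBlock J ^ 4).trace
      - (48 : ℤ) • ((spinBlock J ^ 2).trace * (spinBlock J ^ 2).trace * (spinBlock J ^ 2).trace)
      + (288 : ℤ) • ((spinBlock J ^ 2).trace * (spinBlock J ^ 4).trace)
      - (384 : ℤ) • (spinBlock J ^ 6).trace) := by
  have e0 := sum_casimirTerm_three h
  have e1 := h.translForm_self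
  have e3 := h.translForm_cube
  have t3 := h.isSO_spinBlock.trace_cube
  have t5 := h.isSO_spinBlock.trace_five'
  have p2 : spinBlock J * spinBlock J = spinBlock J ^ 2 := (pow_two _).symm
  have p3 : spinBlock J ^ 2 * spinBlock J = spinBlock J ^ 3 := (pow_succ _ 2).symm
  have p4 : spinBlock J ^ 3 * spinBlock J = spinBlock J ^ 4 := (pow_succ _ 3).symm
  have e1' : (2 : ℤ) • ((spinBlock J ^ 2).trace * translForm J (spinBlock J)) =
      -((spinBlock J ^ 2).trace * (spinBlock J ^ 2).trace) := by
    rw [← mul_neg, ← e1, ← mul_smul_comm]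
    congr 1
    module
  have t3' : (2 : ℤ) • ((spinBlock J ^ 2).trace * (spinBlock J ^ 3).trace) =
      ((N : ℤ) - 2) • ((spinBlock J ^ 2).trace * (spinBlock J ^ 2).trace) := by
    rw [← mul_smul_comm, ← mul_smul_comm]
    congr 1
    rw [Fintype.card_fin] at t3
    linear_combination (norm := module) t3
  have hs (c : A) : translForm J (Matrix.scalar (Fin N) c) = c * translForm J 1 := by
    rw [← translForm_scalar_mul, mul_one]
  rw [h.isSO_spinBlock.contr_sub_transpose, h.isSO_spinBlock.trace_contr_mul,
    h.isSO_spinBlock.trace_contr_mul_contrW rfl] at e0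
  simp only [mul_add, mul_sub, add_mul, sub_mul, mul_smul_comm, smul_mul_assoc, mul_one, mul_assoc,
    p2, p3, p4, Fintype.card_fin, neg_mul] at e0
  simp only [translForm_sub, translForm_add, translForm_smul, translForm_scalar_mul, hs] at e0
  simp only [Fintype.card_fin] at t3 t5
  simp only [mul_assoc]
  -- Each multiplier removes one odd quantity: `e3` the surplus cubic form, `e1` and `e1'` the
  -- linear form, and `t3'`, `t5`, `t3` the odd traces.
  linear_combination (norm := module) e0 - (2304 * ((N : ℤ) - 2)) • e3
    + (1152 * ((N : ℤ) - 2) ^ 2 * (N - 1) - 2304 * (N - 3) * (N - 2)) • e1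
    + (1152 * ((N : ℤ) - 2)) • e1' - (192 * (N : ℤ)) • t3' + (48 * (16 * (N : ℤ) - 24)) • t5
    + (48 * ((2 * (N : ℤ) - 2) * (2 * N - 4) + (4 * N - 12) * (4 * N - 8))
      - 24 * (16 * N - 24) * ((N - 1) * (2 * N - 2) + (N - 1) * (N - 2))) • t3

end Formula

theorem pairProd_smul {κ A S : Type*} [Ring A] [CommRing S] [Algebra S A] (s : κ → S)
    (J : κ → κ → A) : ∀ (n : ℕ) (k : Fin (2 * n) → κ),
    pairProd (fun a b => (s a * s b) • J a b) k = (∏ i, s (k i)) • pairProd J k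
  | 0, k => by simp [pairProd_zero]
  | n + 1, k => by
    obtain ⟨a, k, rfl⟩ : ∃ a, ∃ k' : Fin (2 * n + 1) → κ, k = Matrix.vecCons a k' :=
      ⟨k 0, fun i => k i.succ, funext fun i => by refine Fin.cases ?_ (fun i => ?_) i <;> rfl⟩
    obtain ⟨b, k, rfl⟩ : ∃ a, ∃ k' : Fin (2 * n) → κ, k = Matrix.vecCons a k' :=
      ⟨k 0, fun i => k i.succ, funext fun i => by refine Fin.cases ?_ (fun i => ?_) i <;> rfl⟩
    rw [pairProd_cons, pairProd_cons, pairProd_smul s J n, smul_mul_smul_comm]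
    congr 1
    refine Eq.trans ?_ (Fin.prod_univ_succ (n := 2 * n + 1) _).symm
    rw [Fin.prod_univ_succ]
    simp [mul_assoc]

theorem exists_perm_of_antisymmetrizer_ne_zero {κ : Type*} [DecidableEq κ] {L : ℕ}
    {k m : Fin L → κ} (h : antisymmetrizer k m ≠ 0) : ∃ σ : Equiv.Perm (Fin L), k = m ∘ σ := by
  obtain ⟨σ, -, hσ⟩ := Finset.exists_ne_zero_of_sum_ne_zero h
  refine ⟨σ, funext fun i => ?_⟩
  by_contra hi
  exact hσ (mul_eq_zero_of_right _ (Finset.prod_eq_zero (Finset.mem_univ i) (if_neg hi)))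

theorem raise₂_diagonal {ι A : Type*} [Fintype ι] [DecidableEq ι] [AddCommGroup A] (ε : ι → ℤ)
    (T : ι → ι → A) (m n : ι) : raise₂ (Matrix.diagonal ε) T m n = (ε m * ε n) • T m n := by
  simp [raise₂, Matrix.diagonal_apply]

theorem raise_diagonal {ι A : Type*} [Fintype ι] [DecidableEq ι] [AddCommGroup A] (ε : ι → ℤ)
    (v : ι → A) (m : ι) : raise (Matrix.diagonal ε) v m = ε m • v m := by
  simp [raise, Matrix.diagonal_apply]

/-- Generators of the orthogonal Lie algebra of the metric `diag(ε)`. -/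
structure IsMetricSO {κ A : Type*} [DecidableEq κ] [Ring A] (ε : κ → ℤ) (J : κ → κ → A) :
    Prop where
  antisymm : ∀ a b, J a b = -J b a
  bracket : ∀ a b c d, J a b * J c d - J c d * J a b =
    (ε b * kd b c) • J a d + (ε a * kd a d) • J b c - (ε b * kd b d) • J a c
      - (ε a * kd a c) • J b d

/-- The Casimir operator without its normalization. -/
def casimirSum {κ A : Type*} [Fintype κ] [DecidableEq κ] [Ring A] (ε : κ → ℤ) (n : ℕ)
    (J : κ → κ → A) : A :=
  ∑ k : Fin (2 * n) → κ, ∑ m : Fin (2 * n) → κ,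
    antisymmetrizer k m • (pairProd J k * pairProd (raise₂ (Matrix.diagonal ε) J) m)

section Forms

variable {ι A : Type*} [Fintype ι] [Ring A] (ε : ι → ℤ) (M E : ι → ι → A)

/-- `M_{mn} M^{nm}`. -/
def spinTrace₂ : A := ∑ m, ∑ n, (ε m * ε n) • (M m n * M n m)

/-- `M_{mn} M^{nk} M_{kl} M^{lm}`. -/
def spinTrace₄ : A := ∑ m, ∑ n, ∑ k, ∑ l,
  (ε m * ε n * (ε k * ε l)) • (M m n * M n k * M k l * M l m)

/-- `M_{mn} M^{nk} M_{kl} M^{lr} M_{rs} M^{sm}`. -/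
def spinTrace₆ : A := ∑ m, ∑ n, ∑ k, ∑ l, ∑ r, ∑ s,
  (ε m * ε n * (ε k * ε l) * (ε r * ε s)) • (M m n * M n k * M k l * M l r * M r s * M s m)

/-- `η^{mn} E_{mn}`. -/
def spinForm₀ : A := ∑ m, ε m • E m m

/-- `M^{km} M_k^n E_{mn}`. -/
def spinForm₁ : A := ∑ k, ∑ m, ∑ n, (ε k * (ε m * ε n)) • (M k m * M k n * E m n)

/-- `M^k_d M^{dm} M_{kr} M^{rn} E_{mn}`. -/
def spinForm₂ : A := ∑ k, ∑ d, ∑ m, ∑ r, ∑ n,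
  (ε k * (ε d * ε m) * (ε r * ε n)) • (M k d * M d m * M k r * M r n * E m n)

end Forms

/-! ### Passage from a diagonal metric to the Euclidean one -/

section Rescale

variable {κ B L : Type*} [DecidableEq κ] [Ring B] [Field L] [CharZero L] [Algebra L B]
  {ε : κ → ℤ} {s : κ → L} {J : κ → κ → B}

/-- The generators rescaled by square roots of the metric. -/
def rescale (s : κ → L) (J : κ → κ → B) (a b : κ) : B := (s a * s b) • J a b

theorem IsMetricSO.isSO_rescale (h : IsMetricSO ε J) (hs : ∀ a, s a * s a = ε a)
    (hε : ∀ a, ε a * ε a = 1) : IsSO (rescale s J) where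
  antisymm a b := by rw [rescale, rescale, h.antisymm a b, smul_neg, mul_comm]
  diag a := by
    have h1 := h.antisymm a a
    have h2 : J a a = 0 := by linear_combination (norm := module) (1 / 2 : L) • h1
    rw [rescale, h2, smul_zero]
  bracket a b c d := by
    have h1 := h.bracket a b c d
    have h2 : rescale s J a b * rescale s J c d - rescale s J c d * rescale s J a b =
        (s a * s b * s c * s d) • (J a b * J c d - J c d * J a b) := by
      simp only [rescale, smul_mul_smul_comm]
      module
    -- Where the delta is nonzero, `s x * s x * ε x = ε x ^ 2 = 1`, and the metric disappears from
    -- the bracket.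
    have key : ∀ (x y : κ) (u v : L) (w : B), u = s x * s y * v →
        u • ((ε x * kd x y) • w) = kd x y • (v • w) := fun x y u v w hu => by
      rw [kd]
      split_ifs with hxy
      · subst hxy
        rw [mul_one, one_smul, hu, hs, ← Int.cast_smul_eq_zsmul L, smul_smul, mul_right_comm,
          ← Int.cast_mul, hε, Int.cast_one, one_mul]
      · simp
    rw [h2, h1, smul_sub, smul_sub, smul_add, key b c _ (s a * s d) _ (by ring),
      key a d _ (s b * s c) _ (by ring), key b d _ (s a * s c) _ (by ring),
      key a c _ (s b * s d) _ (by ring)]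
    rfl

/-- A nonzero antisymmetrizer forces `m` to be a rearrangement of `k`, so both products acquire the
same scaling factor. Its square is the product of the signs that raise the indices. -/
theorem casimirSum_eq_rescale [Fintype κ] (hs : ∀ a, s a * s a = ε a) (n : ℕ) :
    casimirSum ε n J = ∑ k, casimirTerm n (rescale s J) k := by
  have h1 : raise₂ (Matrix.diagonal ε) J = fun a b => (ε a * ε b) • J a b := by
    funext a b
    exact raise₂_diagonal ε J a b
  refine Finset.sum_congr rfl fun k _ => ?_
  rw [casimirTerm, altSum, Finset.mul_sum]
  refine Finset.sum_congr rfl fun m _ => ?_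
  by_cases h0 : antisymmetrizer k m = 0
  · simp [h0]
  obtain ⟨σ, rfl⟩ := exists_perm_of_antisymmetrizer_ne_zero h0
  have h2 : ∏ i, s ((m ∘ σ) i) = ∏ i, s (m i) := Equiv.prod_comp σ fun i => s (m i)
  have h3 : ∀ k : Fin (2 * n) → κ, pairProd (rescale s J) k = (∏ i, s (k i)) • pairProd J k :=
    pairProd_smul s J n
  rw [h3, h3, h1, pairProd_smul ε J n, mul_smul_comm (∏ i, ε (m i)), mul_smul_comm (antisymmetrizer _ _),
    smul_mul_smul_comm, h2,
    ← Finset.prod_mul_distrib, Finset.prod_congr rfl fun i _ => hs (m i), ← Int.cast_prod,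
    Int.cast_smul_eq_zsmul]

end Rescale

/-! ### Traces and forms in the original metric -/

section Block

variable {N : ℕ} {B L : Type*} [Ring B] [Field L] [CharZero L] [Algebra L B]
  {ε : Fin (N + 1) → ℤ} {s : Fin (N + 1) → L} {J : Fin (N + 1) → Fin (N + 1) → B}

theorem trace_rescale_two (hs : ∀ a, s a * s a = ε a) :
    (spinBlock (rescale s J) ^ 2).trace =
      spinTrace₂ (fun a : Fin N => ε a.castSucc) fun a b => J a.castSucc b.castSucc := by
  simp only [pow_succ', pow_zero, mul_one, Matrix.trace, Matrix.diag_apply, Matrix.mul_apply,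
    spinBlock, spinTrace₂, rescale, smul_mul_smul_comm,
    ← Int.cast_smul_eq_zsmul L, Int.cast_mul, ← hs]
  refine Finset.sum_congr rfl fun m _ => Finset.sum_congr rfl fun n _ => ?_
  congr 1
  ring

theorem trace_rescale_four (hs : ∀ a, s a * s a = ε a) :
    (spinBlock (rescale s J) ^ 4).trace =
      spinTrace₄ (fun a : Fin N => ε a.castSucc) fun a b => J a.castSucc b.castSucc := by
  simp only [pow_succ', pow_zero, mul_one, Matrix.trace, Matrix.diag_apply, Matrix.mul_apply,
    spinBlock, spinTrace₄, rescale, smul_mul_smul_comm, Finset.mul_sum,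
    ← Int.cast_smul_eq_zsmul L, Int.cast_mul, ← hs, mul_assoc]
  refine Finset.sum_congr rfl fun m _ => Finset.sum_congr rfl fun n _ =>
    Finset.sum_congr rfl fun k _ => Finset.sum_congr rfl fun l _ => ?_
  congr 1
  ring

theorem trace_rescale_six (hs : ∀ a, s a * s a = ε a) :
    (spinBlock (rescale s J) ^ 6).trace =
      spinTrace₆ (fun a : Fin N => ε a.castSucc) fun a b => J a.castSucc b.castSucc := by
  simp only [pow_succ', pow_zero, mul_one, Matrix.trace, Matrix.diag_apply, Matrix.mul_apply,
    spinBlock, spinTrace₆, rescale, smul_mul_smul_comm, Finset.mul_sum,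
    ← Int.cast_smul_eq_zsmul L, Int.cast_mul, ← hs, mul_assoc]
  refine Finset.sum_congr rfl fun m _ => Finset.sum_congr rfl fun n _ =>
    Finset.sum_congr rfl fun k _ => Finset.sum_congr rfl fun l _ =>
    Finset.sum_congr rfl fun r _ => Finset.sum_congr rfl fun t _ => ?_
  congr 1
  ring

/-- Two translations carry `s (Fin.last N) ^ 2 = -1`; this is the sign in front. -/
theorem translForm_rescale_one (hs : ∀ a, s a * s a = ε a) (hN : ε (Fin.last N) = -1) :
    translForm (rescale s J) 1 = -spinForm₀ (fun a : Fin N => ε a.castSucc)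
      fun a b => J b.castSucc (Fin.last N) * J a.castSucc (Fin.last N) := by
  have hN' : s (Fin.last N) * s (Fin.last N) = -1 := by rw [hs, hN]; simp
  rw [translForm_one, spinForm₀, ← Finset.sum_neg_distrib]
  refine Finset.sum_congr rfl fun m _ => ?_
  rw [← Int.cast_smul_eq_zsmul L, ← hs, ← neg_smul, transl, rescale, smul_mul_smul_comm]
  congr 1
  linear_combination s m.castSucc * s m.castSucc * hN'

/-- Here the `-1` of the last direction is compensated by exchanging the indices of the first spin
generator. -/
theorem translForm_rescale_two (h : IsMetricSO ε J) (hs : ∀ a, s a * s a = ε a)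
    (hN : ε (Fin.last N) = -1) :
    translForm (rescale s J) (spinBlock (rescale s J) ^ 2) =
      spinForm₁ (fun a : Fin N => ε a.castSucc) (fun a b => J a.castSucc b.castSucc)
      fun a b => J b.castSucc (Fin.last N) * J a.castSucc (Fin.last N) := by
  have hN' : s (Fin.last N) * s (Fin.last N) = -1 := by rw [hs, hN]; simp
  simp only [translForm, pow_succ', pow_zero, mul_one, Matrix.mul_apply, Finset.sum_mul,
    spinForm₁]
  rw [Finset.sum_congr rfl fun a _ => Finset.sum_comm, Finset.sum_comm]
  refine Finset.sum_congr rfl fun k _ => Finset.sum_congr rfl fun m _ =>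
    Finset.sum_congr rfl fun n _ => ?_
  rw [← Int.cast_smul_eq_zsmul L, Int.cast_mul, Int.cast_mul, ← hs, ← hs, ← hs]
  simp only [transl, spinBlock, rescale, smul_mul_smul_comm]
  rw [h.antisymm m.castSucc k.castSucc, neg_mul, neg_mul, smul_neg, ← neg_smul]
  congr 1
  linear_combination -(s k.castSucc * s k.castSucc * (s m.castSucc * s m.castSucc *
    (s n.castSucc * s n.castSucc))) * hN'

theorem sum_permute₅ {ι M : Type*} [Fintype ι] [AddCommMonoid M] (f : ι → ι → ι → ι → ι → M) :
    ∑ a, ∑ b, ∑ k, ∑ r, ∑ d, f a b k r d = ∑ k, ∑ d, ∑ a, ∑ r, ∑ b, f a b k r d := by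
  rw [Finset.sum_congr rfl fun a _ => Finset.sum_comm, Finset.sum_comm]
  refine Finset.sum_congr rfl fun k _ => ?_
  rw [Finset.sum_congr rfl fun a _ => Finset.sum_congr rfl fun b _ => Finset.sum_comm,
    Finset.sum_congr rfl fun a _ => Finset.sum_comm, Finset.sum_comm]
  exact Finset.sum_congr rfl fun d _ => Finset.sum_congr rfl fun a _ => Finset.sum_comm

theorem translForm_rescale_four (hs : ∀ a, s a * s a = ε a) (hN : ε (Fin.last N) = -1) :
    translForm (rescale s J) ((spinBlock (rescale s J) ^ 2)ᵀ * spinBlock (rescale s J) ^ 2) =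
      -spinForm₂ (fun a : Fin N => ε a.castSucc) (fun a b => J a.castSucc b.castSucc)
      fun a b => J b.castSucc (Fin.last N) * J a.castSucc (Fin.last N) := by
  have hN' : s (Fin.last N) * s (Fin.last N) = -1 := by rw [hs, hN]; simp
  simp only [translForm, pow_succ', pow_zero, mul_one, Matrix.mul_apply, Matrix.transpose_apply,
    Finset.sum_mul, Finset.mul_sum, spinForm₂, ← Finset.sum_neg_distrib]
  rw [sum_permute₅]
  refine Finset.sum_congr rfl fun k _ => Finset.sum_congr rfl fun d _ =>
    Finset.sum_congr rfl fun m _ => Finset.sum_congr rfl fun r _ =>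
    Finset.sum_congr rfl fun n _ => ?_
  rw [← Int.cast_smul_eq_zsmul L]
  simp only [Int.cast_mul, ← hs, ← neg_smul]
  simp only [transl, spinBlock, rescale, smul_mul_smul_comm, mul_assoc]
  congr 1
  linear_combination (s k.castSucc * s k.castSucc * (s m.castSucc * s m.castSucc *
    (s n.castSucc * s n.castSucc)) * (s r.castSucc * s r.castSucc * (s d.castSucc * s d.castSucc)))
    * hN'

/-- The spin block of a family of generators. -/
def blockOf (J : Fin (N + 1) → Fin (N + 1) → B) (a b : Fin N) : B := J a.castSucc b.castSucc

/-- The products of two translations, in reversed order. -/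
def translSq (J : Fin (N + 1) → Fin (N + 1) → B) (a b : Fin N) : B :=
  J b.castSucc (Fin.last N) * J a.castSucc (Fin.last N)

end Block

/-! ### The Casimir sums for a general diagonal metric -/

section Sums

variable {N : ℕ} {A : Type*} [Ring A] (ε : Fin (N + 1) → ℤ) (J : Fin (N + 1) → Fin (N + 1) → A)

/-- The value of the quadratic Casimir sum in terms of the spin block and the translations. -/
def casimirValue₁ (ε : Fin N → ℤ) (X E : Fin N → Fin N → A) : A :=
  -(2 : ℤ) • spinTrace₂ ε X - (4 : ℤ) • spinForm₀ ε E

/-- The value of the quartic Casimir sum in terms of the spin block and the translations. -/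
def casimirValue₂ (ε : Fin N → ℤ) (X E : Fin N → Fin N → A) : A :=
  (64 : ℤ) • spinForm₁ ε X E + (32 : ℤ) • (spinTrace₂ ε X * spinForm₀ ε E)
    + (8 * ((N : ℤ) - 2) * ((N : ℤ) + 1)) • spinTrace₂ ε X
    + (8 : ℤ) • (spinTrace₂ ε X * spinTrace₂ ε X) - (16 : ℤ) • spinTrace₄ ε X

/-- The value of the sextic Casimir sum in terms of the spin block and the translations. -/
def casimirValue₃ (ε : Fin N → ℤ) (X E : Fin N → Fin N → A) : A :=
  -(2304 : ℤ) • spinForm₂ ε X E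
    - (288 : ℤ) • (spinTrace₂ ε X * spinTrace₂ ε X * spinForm₀ ε E)
    + (576 : ℤ) • (spinTrace₄ ε X * spinForm₀ ε E)
    - (1152 : ℤ) • (spinTrace₂ ε X * spinForm₁ ε X E)
    - (288 * ((N : ℤ) ^ 2 - 5 * N + 10)) • (spinTrace₂ ε X * spinForm₀ ε E)
    - (2304 : ℤ) • spinForm₁ ε X E
    - (192 * ((N : ℤ) ^ 4 - 6 * (N : ℤ) ^ 3 + 13 * (N : ℤ) ^ 2 - 8 * N - 4)) • spinTrace₂ ε X
    + (48 * (-3 * (N : ℤ) ^ 2 + N - 2)) • (spinTrace₂ ε X * spinTrace₂ ε X)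
    + (384 * (2 * (N : ℤ) ^ 2 - 5 * N + 5)) • spinTrace₄ ε X
    - (48 : ℤ) • (spinTrace₂ ε X * spinTrace₂ ε X * spinTrace₂ ε X)
    + (288 : ℤ) • (spinTrace₂ ε X * spinTrace₄ ε X)
    - (384 : ℤ) • spinTrace₆ ε X

variable {ε J} {L : Type*} [Field L] [CharZero L] [Algebra L A] {s : Fin (N + 1) → L}

theorem casimirSum_eq_of_sqrt (h : IsMetricSO ε J) (hs : ∀ a, s a * s a = ε a)
    (hε : ∀ a, ε a * ε a = 1) (hN : ε (Fin.last N) = -1) :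
    casimirSum ε 1 J = casimirValue₁ (fun a => ε a.castSucc) (blockOf J) (translSq J) ∧
    casimirSum ε 2 J = casimirValue₂ (fun a => ε a.castSucc) (blockOf J) (translSq J) ∧
    casimirSum ε 3 J = casimirValue₃ (fun a => ε a.castSucc) (blockOf J) (translSq J) := by
  have hJ := h.isSO_rescale hs hε
  have t2 : (spinBlock (rescale s J) ^ 2).trace =
    spinTrace₂ (fun a : Fin N => ε a.castSucc) (blockOf J) := trace_rescale_two hs
  have t4 : (spinBlock (rescale s J) ^ 4).trace =
    spinTrace₄ (fun a : Fin N => ε a.castSucc) (blockOf J) := trace_rescale_four hs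
  have t6 : (spinBlock (rescale s J) ^ 6).trace =
    spinTrace₆ (fun a : Fin N => ε a.castSucc) (blockOf J) := trace_rescale_six hs
  have d0 : translForm (rescale s J) 1 = -spinForm₀ (fun a : Fin N => ε a.castSucc) (translSq J) :=
    translForm_rescale_one hs hN
  have d2 : translForm (rescale s J) (spinBlock (rescale s J) ^ 2) =
      spinForm₁ (fun a : Fin N => ε a.castSucc) (blockOf J) (translSq J) :=
    translForm_rescale_two h hs hN
  have d4 : translForm (rescale s J) (spinBlock (rescale s J) ^ 4)
      - ((N : ℤ) - 2) • translForm (rescale s J) (spinBlock (rescale s J) ^ 3) =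
      -spinForm₂ (fun a : Fin N => ε a.castSucc) (blockOf J) (translSq J) := by
    have := translForm_rescale_four (s := s) (J := J) hs hN
    rw [hJ.isSO_spinBlock.transpose_sq, Fintype.card_fin, sub_mul, smul_mul_assoc, ← pow_add,
      ← pow_succ', translForm_sub, translForm_smul] at this
    exact this
  rw [casimirSum_eq_rescale hs, casimirSum_eq_rescale hs, casimirSum_eq_rescale hs]
  refine ⟨?_, ?_, ?_⟩
  · rw [sum_casimirTerm_one hJ, t2, d0, casimirValue₁]
    module
  · have := hJ.sum_casimirTerm_two_eq
    rw [t2, t4, d0, d2] at this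
    rw [casimirValue₂]
    simp only [mul_neg] at this
    linear_combination (norm := module) (1 / 2 : L) • this
  · have := hJ.sum_casimirTerm_three_eq
    rw [t2, t4, t6, d0, d2, d4] at this
    rw [casimirValue₃]
    simp only [mul_neg] at this
    linear_combination (norm := module) (1 / 2 : L) • this

section Map

variable {ι A B : Type*} [Fintype ι] [Ring A] [Ring B] (f : A →+* B) (ε : ι → ℤ) (X E : ι → ι → A)

theorem map_spinTrace₂ : f (spinTrace₂ ε X) = spinTrace₂ ε fun a b => f (X a b) := by
  simp only [spinTrace₂, map_sum, map_zsmul, map_mul]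

theorem map_spinTrace₄ : f (spinTrace₄ ε X) = spinTrace₄ ε fun a b => f (X a b) := by
  simp only [spinTrace₄, map_sum, map_zsmul, map_mul]

theorem map_spinTrace₆ : f (spinTrace₆ ε X) = spinTrace₆ ε fun a b => f (X a b) := by
  simp only [spinTrace₆, map_sum, map_zsmul, map_mul]

theorem map_spinForm₀ : f (spinForm₀ ε E) = spinForm₀ ε fun a b => f (E a b) := by
  simp only [spinForm₀, map_sum, map_zsmul]

theorem map_spinForm₁ : f (spinForm₁ ε X E) =
    spinForm₁ ε (fun a b => f (X a b)) fun a b => f (E a b) := by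
  simp only [spinForm₁, map_sum, map_zsmul, map_mul]

theorem map_spinForm₂ : f (spinForm₂ ε X E) =
    spinForm₂ ε (fun a b => f (X a b)) fun a b => f (E a b) := by
  simp only [spinForm₂, map_sum, map_zsmul, map_mul]

theorem map_casimirSum [DecidableEq ι] (n : ℕ) :
    f (casimirSum ε n X) = casimirSum ε n fun a b => f (X a b) := by
  simp only [casimirSum, map_sum, map_zsmul, map_mul, pairProd, map_list_prod, List.map_ofFn,
    raise₂, Function.comp_def]

end Map

/-- The base field may lack square roots of the signs. Its algebraic closure `L` has them, `A`
embeds into `L ⊗ A`, and the identities have integer coefficients, so they descend. -/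
theorem casimirSum_eq (𝕜 : Type*) [Field 𝕜] [CharZero 𝕜] [Algebra 𝕜 A] (h : IsMetricSO ε J)
    (hε : ∀ a, ε a * ε a = 1) (hN : ε (Fin.last N) = -1) :
    casimirSum ε 1 J = casimirValue₁ (fun a => ε a.castSucc) (blockOf J) (translSq J) ∧
    casimirSum ε 2 J = casimirValue₂ (fun a => ε a.castSucc) (blockOf J) (translSq J) ∧
    casimirSum ε 3 J = casimirValue₃ (fun a => ε a.castSucc) (blockOf J) (translSq J) := by
  let L := AlgebraicClosure 𝕜
  have : CharZero L := charZero_of_injective_algebraMap (algebraMap 𝕜 L).injective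
  let f : A →+* TensorProduct 𝕜 L A := (Algebra.TensorProduct.includeRight : A →ₐ[𝕜] _).toRingHom
  have hf : Function.Injective f :=
    Algebra.TensorProduct.includeRight_injective (algebraMap 𝕜 L).injective
  have hs : ∀ a, ∃ s : L, s * s = ε a := fun a => by
    obtain ⟨z, hz⟩ := IsAlgClosed.exists_pow_nat_eq (ε a : L) two_pos
    exact ⟨z, by rw [← hz, pow_two]⟩
  choose s hs using hs
  have hJ : IsMetricSO ε fun a b => f (J a b) :=
    ⟨fun a b => by rw [h.antisymm, map_neg], fun a b c d => by
      rw [← map_mul, ← map_mul, ← map_sub, h.bracket a b c d]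
      simp only [map_sub, map_add, map_zsmul]⟩
  obtain ⟨h1, h2, h3⟩ := casimirSum_eq_of_sqrt hJ hs hε hN
  have e1 : blockOf (fun a b => f (J a b)) = fun a b => f (blockOf J a b) := rfl
  have e2 : translSq (fun a b => f (J a b)) = fun a b => f (translSq J a b) := by
    funext a b
    exact (map_mul f _ _).symm
  rw [e1, e2] at h1 h2 h3
  refine ⟨hf ?_, hf ?_, hf ?_⟩
  · rw [map_casimirSum, h1]
    simp only [casimirValue₁, map_sub, map_zsmul, map_spinTrace₂, map_spinForm₀]
  · rw [map_casimirSum, h2]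
    simp only [casimirValue₂, map_sub, map_add, map_mul, map_zsmul, map_spinTrace₂,
      map_spinTrace₄, map_spinForm₀, map_spinForm₁]
  · rw [map_casimirSum, h3]
    simp only [casimirValue₃, map_sub, map_add, map_mul, map_zsmul, map_spinTrace₂,
      map_spinTrace₄, map_spinTrace₆, map_spinForm₀, map_spinForm₁, map_spinForm₂]

end Sums

/-! ### Invariance under pseudo-orthogonal changes of basis -/

section Rotation

variable {κ A S : Type*} [Fintype κ] [Ring A] [CommRing S] [Algebra S A]

/-- The generators in the basis given by the columns of `Λ`. -/
def rotate (Λ : κ → κ → S) (J : κ → κ → A) (a b : κ) : A :=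
  ∑ c, ∑ d, (Λ c a * Λ d b) • J c d

theorem pairProd_rotate (Λ : κ → κ → S) (J : κ → κ → A) : ∀ (n : ℕ) (k : Fin (2 * n) → κ),
    pairProd (rotate Λ J) k = ∑ l : Fin (2 * n) → κ, (∏ i, Λ (l i) (k i)) • pairProd J l
  | 0, k => by simp [pairProd_zero]
  | n + 1, k => by
    obtain ⟨a, k, rfl⟩ : ∃ a, ∃ k' : Fin (2 * n + 1) → κ, k = Matrix.vecCons a k' :=
      ⟨k 0, fun i => k i.succ, funext fun i => by refine Fin.cases ?_ (fun i => ?_) i <;> rfl⟩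
    obtain ⟨b, k, rfl⟩ : ∃ a, ∃ k' : Fin (2 * n) → κ, k = Matrix.vecCons a k' :=
      ⟨k 0, fun i => k i.succ, funext fun i => by refine Fin.cases ?_ (fun i => ?_) i <;> rfl⟩
    rw [pairProd_cons, pairProd_rotate Λ J n, rotate]
    refine Eq.trans ?_ (sum_fin_succ_fun (N := 2 * n + 1) _).symm
    rw [Finset.sum_mul]
    refine Finset.sum_congr rfl fun c _ => ?_
    rw [sum_fin_succ_fun, Finset.sum_mul]
    refine Finset.sum_congr rfl fun d _ => ?_
    rw [Finset.mul_sum]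
    refine Finset.sum_congr rfl fun l _ => ?_
    rw [pairProd_cons, smul_mul_smul_comm]
    congr 1
    refine Eq.trans ?_ (Fin.prod_univ_succ (n := 2 * n + 1) _).symm
    rw [Fin.prod_univ_succ]
    simp [mul_assoc]

variable [DecidableEq κ] {ε : κ → ℤ} {Λ : κ → κ → S} {J : κ → κ → A}

theorem casimirSum_eq_smul (ε : κ → ℤ) (n : ℕ) (J : κ → κ → A) :
    casimirSum ε n J = ∑ k : Fin (2 * n) → κ, ∑ m : Fin (2 * n) → κ,
      ((antisymmetrizer k m : S) * ∏ i, (ε (m i) : S)) • (pairProd J k * pairProd J m) := by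
  have h1 : raise₂ (Matrix.diagonal ε) J = fun a b => (ε a * ε b) • J a b := by
    funext a b
    exact raise₂_diagonal ε J a b
  refine Finset.sum_congr rfl fun k _ => Finset.sum_congr rfl fun m _ => ?_
  rw [h1, pairProd_smul ε J n, mul_smul_comm, smul_smul, ← Int.cast_smul_eq_zsmul S]
  push_cast
  rfl

theorem prod_ite_eq_comp {L : ℕ} (f : Fin L → κ → S) (l : Fin L → κ) :
    ∑ k : Fin L → κ, (∏ i, if k i = l i then (1 : S) else 0) * ∏ i, f i (k i) =
      ∏ i, f i (l i) := by
  rw [Finset.sum_eq_single l]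
  · simp
  · intro k _ hk
    obtain ⟨i, hi⟩ := Function.ne_iff.mp hk
    rw [Finset.prod_eq_zero (Finset.mem_univ i) (if_neg hi), zero_mul]
  · simp

/-- For each permutation the deltas remove the sum over `k`, and the sum over `m` factorises over
the slots into orthogonality relations of the rows of `Λ`. -/
theorem sum_antisymmetrizer_mul (hΛ : ∀ c d, ∑ a, (ε a : S) * Λ c a * Λ d a = ε c * kd c d)
    {L : ℕ} (k' m' : Fin L → κ) :
    ∑ k : Fin L → κ, ∑ m : Fin L → κ, (antisymmetrizer k m : S) * (∏ i, (ε (m i) : S)) *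
      ((∏ i, Λ (k' i) (k i)) * ∏ i, Λ (m' i) (m i)) =
      (antisymmetrizer k' m' : S) * ∏ i, (ε (m' i) : S) := by
  simp only [antisymmetrizer, Int.cast_sum, Int.cast_mul, Int.cast_prod, Int.cast_ite, Int.cast_one,
    Int.cast_zero, Finset.sum_mul]
  rw [Finset.sum_congr rfl fun k _ => Finset.sum_comm, Finset.sum_comm]
  refine Finset.sum_congr rfl fun σ _ => ?_
  rw [Finset.sum_comm]
  have h1 : ∀ m : Fin L → κ, ∑ k : Fin L → κ,
      ((Equiv.Perm.sign σ : ℤ) : S) * (∏ i, if k i = m (σ i) then (1 : S) else 0) *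
        (∏ i, (ε (m i) : S)) * ((∏ i, Λ (k' i) (k i)) * ∏ i, Λ (m' i) (m i)) =
      ((Equiv.Perm.sign σ : ℤ) : S) * ∏ i, ((ε (m i) : S) * Λ (m' i) (m i) *
        Λ (k' (σ.symm i)) (m i)) := by
    intro m
    have h2 := prod_ite_eq_comp (fun i a => Λ (k' i) a) fun i => m (σ i)
    have h3 : ∏ i, Λ (k' i) (m (σ i)) = ∏ i, Λ (k' (σ.symm i)) (m i) := by
      rw [← Equiv.prod_comp σ fun i => Λ (k' (σ.symm i)) (m i)]
      simp
    rw [Finset.prod_mul_distrib, Finset.prod_mul_distrib, ← h3, ← h2, Finset.mul_sum,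
      Finset.mul_sum]
    refine Finset.sum_congr rfl fun k _ => ?_
    ring
  rw [Finset.sum_congr rfl fun m _ => h1 m, ← Finset.mul_sum, mul_assoc]
  congr 1
  have h4 := Finset.prod_univ_sum (fun _ : Fin L => (Finset.univ : Finset κ))
    fun i a => (ε a : S) * Λ (m' i) a * Λ (k' (σ.symm i)) a
  rw [Fintype.piFinset_univ] at h4
  rw [← h4, Finset.prod_congr rfl fun i _ => hΛ (m' i) (k' (σ.symm i)), Finset.prod_mul_distrib,
    mul_comm]
  congr 1
  rw [← Equiv.prod_comp σ]
  refine Finset.prod_congr rfl fun i _ => ?_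
  rw [σ.symm_apply_apply, kd_comm, kd]
  split_ifs <;> simp

/-- No Lie algebra relation enters, but the entries of `Λ` must be scalars to be pulled out of the
ordered products. For this reason the frame is frozen at one point at a time. -/
theorem casimirSum_rotate (hΛ : ∀ c d, ∑ a, (ε a : S) * Λ c a * Λ d a = ε c * kd c d) (n : ℕ) :
    casimirSum ε n (rotate Λ J) = casimirSum ε n J := by
  rw [casimirSum_eq_smul (S := S), casimirSum_eq_smul (S := S)]
  simp only [pairProd_rotate, Finset.sum_mul_sum, Finset.smul_sum, smul_mul_smul_comm, smul_smul]
  have h1 : ∀ f : (Fin (2 * n) → κ) → (Fin (2 * n) → κ) → (Fin (2 * n) → κ) →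
      (Fin (2 * n) → κ) → A, ∑ k, ∑ m, ∑ k', ∑ m', f k m k' m' =
      ∑ k', ∑ m', ∑ k, ∑ m, f k m k' m' := fun f => by
    rw [Finset.sum_congr rfl fun k _ => Finset.sum_comm, Finset.sum_comm]
    refine Finset.sum_congr rfl fun k' _ => ?_
    rw [Finset.sum_congr rfl fun k _ => Finset.sum_comm, Finset.sum_comm]
  rw [h1]
  refine Finset.sum_congr rfl fun k' _ => Finset.sum_congr rfl fun m' _ => ?_
  simp only [← Finset.sum_smul]
  rw [sum_antisymmetrizer_mul hΛ]

theorem sum_contract_rotate (hΛ : ∀ a b, ∑ c, (ε c : S) * Λ c a * Λ c b = ε a * kd a b)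
    (a b c d : κ) : ∑ e, ∑ f, ∑ g, ∑ h, (Λ e a * Λ f b * (Λ g c * Λ h d)) •
      ((ε f * kd f g) • J e h) = (ε b * kd b c) • rotate Λ J a d := by
  have h1 : ∀ e f g h, (Λ e a * Λ f b * (Λ g c * Λ h d)) • ((ε f * kd f g) • J e h) =
      if f = g then ((ε f : S) * Λ f b * Λ f c) • ((Λ e a * Λ h d) • J e h) else 0 := by
    intro e f g h
    rw [kd]
    split_ifs with hfg
    · subst hfg
      rw [mul_one, ← Int.cast_smul_eq_zsmul S, smul_smul, smul_smul]
      congr 1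
      ring
    · simp
  have h2 : ∀ e, ∑ f, ∑ g, ∑ h, (Λ e a * Λ f b * (Λ g c * Λ h d)) • ((ε f * kd f g) • J e h) =
      ∑ h, (ε b * kd b c) • ((Λ e a * Λ h d) • J e h) := by
    intro e
    simp only [h1]
    rw [Finset.sum_congr rfl fun f _ => Finset.sum_comm, Finset.sum_comm]
    refine Finset.sum_congr rfl fun h _ => ?_
    simp only [Finset.sum_ite_eq, Finset.mem_univ, if_true]
    rw [← Finset.sum_smul, hΛ, ← Int.cast_mul, Int.cast_smul_eq_zsmul]
  simp only [h2, rotate, Finset.smul_sum]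

theorem IsMetricSO.rotate (h : IsMetricSO ε J)
    (hΛ : ∀ a b, ∑ c, (ε c : S) * Λ c a * Λ c b = ε a * kd a b) :
    IsMetricSO ε (rotate Λ J) where
  antisymm a b := by
    rw [Pseudosphere.rotate, Pseudosphere.rotate, Finset.sum_comm]
    simp only [← Finset.sum_neg_distrib]
    refine Finset.sum_congr rfl fun c _ => Finset.sum_congr rfl fun d _ => ?_
    rw [h.antisymm d c, smul_neg, mul_comm]
  bracket a b c d := by
    have h1 : Pseudosphere.rotate Λ J a b * Pseudosphere.rotate Λ J c d
        - Pseudosphere.rotate Λ J c d * Pseudosphere.rotate Λ J a b =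
        ∑ e, ∑ f, ∑ g, ∑ k, (Λ e a * Λ f b * (Λ g c * Λ k d)) •
          (J e f * J g k - J g k * J e f) := by
      have h2 : Pseudosphere.rotate Λ J c d * Pseudosphere.rotate Λ J a b =
          ∑ e, ∑ f, ∑ g, ∑ k, (Λ e a * Λ f b * (Λ g c * Λ k d)) • (J g k * J e f) := by
        simp only [Pseudosphere.rotate, Finset.mul_sum, Finset.sum_mul, smul_mul_smul_comm,
          mul_comm]
      have h3 : Pseudosphere.rotate Λ J a b * Pseudosphere.rotate Λ J c d =
          ∑ e, ∑ f, ∑ g, ∑ k, (Λ e a * Λ f b * (Λ g c * Λ k d)) • (J e f * J g k) := by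
        rw [Pseudosphere.rotate, Finset.sum_mul]
        refine Finset.sum_congr rfl fun e _ => ?_
        rw [Finset.sum_mul]
        refine Finset.sum_congr rfl fun f _ => ?_
        simp only [Pseudosphere.rotate, Finset.mul_sum, smul_mul_smul_comm]
      rw [h2, h3]
      simp only [smul_sub, Finset.sum_sub_distrib]
    have e1 := sum_contract_rotate (J := J) hΛ a b c d
    have e2 : ∑ e, ∑ f, ∑ g, ∑ k, (Λ e a * Λ f b * (Λ g c * Λ k d)) •
        ((ε e * kd e k) • J f g) = (ε a * kd a d) • Pseudosphere.rotate Λ J b c := by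
      rw [← sum_contract_rotate hΛ, Finset.sum_comm]
      refine Finset.sum_congr rfl fun f _ => Finset.sum_congr rfl fun e _ => ?_
      rw [Finset.sum_comm]
      simp only [mul_comm]
    have e3 : ∑ e, ∑ f, ∑ g, ∑ k, (Λ e a * Λ f b * (Λ g c * Λ k d)) •
        ((ε f * kd f k) • J e g) = (ε b * kd b d) • Pseudosphere.rotate Λ J a c := by
      rw [← sum_contract_rotate hΛ]
      refine Finset.sum_congr rfl fun e _ => Finset.sum_congr rfl fun f _ => ?_
      rw [Finset.sum_comm]
      simp only [mul_comm]
    have e4 : ∑ e, ∑ f, ∑ g, ∑ k, (Λ e a * Λ f b * (Λ g c * Λ k d)) •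
        ((ε e * kd e g) • J f k) = (ε a * kd a c) • Pseudosphere.rotate Λ J b d := by
      rw [← sum_contract_rotate hΛ, Finset.sum_comm]
      simp only [mul_comm]
    simp only [h1, h.bracket, smul_sub, smul_add, Finset.sum_sub_distrib, Finset.sum_add_distrib,
      e1, e2, e3, e4]

end Rotation

/-! ### Commutators of coordinates, derivatives and spin operators -/

section Ad

variable {A : Type*} [Ring A]

/-- The commutator with `a`. -/
def ad (a : A) : A →+ A := AddMonoidHom.mulLeft a - AddMonoidHom.mulRight a

theorem ad_apply (a b : A) : ad a b = a * b - b * a := rfl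

theorem ad_swap (a b : A) : ad a b = -ad b a := by simp [ad_apply]

theorem ad_mul (a b c : A) : ad a (b * c) = ad a b * c + b * ad a c := by
  simp only [ad_apply]; noncomm_ring

theorem ad_smul {S : Type*} [CommRing S] [Algebra S A] (r : S) (a b : A) :
    ad a (r • b) = r • ad a b := by
  simp [ad_apply, smul_sub]

theorem mul_eq_mul_add_ad (a b : A) : a * b = b * a + ad a b := by
  simp [ad_apply]

end Ad

/-- The entries of the metric `diag(ε)`. -/
def diagMetric {ι : Type*} [DecidableEq ι] (ε : ι → ℤ) (a b : ι) : ℤ := ε a * kd a b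

section DiagMetric

variable {ι : Type*} [DecidableEq ι] {ε : ι → ℤ}

theorem diagMetric_comm (a b : ι) : diagMetric ε a b = diagMetric ε b a := by
  rw [diagMetric, diagMetric, kd_comm]
  rw [kd]
  split_ifs with h
  · rw [h]
  · simp

theorem sum_diagMetric {A : Type*} [Fintype ι] [AddCommGroup A] (hε : ∀ a, ε a * ε a = 1) (n : ι)
    (v : ι → A) : ∑ k, ε k • (diagMetric ε n k • v k) = v n := by
  rw [Finset.sum_eq_single n]
  · rw [diagMetric, kd, if_pos rfl, mul_one, smul_smul, hε, one_smul]
  · intro b _ hb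
    simp [diagMetric, kd, hb.symm]
  · simp

theorem sum_diagMetric' {A : Type*} [Fintype ι] [AddCommGroup A] (hε : ∀ a, ε a * ε a = 1) (n : ι)
    (v : ι → A) : ∑ k, ε k • (diagMetric ε k n • v k) = v n := by
  simp only [diagMetric_comm _ n, sum_diagMetric hε]

end DiagMetric

/-- Coordinates, derivatives and spin operators. -/
structure IsWeylSpin {ι A : Type*} [DecidableEq ι] [Ring A] (ε : ι → ℤ) (x d : ι → A)
    (M : ι → ι → A) : Prop where
  sq_eq_one : ∀ a, ε a * ε a = 1
  ad_x_x : ∀ m n, ad (x m) (x n) = 0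
  ad_d_d : ∀ m n, ad (d m) (d n) = 0
  ad_d_x : ∀ m n, ad (d m) (x n) = diagMetric ε m n • 1
  antisymm : ∀ m n, M m n = -M n m
  ad_x_M : ∀ k m n, ad (x k) (M m n) = 0
  ad_d_M : ∀ k m n, ad (d k) (M m n) = 0
  ad_M_M : ∀ m n k l, ad (M m n) (M k l) = diagMetric ε n k • M m l + diagMetric ε m l • M n k
    - diagMetric ε n l • M m k - diagMetric ε m k • M n l

section Weyl

variable {ι A : Type*} [Fintype ι] [Ring A] (ε : ι → ℤ) (x d : ι → A) (M : ι → ι → A)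

/-- The contraction `x^k v_k`. -/
def dotOp (v : ι → A) : A := ∑ k, ε k • (x k * v k)

/-- `x^k M_{kn}`. -/
def spinRot (n : ι) : A := dotOp ε x fun k => M k n

/-- The special conformal generators `x² ∂_n - 2 x_n x^k ∂_k + 2 x^k M_{kn}`. -/
def specialConf (n : ι) : A :=
  dotOp ε x x * d n - (2 : ℤ) • (x n * dotOp ε x d) + (2 : ℤ) • spinRot ε x M n

/-- `x_m ∂_n - x_n ∂_m + M_{mn}`. -/
def rotGen (m n : ι) : A := x m * d n - x n * d m + M m n

/-- The translations of the pseudosphere. -/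
def translGen {S : Type*} [CommRing S] [Algebra S A] (c : S) (n : ι) : A :=
  d n + c • specialConf ε x d M n

variable {ε x d M} [DecidableEq ι]

theorem ad_dotOp (a : A) (v : ι → A) : ad a (dotOp ε x v) =
    ∑ k, ε k • (ad a (x k) * v k) + dotOp ε x fun k => ad a (v k) := by
  simp only [dotOp, map_sum, map_zsmul, ad_mul, smul_add, Finset.sum_add_distrib]

theorem dotOp_zero : dotOp ε x (fun _ => (0 : A)) = 0 := by simp [dotOp]

theorem dotOp_add (v w : ι → A) : dotOp ε x (fun k => v k + w k) = dotOp ε x v + dotOp ε x w := by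
  simp only [dotOp, mul_add, smul_add, Finset.sum_add_distrib]

theorem dotOp_sub (v w : ι → A) : dotOp ε x (fun k => v k - w k) = dotOp ε x v - dotOp ε x w := by
  simp only [dotOp, mul_sub, smul_sub, Finset.sum_sub_distrib]

theorem dotOp_neg (v : ι → A) : dotOp ε x (fun k => -v k) = -dotOp ε x v := by
  simp only [dotOp, mul_neg, smul_neg, Finset.sum_neg_distrib]

theorem dotOp_zsmul (n : ℤ) (v : ι → A) : dotOp ε x (fun k => n • v k) = n • dotOp ε x v := by
  simp only [dotOp, mul_smul_comm, Finset.smul_sum, smul_comm n]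

theorem dotOp_mul (v : ι → A) (b : A) : dotOp ε x (fun k => v k * b) = dotOp ε x v * b := by
  simp only [dotOp, Finset.sum_mul, smul_mul_assoc, mul_assoc]

theorem dotOp_diagMetric (hε : ∀ a, ε a * ε a = 1) (n : ι) (b : A) :
    dotOp ε x (fun k => diagMetric ε n k • b) = x n * b := by
  simp only [dotOp, mul_smul_comm, sum_diagMetric hε n fun k => x k * b]

namespace IsWeylSpin

theorem mul_comm_x (h : IsWeylSpin ε x d M) (m n : ι) : x m * x n = x n * x m :=
  sub_eq_zero.mp (h.ad_x_x m n)

theorem dotOp_mul_left (h : IsWeylSpin ε x d M) (n : ι) (v : ι → A) :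
    dotOp ε x (fun k => x n * v k) = x n * dotOp ε x v := by
  simp only [dotOp, Finset.mul_sum, mul_smul_comm, ← mul_assoc, h.mul_comm_x n]

theorem ad_x_d (h : IsWeylSpin ε x d M) (m n : ι) :
    ad (x m) (d n) = -(diagMetric ε m n • 1) := by
  rw [ad_swap, h.ad_d_x, diagMetric_comm]

theorem ad_M_x (h : IsWeylSpin ε x d M) (k m n : ι) : ad (M m n) (x k) = 0 := by
  rw [ad_swap, h.ad_x_M, neg_zero]

theorem ad_M_d (h : IsWeylSpin ε x d M) (k m n : ι) : ad (M m n) (d k) = 0 := by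
  rw [ad_swap, h.ad_d_M, neg_zero]

theorem ad_x_sq (h : IsWeylSpin ε x d M) (m : ι) : ad (x m) (dotOp ε x x) = 0 := by
  simp [ad_dotOp, h.ad_x_x, dotOp_zero]

theorem mul_comm_sq (h : IsWeylSpin ε x d M) (m : ι) :
    x m * dotOp ε x x = dotOp ε x x * x m := sub_eq_zero.mp (h.ad_x_sq m)

theorem ad_x_euler (h : IsWeylSpin ε x d M) (m : ι) : ad (x m) (dotOp ε x d) = -x m := by
  simp only [ad_dotOp, h.ad_x_x, h.ad_x_d, dotOp_neg, dotOp_diagMetric h.sq_eq_one, zero_mul,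
    smul_zero, Finset.sum_const_zero, zero_add, mul_one]

theorem ad_x_spinRot (h : IsWeylSpin ε x d M) (m n : ι) : ad (x m) (spinRot ε x M n) = 0 := by
  simp [spinRot, ad_dotOp, h.ad_x_x, h.ad_x_M, dotOp_zero]

theorem ad_d_dotOp (h : IsWeylSpin ε x d M) (m : ι) (v : ι → A) :
    ad (d m) (dotOp ε x v) = v m + dotOp ε x fun k => ad (d m) (v k) := by
  rw [ad_dotOp]
  congr 1
  simp only [h.ad_d_x, smul_mul_assoc, one_mul, sum_diagMetric h.sq_eq_one]

theorem ad_d_sq (h : IsWeylSpin ε x d M) (m : ι) : ad (d m) (dotOp ε x x) = (2 : ℤ) • x m := by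
  rw [h.ad_d_dotOp]
  simp only [h.ad_d_x, dotOp_diagMetric h.sq_eq_one, mul_one]
  module

theorem ad_d_euler (h : IsWeylSpin ε x d M) (m : ι) : ad (d m) (dotOp ε x d) = d m := by
  rw [h.ad_d_dotOp]
  simp [h.ad_d_d, dotOp_zero]

theorem ad_d_spinRot (h : IsWeylSpin ε x d M) (m n : ι) :
    ad (d m) (spinRot ε x M n) = M m n := by
  rw [spinRot, h.ad_d_dotOp]
  simp [h.ad_d_M, dotOp_zero]

/-- The right side is twice a rotation minus a dilation term; the latter is symmetric in `m` and `n`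
and drops out of the bracket of two translations. -/
theorem ad_d_specialConf (h : IsWeylSpin ε x d M) (m n : ι) :
    ad (d m) (specialConf ε x d M n) = (2 : ℤ) • (x m * d n)
      - (2 : ℤ) • (diagMetric ε m n • dotOp ε x d) - (2 : ℤ) • (x n * d m) + (2 : ℤ) • M m n := by
  simp only [specialConf, map_add, map_sub, map_zsmul, ad_mul, h.ad_d_sq, h.ad_d_d, h.ad_d_x,
    h.ad_d_euler, h.ad_d_spinRot, mul_zero, add_zero, smul_mul_assoc, one_mul]
  module

theorem ad_x_specialConf (h : IsWeylSpin ε x d M) (m n : ι) :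
    ad (x m) (specialConf ε x d M n) =
      (2 : ℤ) • (x n * x m) - diagMetric ε m n • dotOp ε x x := by
  simp only [specialConf, map_add, map_sub, map_zsmul, ad_mul, h.ad_x_sq, h.ad_x_x, h.ad_x_d,
    h.ad_x_euler, h.ad_x_spinRot, zero_mul, zero_add, mul_neg, mul_smul_comm,
    mul_one]
  module

theorem ad_specialConf_x (h : IsWeylSpin ε x d M) (m n : ι) :
    ad (specialConf ε x d M m) (x n) =
      diagMetric ε m n • dotOp ε x x - (2 : ℤ) • (x m * x n) := by
  rw [ad_swap, h.ad_x_specialConf, diagMetric_comm]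
  module

theorem ad_specialConf_d (h : IsWeylSpin ε x d M) (m n : ι) :
    ad (specialConf ε x d M m) (d n) = (2 : ℤ) • (x m * d n)
      + (2 : ℤ) • (diagMetric ε m n • dotOp ε x d) - (2 : ℤ) • (x n * d m) + (2 : ℤ) • M m n := by
  rw [ad_swap, h.ad_d_specialConf, diagMetric_comm, h.antisymm n m]
  module

theorem ad_specialConf_sq (h : IsWeylSpin ε x d M) (m : ι) :
    ad (specialConf ε x d M m) (dotOp ε x x) = -((2 : ℤ) • (dotOp ε x x * x m)) := by
  rw [ad_dotOp]
  simp only [h.ad_specialConf_x, sub_mul, smul_mul_assoc, smul_sub, Finset.sum_sub_distrib,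
    dotOp_sub, sum_diagMetric h.sq_eq_one m fun k => dotOp ε x x * x k,
    dotOp_diagMetric h.sq_eq_one, dotOp_zsmul, h.dotOp_mul_left]
  have e : ∑ k, ε k • (2 : ℤ) • (x m * x k * x k) = (2 : ℤ) • (x m * dotOp ε x x) := by
    simp only [dotOp, Finset.mul_sum, Finset.smul_sum, mul_smul_comm, smul_comm (2 : ℤ), mul_assoc]
  rw [e, h.mul_comm_sq]
  module

theorem ad_euler_x (h : IsWeylSpin ε x d M) (m : ι) : ad (dotOp ε x d) (x m) = x m := by
  rw [ad_swap, h.ad_x_euler, neg_neg]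

theorem ad_euler_d (h : IsWeylSpin ε x d M) (m : ι) : ad (dotOp ε x d) (d m) = -d m := by
  rw [ad_swap, h.ad_d_euler]

theorem ad_M_euler (h : IsWeylSpin ε x d M) (m n : ι) : ad (M m n) (dotOp ε x d) = 0 := by
  simp [ad_dotOp, h.ad_M_x, h.ad_M_d, dotOp_zero]

theorem ad_euler_specialConf (h : IsWeylSpin ε x d M) (m : ι) :
    ad (dotOp ε x d) (specialConf ε x d M m) = specialConf ε x d M m := by
  have h1 : ad (dotOp ε x d) (dotOp ε x x) = (2 : ℤ) • dotOp ε x x := by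
    rw [ad_dotOp]
    simp only [h.ad_euler_x]
    rw [← dotOp, two_zsmul]
  have h2 : ad (dotOp ε x d) (spinRot ε x M m) = spinRot ε x M m := by
    rw [spinRot, ad_dotOp]
    simp only [h.ad_euler_x, ad_swap (dotOp ε x d) (M _ _), h.ad_M_euler, neg_zero, dotOp_zero,
      add_zero]
    rw [dotOp]
  have h3 : ad (dotOp ε x d) (dotOp ε x d) = 0 := sub_self _
  simp only [specialConf, map_add, map_sub, map_zsmul, ad_mul, h1, h2, h3, h.ad_euler_d,
    h.ad_euler_x, mul_zero, mul_neg, smul_mul_assoc]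
  module

theorem dotOp_antisymm (h : IsWeylSpin ε x d M) (n : ι) :
    dotOp ε x (fun k => M n k) = -spinRot ε x M n := by
  rw [spinRot, ← dotOp_neg]
  exact congrArg _ (funext fun k => h.antisymm n k)

/-- The symmetric `x^k x^l` is contracted with the antisymmetric `M`, so the result equals its own
negative; torsion-freeness makes it vanish. -/
theorem dotOp_spinRot [IsAddTorsionFree A] (h : IsWeylSpin ε x d M) : dotOp ε x (spinRot ε x M) = 0 := by
  have h1 : dotOp ε x (spinRot ε x M) = ∑ k, ∑ l, (ε k * ε l) • (x k * x l * M l k) := by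
    simp only [dotOp, spinRot, Finset.mul_sum, Finset.smul_sum, mul_smul_comm, smul_smul,
      mul_assoc]
  have h2 : dotOp ε x (spinRot ε x M) = -dotOp ε x (spinRot ε x M) := by
    conv_lhs => rw [h1, Finset.sum_comm]
    rw [h1]
    simp only [← Finset.sum_neg_distrib]
    refine Finset.sum_congr rfl fun k _ => Finset.sum_congr rfl fun l _ => ?_
    rw [h.antisymm k l, h.mul_comm_x l k, mul_comm (ε l), mul_neg, smul_neg]
  exact self_eq_neg.mp h2

theorem ad_M_spinRot (h : IsWeylSpin ε x d M) (k n m : ι) :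
    ad (M k n) (spinRot ε x M m) = -(diagMetric ε m k • spinRot ε x M n) - x n * M m k
      + diagMetric ε m n • spinRot ε x M k + x k * M m n := by
  rw [spinRot, ad_dotOp]
  simp only [h.ad_M_x, h.ad_M_M, zero_mul, smul_zero, Finset.sum_const_zero, zero_add, dotOp_sub,
    dotOp_add, dotOp_diagMetric h.sq_eq_one, dotOp_zsmul, h.dotOp_antisymm]
  rw [h.antisymm k m, h.antisymm n m, diagMetric_comm k m, diagMetric_comm n m]
  simp only [mul_neg]
  module

theorem ad_specialConf_M (h : IsWeylSpin ε x d M) (m k n : ι) :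
    ad (specialConf ε x d M m) (M k n) = (2 : ℤ) • (diagMetric ε m k • spinRot ε x M n
      + x n * M m k - diagMetric ε m n • spinRot ε x M k - x k * M m n) := by
  have h1 : ad (M k n) (dotOp ε x x) = 0 := by
    simp [ad_dotOp, h.ad_M_x, dotOp_zero]
  rw [ad_swap]
  simp only [specialConf, map_add, map_sub, map_zsmul, ad_mul, h1, h.ad_M_d, h.ad_M_x,
    h.ad_M_euler, h.ad_M_spinRot, mul_zero, zero_mul]
  module

theorem ad_specialConf_spinRot [IsAddTorsionFree A] (h : IsWeylSpin ε x d M) (m n : ι) :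
    ad (specialConf ε x d M m) (spinRot ε x M n) =
      -(dotOp ε x x * M m n) - (2 : ℤ) • (x n * spinRot ε x M m) := by
  have h1 : ∑ k, ε k • (ad (specialConf ε x d M m) (x k) * M k n) =
      dotOp ε x x * M m n - (2 : ℤ) • (x m * spinRot ε x M n) := by
    simp only [h.ad_specialConf_x, sub_mul, smul_mul_assoc, smul_sub, Finset.sum_sub_distrib,
      sum_diagMetric h.sq_eq_one m fun k => dotOp ε x x * M k n]
    simp only [spinRot, dotOp, Finset.mul_sum, Finset.smul_sum, mul_smul_comm, smul_comm (2 : ℤ),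
      mul_assoc]
  rw [spinRot, ad_dotOp, h1]
  simp only [h.ad_specialConf_M, dotOp_zsmul, dotOp_add, dotOp_sub, h.dotOp_mul_left, dotOp_mul,
    h.dotOp_antisymm, dotOp_diagMetric h.sq_eq_one, h.dotOp_spinRot, mul_neg, smul_zero]
  module

/-- Thanks to this, only the mixed terms survive in the bracket of two pseudosphere translations. -/
theorem ad_specialConf_specialConf [IsAddTorsionFree A] (h : IsWeylSpin ε x d M)
    (m n : ι) : ad (specialConf ε x d M m) (specialConf ε x d M n) = 0 := by
  have h1 : ad (specialConf ε x d M m) (dotOp ε x d) = -specialConf ε x d M m := by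
    rw [ad_swap, h.ad_euler_specialConf]
  have e1 : ∀ k b, x k * (dotOp ε x x * b) = dotOp ε x x * (x k * b) := fun k b => by
    rw [← mul_assoc, h.mul_comm_sq, mul_assoc]
  have e2 : specialConf ε x d M n = dotOp ε x x * d n - (2 : ℤ) • (x n * dotOp ε x d)
    + (2 : ℤ) • spinRot ε x M n := rfl
  rw [e2]
  simp only [map_add, map_sub, map_zsmul, ad_mul, h1, h.ad_specialConf_sq, h.ad_specialConf_d,
    h.ad_specialConf_x, h.ad_specialConf_spinRot]
  simp only [specialConf, mul_add, mul_sub, sub_mul, neg_mul, mul_neg, smul_mul_assoc,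
    mul_smul_comm, mul_assoc, e1]
  rw [← mul_assoc (x n) (x m), h.mul_comm_x n m, mul_assoc (x m) (x n)]
  module

end IsWeylSpin

end Weyl

theorem smul_ad {A S : Type*} [Ring A] [CommRing S] [Algebra S A] (r : S) (a b : A) :
    ad (r • a) b = r • ad a b := by
  simp [ad_apply, smul_sub]

theorem neg_ad {A : Type*} [Ring A] (a b : A) : ad (-a) b = -ad a b := by
  simp [ad_apply]; abel

theorem zero_ad {A : Type*} [Ring A] (b : A) : ad 0 b = 0 := by
  simp [ad_apply]

section Weyl

variable {ι A S : Type*} [Fintype ι] [DecidableEq ι] [Ring A] [CommRing S] [Algebra S A] {ε : ι → ℤ}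
  {x d : ι → A} {M : ι → ι → A}

namespace IsWeylSpin

theorem rotGen_antisymm (h : IsWeylSpin ε x d M) (m n : ι) :
    rotGen x d M m n = -rotGen x d M n m := by
  rw [rotGen, rotGen, h.antisymm m n]
  abel

theorem ad_rotGen_x (h : IsWeylSpin ε x d M) (m n k : ι) : ad (rotGen x d M m n) (x k) =
    diagMetric ε n k • x m - diagMetric ε m k • x n := by
  rw [ad_swap]
  simp only [rotGen, map_add, map_sub, ad_mul, h.ad_x_x, h.ad_x_M, h.ad_x_d, zero_mul, mul_neg,
    mul_smul_comm, mul_one, diagMetric_comm k]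
  module

theorem ad_rotGen_d (h : IsWeylSpin ε x d M) (m n k : ι) : ad (rotGen x d M m n) (d k) =
    diagMetric ε n k • d m - diagMetric ε m k • d n := by
  rw [ad_swap]
  simp only [rotGen, map_add, map_sub, ad_mul, h.ad_d_d, h.ad_d_M, h.ad_d_x, mul_zero,
    smul_mul_assoc, one_mul, diagMetric_comm k]
  module

theorem ad_rotGen_M (h : IsWeylSpin ε x d M) (m n k l : ι) : ad (rotGen x d M m n) (M k l) =
    diagMetric ε n k • M m l + diagMetric ε m l • M n k - diagMetric ε n l • M m k
      - diagMetric ε m k • M n l := by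
  have h1 : ∀ i j, ad (M k l) (x i * d j) = 0 := fun i j => by
    rw [ad_mul, h.ad_M_x, h.ad_M_d, zero_mul, mul_zero, add_zero]
  have h2 := h.ad_M_M m n k l
  rw [ad_swap] at h2 ⊢
  simp only [rotGen, map_add, map_sub, h1, sub_self, zero_add]
  exact h2

theorem ad_rotGen_rotGen (h : IsWeylSpin ε x d M) (m n k l : ι) :
    ad (rotGen x d M m n) (rotGen x d M k l) = diagMetric ε n k • rotGen x d M m l
      + diagMetric ε m l • rotGen x d M n k - diagMetric ε n l • rotGen x d M m k
      - diagMetric ε m k • rotGen x d M n l := by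
  rw [rotGen.eq_def x d M k l]
  simp only [map_add, map_sub, ad_mul, h.ad_rotGen_x, h.ad_rotGen_d, h.ad_rotGen_M]
  simp only [rotGen, sub_mul, mul_sub, smul_mul_assoc, mul_smul_comm]
  module

theorem ad_rotGen_dotOp (h : IsWeylSpin ε x d M) (m n : ι) (v : ι → A) :
    ad (rotGen x d M m n) (dotOp ε x v) =
      x m * v n - x n * v m + dotOp ε x fun k => ad (rotGen x d M m n) (v k) := by
  rw [ad_dotOp]
  congr 1
  simp only [h.ad_rotGen_x, sub_mul, smul_mul_assoc, smul_sub, Finset.sum_sub_distrib,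
    sum_diagMetric h.sq_eq_one _ fun k => _ * v k]

theorem ad_rotGen_specialConf (h : IsWeylSpin ε x d M) (m n k : ι) :
    ad (rotGen x d M m n) (specialConf ε x d M k) =
      diagMetric ε n k • specialConf ε x d M m - diagMetric ε m k • specialConf ε x d M n := by
  have h1 : ad (rotGen x d M m n) (dotOp ε x x) = 0 := by
    rw [h.ad_rotGen_dotOp]
    simp only [h.ad_rotGen_x, dotOp_sub, dotOp_diagMetric h.sq_eq_one]
    rw [h.mul_comm_x m n]
    abel
  have h2 : ad (rotGen x d M m n) (dotOp ε x d) = 0 := by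
    rw [h.ad_rotGen_dotOp]
    simp only [h.ad_rotGen_d, dotOp_sub, dotOp_diagMetric h.sq_eq_one]
    abel
  have h3 : ad (rotGen x d M m n) (spinRot ε x M k) =
      diagMetric ε n k • spinRot ε x M m - diagMetric ε m k • spinRot ε x M n := by
    rw [spinRot, h.ad_rotGen_dotOp]
    simp only [h.ad_rotGen_M, dotOp_sub, dotOp_add, dotOp_diagMetric h.sq_eq_one, dotOp_zsmul,
      h.dotOp_antisymm]
    module
  rw [specialConf.eq_def ε x d M k]
  simp only [map_add, map_sub, map_zsmul, ad_mul, h1, h2, h3, h.ad_rotGen_x, h.ad_rotGen_d]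
  simp only [specialConf, sub_mul, mul_sub, smul_mul_assoc, mul_smul_comm, zero_mul, mul_zero]
  module

theorem ad_rotGen_translGen (h : IsWeylSpin ε x d M) (c : S) (m n k : ι) :
    ad (rotGen x d M m n) (translGen ε x d M c k) =
      diagMetric ε n k • translGen ε x d M c m - diagMetric ε m k • translGen ε x d M c n := by
  simp only [translGen, map_add, ad_smul, h.ad_rotGen_d, h.ad_rotGen_specialConf]
  module

/-- Each of the two mixed brackets contributes `2 c` times the rotation, and their dilation parts
cancel. -/
theorem ad_translGen_translGen [IsAddTorsionFree A] (h : IsWeylSpin ε x d M) (c : S) (m n : ι) :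
    ad (translGen ε x d M c m) (translGen ε x d M c n) = (4 * c) • rotGen x d M m n := by
  have e1 : ad (translGen ε x d M c m) (d n) = c • ad (specialConf ε x d M m) (d n) := by
    rw [ad_swap, translGen, map_add, ad_smul, h.ad_d_d, zero_add, ad_swap (d n), smul_neg, neg_neg]
  have e2 : ad (translGen ε x d M c m) (specialConf ε x d M n) =
      ad (d m) (specialConf ε x d M n) := by
    rw [ad_swap, translGen, map_add, ad_smul, h.ad_specialConf_specialConf, smul_zero, add_zero,
      ← ad_swap]
  rw [translGen.eq_def ε x d M c n, map_add, ad_smul, e1, e2, h.ad_specialConf_d,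
    h.ad_d_specialConf, rotGen]
  module

end IsWeylSpin

variable {N : ℕ}

theorem kd_self {κ : Type*} [DecidableEq κ] (a : κ) : kd a a = 1 := if_pos rfl

/-- The generators of the isometries of the pseudosphere of radius `r`, with `c = 1 / (4 r²)`. -/
def ambGen (ε : Fin N → ℤ) (x d : Fin N → A) (M : Fin N → Fin N → A) (r c : S) :
    Fin (N + 1) → Fin (N + 1) → A :=
  Fin.lastCases (Fin.lastCases 0 fun n => -(r • translGen ε x d M c n))
    (fun m => Fin.lastCases (r • translGen ε x d M c m) fun n => rotGen x d M m n)

theorem ambGen_castSucc (ε : Fin N → ℤ) (x d : Fin N → A) (M : Fin N → Fin N → A) (r c : S)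
    (m n : Fin N) : ambGen ε x d M r c m.castSucc n.castSucc = rotGen x d M m n := by
  simp [ambGen]

theorem ambGen_castSucc_last (ε : Fin N → ℤ) (x d : Fin N → A) (M : Fin N → Fin N → A) (r c : S)
    (m : Fin N) : ambGen ε x d M r c m.castSucc (Fin.last N) = r • translGen ε x d M c m := by
  simp [ambGen]

theorem ambGen_last_castSucc (ε : Fin N → ℤ) (x d : Fin N → A) (M : Fin N → Fin N → A) (r c : S)
    (m : Fin N) : ambGen ε x d M r c (Fin.last N) m.castSucc = -(r • translGen ε x d M c m) := by
  simp [ambGen]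

theorem ambGen_last (ε : Fin N → ℤ) (x d : Fin N → A) (M : Fin N → Fin N → A) (r c : S) :
    ambGen ε x d M r c (Fin.last N) (Fin.last N) = 0 := by
  simp [ambGen]

/-- The metric of the ambient space. -/
def ambSign (ε : Fin N → ℤ) : Fin (N + 1) → ℤ := Fin.lastCases (-1) ε

/-- The condition `4 c r² = 1` normalises the bracket of two rescaled translations to the rotation
itself, with the sign prescribed by the entry `-1` of the last direction. -/
theorem IsWeylSpin.isMetricSO_ambGen [IsAddTorsionFree A] {ε : Fin N → ℤ} {x d : Fin N → A}
    {M : Fin N → Fin N → A} (h : IsWeylSpin ε x d M) {r c : S} (hr : 4 * c * r ^ 2 = 1) :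
    IsMetricSO (ambSign ε) (ambGen ε x d M r c) where
  antisymm a b := by
    refine Fin.lastCases ?_ (fun a => ?_) a <;> refine Fin.lastCases ?_ (fun b => ?_) b
    · simp [ambGen_last]
    · simp [ambGen_last_castSucc, ambGen_castSucc_last]
    · simp [ambGen_last_castSucc, ambGen_castSucc_last]
    · rw [ambGen_castSucc, ambGen_castSucc, h.rotGen_antisymm]
  bracket a b c' d' := by
    have hJJ := h.ad_rotGen_rotGen
    have hJP := h.ad_rotGen_translGen c
    have hPJ : ∀ k m n, ad (translGen ε x d M c k) (rotGen x d M m n) =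
        -(diagMetric ε k n • translGen ε x d M c m - diagMetric ε k m • translGen ε x d M c n) :=
      fun k m n => by rw [ad_swap, hJP, diagMetric_comm n, diagMetric_comm m]
    have hPP : ∀ m n, (r * r) • ad (translGen ε x d M c m) (translGen ε x d M c n) =
        rotGen x d M m n := fun m n => by
      rw [h.ad_translGen_translGen, smul_smul]
      have : r * r * (4 * c) = 1 := by rw [← hr]; ring
      rw [this, one_smul]
    change ad _ _ = _
    have g : ∀ m n, ε m * kd m n = diagMetric ε m n := fun _ _ => rfl
    refine Fin.lastCases ?_ (fun a => ?_) a <;> refine Fin.lastCases ?_ (fun b => ?_) b <;>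
    refine Fin.lastCases ?_ (fun c' => ?_) c' <;> refine Fin.lastCases ?_ (fun d' => ?_) d' <;>
    simp only [ambGen_castSucc, ambGen_castSucc_last, ambGen_last_castSucc, ambGen_last, ambSign,
      Fin.lastCases_last, Fin.lastCases_castSucc, kd_castSucc, kd_castSucc_last, kd_last_castSucc,
      g, map_zero, map_neg, ad_smul, mul_zero, zero_smul, hJJ, hJP, hPJ, smul_ad, neg_ad, zero_ad,
      kd_self, mul_one, smul_neg, smul_smul, hPP, smul_zero]
    all_goals module

end Weyl

/-! ### Contraction with a constant vector and evaluation at a point -/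

section Con

variable {ι S V W : Type*} [Fintype ι] [CommRing S] [AddCommGroup V] [Module S V]
  [AddCommGroup W] [Module S W] (ε : ι → ℤ) (a : ι → S)

/-- The contraction `a^i v_i` with a constant vector. -/
def con (v : ι → V) : V := ∑ i, ((ε i : S) * a i) • v i

theorem con_add (v w : ι → V) : con ε a (fun i => v i + w i) = con ε a v + con ε a w := by
  simp only [con, smul_add, Finset.sum_add_distrib]

theorem con_sub (v w : ι → V) : con ε a (fun i => v i - w i) = con ε a v - con ε a w := by
  simp only [con, smul_sub, Finset.sum_sub_distrib]

theorem con_neg (v : ι → V) : con ε a (fun i => -v i) = -con ε a v := by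
  simp only [con, smul_neg, Finset.sum_neg_distrib]

theorem con_smul (r : S) (v : ι → V) : con ε a (fun i => r • v i) = r • con ε a v := by
  simp only [con, smul_comm r, Finset.smul_sum]

theorem con_zsmul (n : ℤ) (v : ι → V) : con ε a (fun i => n • v i) = n • con ε a v := by
  simp only [con, smul_comm n, Finset.smul_sum]

theorem con_smul_const (f : ι → S) (w : V) : con ε a (fun i => f i • w) = con ε a f • w := by
  simp only [con, smul_smul, Finset.sum_smul, smul_eq_mul]

theorem map_con (f : V →ₗ[S] W) (v : ι → V) : f (con ε a v) = con ε a fun i => f (v i) := by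
  simp only [con, map_sum, map_smul]

theorem con_comm (v : ι → ι → V) :
    con ε a (fun i => con ε a fun j => v i j) = con ε a fun j => con ε a fun i => v i j := by
  simp only [con, Finset.smul_sum]
  rw [Finset.sum_comm]
  exact Finset.sum_congr rfl fun j _ => Finset.sum_congr rfl fun i _ => smul_comm _ _ _

theorem con_con_eq_zero [IsAddTorsionFree V] {v : ι → ι → V} (hv : ∀ i j, v i j = -v j i) :
    con ε a (fun i => con ε a fun j => v i j) = 0 := by
  refine self_eq_neg.mp ?_
  conv_lhs => rw [con_comm]
  rw [← con_neg]
  refine congrArg _ (funext fun j => ?_)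
  rw [← con_neg]
  exact congrArg _ (funext fun i => hv i j)

theorem con_diagMetric [DecidableEq ι] {ε : ι → ℤ} (hε : ∀ a, ε a * ε a = 1) (n : ι) (w : V) :
    con ε a (fun i => diagMetric ε n i • w) = a n • w := by
  rw [con, Finset.sum_eq_single n]
  · rw [diagMetric, kd_self, mul_one, ← Int.cast_smul_eq_zsmul S, smul_smul, mul_right_comm,
      ← Int.cast_mul, hε, Int.cast_one, one_mul]
  · intro b _ hb
    simp [diagMetric, kd, hb.symm]
  · simp

end Con

/-- A linear map which evaluates the coordinates standing on the left at the point `a`. -/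
structure IsEvalAt {ι A S Q : Type*} [Ring A] [CommRing S] [Algebra S A] [AddCommGroup Q]
    [Module S Q] (x : ι → A) (a : ι → S) (π : A →ₗ[S] Q) : Prop where
  map_x_mul : ∀ k z, π (x k * z) = a k • π z
  mul_right : ∀ z w v, π z = π w → π (z * v) = π (w * v)
  mul_left : ∀ b z w, (∀ k, Commute (x k) b) → π z = π w → π (b * z) = π (b * w)

section Eval

variable {ι A S Q : Type*} [Fintype ι] [DecidableEq ι] [Ring A] [CommRing S] [Algebra S A]
  [AddCommGroup Q] [Module S Q] {ε : ι → ℤ} {x d : ι → A} {M : ι → ι → A} {a : ι → S}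
  {π : A →ₗ[S] Q}

theorem IsEvalAt.map_dotOp (hπ : IsEvalAt x a π) (v : ι → A) :
    π (dotOp ε x v) = con ε a fun i => π (v i) := by
  simp only [dotOp, con, map_sum, map_smul, hπ.map_x_mul, ← Int.cast_smul_eq_zsmul S, smul_smul]

theorem IsEvalAt.map_dotOp_mul (hπ : IsEvalAt x a π) (v : ι → A) (b : A) :
    π (dotOp ε x v * b) = con ε a fun i => π (v i * b) := by
  rw [← dotOp_mul, hπ.map_dotOp]

theorem IsEvalAt.map_sq_mul (hπ : IsEvalAt x a π) (b : A) :
    π (dotOp ε x x * b) = con ε a a • π b := by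
  rw [hπ.map_dotOp_mul]
  simp only [hπ.map_x_mul, con_smul_const]

theorem IsEvalAt.map_rotGen (hπ : IsEvalAt x a π) (m n : ι) :
    π (rotGen x d M m n) = a m • π (d n) - a n • π (d m) + π (M m n) := by
  simp only [rotGen, map_add, map_sub, hπ.map_x_mul]

theorem IsEvalAt.map_translGen (hπ : IsEvalAt x a π) (c : S) (n : ι) :
    π (translGen ε x d M c n) = π (d n) + c • (con ε a a • π (d n)
      - (2 : ℤ) • (a n • con ε a fun k => π (d k)) + (2 : ℤ) • con ε a fun k => π (M k n)) := by
  simp only [translGen, specialConf, spinRot, map_add, map_sub, map_smul, map_zsmul, hπ.map_sq_mul,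
    hπ.map_x_mul, hπ.map_dotOp]

end Eval

/-! ### The frame matrix at a point -/

section Frame

variable {N : ℕ} {A S Q : Type*} [Ring A] [CommRing S] [Algebra S A]
  [AddCommGroup Q] [Module S Q] {ε : Fin N → ℤ} {x d : Fin N → A} {M : Fin N → Fin N → A}
  {a : Fin N → S} {π : A →ₗ[S] Q} {r c γ : S}

/-- The pseudo-orthogonal matrix whose columns are the frame at the point with coordinates `a`
and the radius vector; `γ` is the inverse of `1 - c a²` and `4 c r² = 1`. -/
def frameMatrix (ε : Fin N → ℤ) (a : Fin N → S) (r c γ : S) : Fin (N + 1) → Fin (N + 1) → S :=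
  Fin.lastCases (Fin.lastCases (2 * γ - 1) fun n => 4 * c * r * γ * a n)
    (fun m => Fin.lastCases (4 * c * r * γ * ((ε m : S) * a m)) fun n =>
      (if m = n then 1 else 0) + 2 * c * γ * a n * ((ε m : S) * a m))

theorem sum_frameMatrix {V : Type*} [AddCommGroup V] [Module S V] (n : Fin N) (v : Fin (N + 1) → V) :
    ∑ i, frameMatrix ε a r c γ i n.castSucc • v i = v n.castSucc
      + (2 * c * γ * a n) • (con ε a fun i => v i.castSucc)
      + (4 * c * r * γ * a n) • v (Fin.last N) := by
  rw [Fin.sum_univ_castSucc]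
  simp [frameMatrix, add_smul, Finset.sum_add_distrib, con, Finset.smul_sum, smul_smul]

theorem sum_frameMatrix_last {V : Type*} [AddCommGroup V] [Module S V] (v : Fin (N + 1) → V) :
    ∑ i, frameMatrix ε a r c γ i (Fin.last N) • v i =
      (4 * c * r * γ) • (con ε a fun i => v i.castSucc) + (2 * γ - 1) • v (Fin.last N) := by
  rw [Fin.sum_univ_castSucc]
  simp [frameMatrix, con, Finset.smul_sum, smul_smul]

theorem rotate_eq (Λ : Fin (N + 1) → Fin (N + 1) → S) (J : Fin (N + 1) → Fin (N + 1) → A)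
    (i j : Fin (N + 1)) : rotate Λ J i j = ∑ k, Λ k i • ∑ l, Λ l j • J k l := by
  simp only [rotate, Finset.smul_sum, smul_smul]

/-- For the stereographic embedding `X` the columns are the frame derivatives `e_n X` and `X / r`.
The relations say that the frame is orthonormal, that it is orthogonal to the radius vector, and
that the latter has square `-r²`. -/
theorem frameMatrix_orthogonal (hε : ∀ a, ε a * ε a = 1) (hr : 4 * c * r ^ 2 = 1)
    (hγ : γ * (1 - c * con ε a a) = 1) (i j : Fin (N + 1)) :
    ∑ k, (ambSign ε k : S) * frameMatrix ε a r c γ k i * frameMatrix ε a r c γ k j =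
      ambSign ε i * kd i j := by
  have hε' : ∀ k, (ε k : S) * ε k = 1 := fun k => by rw [← Int.cast_mul, hε, Int.cast_one]
  have h1 : ∀ i j, ∑ k, (ambSign ε k : S) * frameMatrix ε a r c γ k i * frameMatrix ε a r c γ k j =
      ∑ k, frameMatrix ε a r c γ k i • ((ambSign ε k : S) * frameMatrix ε a r c γ k j) :=
    fun i j => Finset.sum_congr rfl fun k _ => by rw [smul_eq_mul]; ring
  have f1 : ∀ i j : Fin N, (ambSign ε i.castSucc : S) * frameMatrix ε a r c γ i.castSucc j.castSucc =
      diagMetric ε j i • (1 : S) + a i * (2 * c * γ * a j) := fun i j => by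
    rw [diagMetric_comm j i, diagMetric, kd]
    simp only [frameMatrix, ambSign, Fin.lastCases_castSucc]
    split_ifs with h
    · simp only [zsmul_eq_mul]
      push_cast
      linear_combination (2 * c * γ * a j * a i) * hε' i
    · simp only [zsmul_eq_mul]
      push_cast
      linear_combination (2 * c * γ * a j * a i) * hε' i
  have f2 : ∀ i : Fin N, (ambSign ε i.castSucc : S) * frameMatrix ε a r c γ i.castSucc (Fin.last N) =
      a i * (4 * c * r * γ) := fun i => by
    simp only [frameMatrix, ambSign, Fin.lastCases_castSucc, Fin.lastCases_last]
    linear_combination (4 * c * r * γ * a i) * hε' i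
  have f3 : ∀ j : Fin N, (ambSign ε (Fin.last N) : S) * frameMatrix ε a r c γ (Fin.last N) j.castSucc =
      -(4 * c * r * γ * a j) := fun j => by
    simp [frameMatrix, ambSign]
  have f4 : (ambSign ε (Fin.last N) : S) * frameMatrix ε a r c γ (Fin.last N) (Fin.last N) =
      -(2 * γ - 1) := by
    simp [frameMatrix, ambSign]
  have c1 : ∀ t : S, con ε a (fun i => a i * t) = con ε a a * t := fun t =>
    con_smul_const ε a a t
  rw [h1]
  refine Fin.lastCases ?_ (fun i => ?_) i <;> refine Fin.lastCases ?_ (fun j => ?_) j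
  · rw [sum_frameMatrix_last]
    simp only [f2, f4, c1, kd_self, smul_eq_mul]
    simp only [ambSign, Fin.lastCases_last]
    push_cast
    linear_combination (4 * c * γ ^ 2 * con ε a a) * hr - 4 * γ * hγ
  · rw [sum_frameMatrix_last]
    simp only [f1, f3, c1, con_add, con_diagMetric a hε, kd_last_castSucc,
      smul_eq_mul]
    push_cast
    linear_combination (-8 * c * r * γ * a j) * hγ
  · rw [sum_frameMatrix]
    simp only [f2, f4, c1, kd_castSucc_last, smul_eq_mul]
    push_cast
    linear_combination (-8 * c * r * γ * a i) * hγ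
  · rw [sum_frameMatrix]
    simp only [f1, f3, c1, con_add, con_diagMetric a hε, kd_castSucc,
      smul_eq_mul]
    rw [ambSign, Fin.lastCases_castSucc, diagMetric_comm j i, diagMetric, zsmul_eq_mul]
    push_cast
    linear_combination (-4 * c * γ ^ 2 * a i * a j) * hr - (4 * c * γ * a i * a j) * hγ

end Frame

/-- A one-sided inverse of a square matrix over a commutative ring is two-sided. Stability of the
brackets uses the relations of the columns, invariance of the Casimir sum those of the rows. -/
theorem orthogonal_transpose {κ S : Type*} [Fintype κ] [DecidableEq κ] [CommRing S] {ε : κ → ℤ}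
    (hε : ∀ a, ε a * ε a = 1) {Λ : κ → κ → S}
    (h : ∀ a b, ∑ c, (ε c : S) * Λ c a * Λ c b = ε a * kd a b) (c d : κ) :
    ∑ a, (ε a : S) * Λ c a * Λ d a = ε c * kd c d := by
  have hε' : ∀ k, (ε k : S) * ε k = 1 := fun k => by rw [← Int.cast_mul, hε, Int.cast_one]
  have h1 : (Matrix.of fun a c => (ε a : S) * (ε c : S) * Λ c a) * Matrix.of Λ = 1 := by
    ext a b
    rw [Matrix.mul_apply, Matrix.one_apply]
    have : ∑ c, (Matrix.of fun a c => (ε a : S) * (ε c : S) * Λ c a) a c * Matrix.of Λ c b =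
        (ε a : S) * ∑ c, (ε c : S) * Λ c a * Λ c b := by
      rw [Finset.mul_sum]
      refine Finset.sum_congr rfl fun c _ => ?_
      simp only [Matrix.of_apply]
      ring
    rw [this, h, ← mul_assoc, hε', kd]
    split_ifs <;> simp
  have h0 : Matrix.of Λ * (Matrix.of fun a c => (ε a : S) * (ε c : S) * Λ c a) = 1 :=
    mul_eq_one_comm.mp h1
  have h2 := congrFun (congrFun h0 c) d
  rw [Matrix.mul_apply, Matrix.one_apply] at h2
  have h3 : ∑ a, (ε a : S) * Λ c a * Λ d a = (ε d : S) *
      ∑ a, Matrix.of Λ c a * (Matrix.of fun a c => (ε a : S) * (ε c : S) * Λ c a) a d := by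
    rw [Finset.mul_sum]
    refine Finset.sum_congr rfl fun a _ => ?_
    simp only [Matrix.of_apply]
    linear_combination (-(ε a : S) * Λ c a * Λ d a) * hε' d
  rw [h3, h2, kd]
  split_ifs with hcd
  · simp [hcd]
  · simp

/-! ### Rotated generators as covariant derivatives at the point -/

section Frame

variable {N : ℕ} {A S Q : Type*} [Ring A] [CommRing S] [Algebra S A]
  [AddCommGroup Q] [Module S Q] {ε : Fin N → ℤ} {x d : Fin N → A} {M : Fin N → Fin N → A}
  {a : Fin N → S} {π : A →ₗ[S] Q} {r c γ : S}

/-- The generators in the frame at the point with coordinates `a`. -/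
def frameGen (ε : Fin N → ℤ) (x d : Fin N → A) (M : Fin N → Fin N → A) (a : Fin N → S) (r c γ : S) :
    Fin (N + 1) → Fin (N + 1) → A :=
  rotate (frameMatrix ε a r c γ) (ambGen ε x d M r c)

theorem frameGen_castSucc (h : IsWeylSpin ε x d M) (hr : 4 * c * r ^ 2 = 1) [IsAddTorsionFree A]
    (m n : Fin N) : frameGen ε x d M a r c γ m.castSucc n.castSucc = rotGen x d M m n
      + (2 * c * γ) • (a m • con ε a (fun l => rotGen x d M l n)
        - a n • con ε a fun l => rotGen x d M l m)
      + γ • (a n • translGen ε x d M c m - a m • translGen ε x d M c n) := by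
  have h1 : ∀ i, con ε a (fun l => rotGen x d M i l) = -con ε a fun l => rotGen x d M l i :=
    fun i => by
      rw [← con_neg]
      exact congrArg _ (funext fun l => h.rotGen_antisymm i l)
  have h2 : con ε a (fun i => con ε a fun l => rotGen x d M l i) = 0 :=
    con_con_eq_zero ε a fun i j => h.rotGen_antisymm j i
  rw [frameGen, rotate_eq, sum_frameMatrix]
  simp only [sum_frameMatrix, ambGen_castSucc, ambGen_castSucc_last, ambGen_last_castSucc,
    ambGen_last, con_add, con_smul, con_neg, h1, h2, smul_zero, add_zero]
  linear_combination (norm := module) hr • ((γ * a n) • translGen ε x d M c m)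
    - hr • ((γ * a m) • translGen ε x d M c n)

theorem frameGen_castSucc_last (h : IsWeylSpin ε x d M) (hr : 4 * c * r ^ 2 = 1)
    [IsAddTorsionFree A] (n : Fin N) : frameGen ε x d M a r c γ n.castSucc (Fin.last N) =
      r • ((2 * γ - 1) • translGen ε x d M c n
        - (4 * c * γ) • con ε a (fun l => rotGen x d M l n)
        - (2 * c * γ * a n) • con ε a fun l => translGen ε x d M c l) := by
  have h1 : ∀ i, con ε a (fun l => rotGen x d M i l) = -con ε a fun l => rotGen x d M l i :=
    fun i => by
      rw [← con_neg]
      exact congrArg _ (funext fun l => h.rotGen_antisymm i l)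
  have h2 : con ε a (fun i => con ε a fun l => rotGen x d M l i) = 0 :=
    con_con_eq_zero ε a fun i j => h.rotGen_antisymm j i
  rw [frameGen, rotate_eq, sum_frameMatrix]
  simp only [sum_frameMatrix_last, ambGen_castSucc, ambGen_castSucc_last, ambGen_last_castSucc,
    ambGen_last, con_add, con_smul, con_neg, h1, h2, smul_zero, add_zero, neg_zero]
  linear_combination (norm := module)
    -(hr • ((4 * c * γ ^ 2 * r * a n) • con ε a fun l => translGen ε x d M c l))

/-- The rotated `J_{mn}` generates rotations that fix the point, so its derivative part vanishes
there and the spin part is left. -/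
theorem IsEvalAt.map_frameGen_castSucc [IsAddTorsionFree A] (hπ : IsEvalAt x a π)
    (h : IsWeylSpin ε x d M) (hr : 4 * c * r ^ 2 = 1) (hγ : γ * (1 - c * con ε a a) = 1)
    (m n : Fin N) : π (frameGen ε x d M a r c γ m.castSucc n.castSucc) = π (M m n) := by
  rw [frameGen_castSucc h hr]
  simp only [map_add, map_sub, map_smul, map_con, hπ.map_rotGen, hπ.map_translGen, con_add,
    con_sub, con_smul, con_smul_const]
  linear_combination (norm := module) -(hγ • (a m • π (d n))) + hγ • (a n • π (d m))

/-- The covariant derivative with the coordinates replaced by their values at a point. -/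
def frozenD (ε : Fin N → ℤ) (d : Fin N → A) (M : Fin N → Fin N → A) (a : Fin N → S) (c : S)
    (n : Fin N) : A :=
  (1 - c * con ε a a) • d n - (2 * c) • con ε a fun k => M k n

theorem IsEvalAt.map_frameGen_castSucc_last [IsAddTorsionFree A] [IsAddTorsionFree Q]
    (hπ : IsEvalAt x a π)
    (h : IsWeylSpin ε x d M) (hr : 4 * c * r ^ 2 = 1) (hγ : γ * (1 - c * con ε a a) = 1)
    (n : Fin N) : π (frameGen ε x d M a r c γ n.castSucc (Fin.last N)) =
      π (r • frozenD ε d M a c n) := by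
  have h0 : con ε a (fun i => con ε a fun k => π (M k i)) = 0 :=
    con_con_eq_zero ε a fun i j => by rw [h.antisymm, map_neg]
  rw [frameGen_castSucc_last h hr, frozenD]
  simp only [map_sub, map_smul, map_con, hπ.map_rotGen, hπ.map_translGen, con_add,
    con_sub, con_smul, con_zsmul, con_smul_const, h0]
  linear_combination (norm := module) hγ • ((2 * r) • π (d n))
    - hγ • ((2 * c * r * a n) • con ε a fun k => π (d k))

theorem IsWeylSpin.commute_con (h : IsWeylSpin ε x d M) (k n : Fin N) :
    Commute (x k) (con ε a fun l => M l n) := by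
  refine Commute.sum_right _ _ _ fun l _ => Commute.smul_right ?_ _
  exact sub_eq_zero.mp (h.ad_x_M k l n)

theorem IsWeylSpin.ad_d_con (h : IsWeylSpin ε x d M) (m n : Fin N) :
    ad (d m) (con ε a fun l => M l n) = 0 := by
  simp only [con, map_sum, ad_smul, h.ad_d_M, smul_zero, Finset.sum_const_zero]

theorem IsWeylSpin.ad_d_frozenD (h : IsWeylSpin ε x d M) (m n : Fin N) :
    ad (d m) (frozenD ε d M a c n) = 0 := by
  simp only [frozenD, map_sub, ad_smul, h.ad_d_con, h.ad_d_d, smul_zero, sub_zero]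

/-- Left multiplication by the frozen covariant derivative. -/
theorem IsEvalAt.map_frozenD_mul (hπ : IsEvalAt x a π) (h : IsWeylSpin ε x d M) {y w : A}
    (hyw : π y = π w) (hw : ∀ m, ad (d m) w = 0) (n : Fin N) :
    π (frozenD ε d M a c n * y) =
      π (frozenD ε d M a c n * w) + (1 - c * con ε a a) • π (ad (d n) y) := by
  have h1 : π ((con ε a fun k => M k n) * y) = π ((con ε a fun k => M k n) * w) :=
    hπ.mul_left _ _ _ (fun k => h.commute_con k n) hyw
  -- Left multiplication by `d n` is not compatible with evaluation, because `d n` does not commute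
  -- with the coordinates. It is moved to the right, and the commutator is kept.
  have h2 : π (d n * y) = π (d n * w) + π (ad (d n) y) := by
    rw [mul_eq_mul_add_ad (d n) y, mul_eq_mul_add_ad (d n) w, hw, add_zero, map_add,
      hπ.mul_right y w _ hyw]
  simp only [frozenD, sub_mul, smul_mul_assoc, map_sub, map_smul, h1, h2]
  module

/-- The correction arises because the derivative in the left factor acts on the coefficient
functions of the right factor before these are evaluated. -/
theorem IsEvalAt.map_frameGen_mul [IsAddTorsionFree A] [IsAddTorsionFree Q]
    (hπ : IsEvalAt x a π)
    (h : IsWeylSpin ε x d M) (hr : 4 * c * r ^ 2 = 1) (hγ : γ * (1 - c * con ε a a) = 1)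
    (m n : Fin N) : π (frameGen ε x d M a r c γ n.castSucc (Fin.last N) *
      frameGen ε x d M a r c γ m.castSucc (Fin.last N)) =
      r ^ 2 • π (frozenD ε d M a c n * frozenD ε d M a c m)
      + (r * (1 - c * con ε a a)) •
        π (ad (d n) (frameGen ε x d M a r c γ m.castSucc (Fin.last N))) := by
  have hm := hπ.map_frameGen_castSucc_last h hr hγ m
  rw [hπ.mul_right _ _ _ (hπ.map_frameGen_castSucc_last h hr hγ n), smul_mul_assoc, map_smul,
    hπ.map_frozenD_mul h hm (fun k => by rw [ad_smul, h.ad_d_frozenD, smul_zero]), mul_smul_comm,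
    map_smul]
  module

theorem IsEvalAt.map_ad_frameGen [IsAddTorsionFree A] [IsAddTorsionFree Q]
    (hπ : IsEvalAt x a π)
    (h : IsWeylSpin ε x d M) (hr : 4 * c * r ^ 2 = 1) (hγ : γ * (1 - c * con ε a a) = 1)
    (m n : Fin N) : (1 - c * con ε a a) •
        π (ad (d n) (frameGen ε x d M a r c γ m.castSucc (Fin.last N))) =
      (2 * r * c) • ((1 + c * con ε a a) • (a n • π (d m)
        - diagMetric ε n m • con ε a (fun k => π (d k)) - a m • π (d n) + π (M n m))
      - (2 : ℤ) • (a n • π (d m) - diagMetric ε n m • con ε a fun k => π (d k))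
      + (2 * c) • (a m • (con ε a a • π (d n) + con ε a fun k => π (M k n)))) := by
  have e1 : ∀ k, ad (d n) (translGen ε x d M c k) = c • ad (d n) (specialConf ε x d M k) :=
    fun k => by rw [translGen, map_add, ad_smul, h.ad_d_d, zero_add]
  have e2 : ∀ k, ad (d n) (rotGen x d M k m) =
      diagMetric ε n k • d m - diagMetric ε n m • d k := fun k => by
    rw [ad_swap, h.ad_rotGen_d, diagMetric_comm n, diagMetric_comm n]
    abel
  have e3 : ∀ v : Fin N → A, ad (d n) (con ε a v) = con ε a fun k => ad (d n) (v k) := fun v => by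
    simp only [con, map_sum, ad_smul]
  have e4 : con ε a (fun k => π (M n k)) = -con ε a fun k => π (M k n) := by
    rw [← con_neg]
    exact congrArg _ (funext fun k => by rw [h.antisymm n k, map_neg])
  rw [frameGen_castSucc_last h hr]
  simp only [map_sub, ad_smul, e1, e2, e3, h.ad_d_specialConf, map_smul, map_add, map_zsmul,
    map_con, con_add, con_sub, con_smul, con_zsmul, hπ.map_x_mul, hπ.map_dotOp, con_smul_const,
    con_diagMetric a h.sq_eq_one, e4]
  linear_combination (norm := module) hγ • ((4 * r * c) • (a n • π (d m)
      - diagMetric ε n m • con ε a (fun k => π (d k)) - a m • π (d n) + π (M n m))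
    - (4 * c * r) • (a n • π (d m) - diagMetric ε n m • con ε a fun k => π (d k))
    + (4 * c ^ 2 * r * a m) • (con ε a a • π (d n) + con ε a fun k => π (M k n)))

/-- The covariant derivative `𝒟_n = (1 - c x²) ∂_n - 2 c x^k M_{kn}`. -/
def covDer (ε : Fin N → ℤ) (x d : Fin N → A) (M : Fin N → Fin N → A) (c : S) (n : Fin N) : A :=
  d n - c • (dotOp ε x x * d n) - (2 * c) • spinRot ε x M n

/-- The second covariant derivative. -/
def covDer₂ (ε : Fin N → ℤ) (x d : Fin N → A) (M : Fin N → Fin N → A) (c : S) (m n : Fin N) : A :=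
  covDer ε x d M c m * covDer ε x d M c n - (2 * c) • (x n * covDer ε x d M c m
    - diagMetric ε m n • dotOp ε x (covDer ε x d M c))

theorem IsEvalAt.map_covDer_mul (hπ : IsEvalAt x a π) (n : Fin N) (z : A) :
    π (covDer ε x d M c n * z) = π (frozenD ε d M a c n * z) := by
  refine hπ.mul_right _ _ _ ?_
  simp only [covDer, frozenD, spinRot, map_sub, map_smul, hπ.map_sq_mul, hπ.map_dotOp, map_con]
  module

theorem IsEvalAt.map_covDer (hπ : IsEvalAt x a π) (n : Fin N) :
    π (covDer ε x d M c n) = π (frozenD ε d M a c n) := by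
  simpa using hπ.map_covDer_mul (ε := ε) (d := d) (M := M) (c := c) n 1

theorem IsEvalAt.map_covDer₂ [IsAddTorsionFree Q] (hπ : IsEvalAt x a π)
    (h : IsWeylSpin ε x d M) (m n : Fin N) :
    π (covDer₂ ε x d M c m n) = π (frozenD ε d M a c m * frozenD ε d M a c n)
      - (2 * c) • ((1 - c * con ε a a) • (a m • π (d n) + π (M m n))
        + a n • π (frozenD ε d M a c m)
        - (diagMetric ε m n : ℤ) • ((1 - c * con ε a a) • con ε a fun k => π (d k))) := by
  have h0 : con ε a (fun i => con ε a fun k => π (M k i)) = 0 :=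
    con_con_eq_zero ε a fun i j => by rw [h.antisymm, map_neg]
  have e1 : π (ad (d m) (covDer ε x d M c n)) = -((2 * c) • (a m • π (d n) + π (M m n))) := by
    simp only [covDer, map_sub, ad_smul, ad_mul, h.ad_d_d, h.ad_d_sq, h.ad_d_spinRot, map_smul,
      smul_mul_assoc, map_zsmul, hπ.map_x_mul, mul_zero, add_zero, map_zero]
    module
  have e2 : con ε a (fun k => π (frozenD ε d M a c k)) =
      (1 - c * con ε a a) • con ε a fun k => π (d k) := by
    simp only [frozenD, map_sub, map_smul, con_sub, con_smul, map_con, h0, smul_zero, sub_zero]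
  rw [covDer₂, map_sub, map_smul, map_sub, map_zsmul, hπ.map_covDer_mul,
    hπ.map_frozenD_mul h (hπ.map_covDer n) (fun k => h.ad_d_frozenD k n), e1, hπ.map_x_mul,
    hπ.map_dotOp]
  simp only [hπ.map_covDer, e2]
  module

/-- Frozen derivatives have constant coefficients, so only the commutator of their two spin terms
remains. -/
theorem IsEvalAt.map_frozenD_comm [IsAddTorsionFree A] [IsAddTorsionFree Q] (hπ : IsEvalAt x a π)
    (h : IsWeylSpin ε x d M) (m n : Fin N) :
    π (frozenD ε d M a c n * frozenD ε d M a c m) = π (frozenD ε d M a c m * frozenD ε d M a c n)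
      + (4 * c ^ 2) • (a n • con ε a (fun k => π (M k m)) - a m • con ε a (fun k => π (M k n))
        - con ε a a • π (M n m)) := by
  have h0 : con ε a (fun i => con ε a fun k => M k i) = 0 :=
    con_con_eq_zero ε a fun i j => h.antisymm j i
  have h1 : ∀ i, con ε a (fun k => M i k) = -con ε a fun k => M k i := fun i => by
    rw [← con_neg]
    exact congrArg _ (funext fun k => h.antisymm i k)
  have e1 : ∀ (z : A) (v : Fin N → A), ad z (con ε a v) = con ε a fun k => ad z (v k) :=
    fun z v => by simp only [con, map_sum, ad_smul]
  have e2 : ∀ k, ad (con ε a fun l => M l n) (M k m) = diagMetric ε n k • con ε a (fun l => M l m)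
      + a m • M n k - diagMetric ε n m • con ε a (fun l => M l k) - a k • M n m := fun k => by
    have e3 : ∀ l, ad (M k m) (M l n) = -(diagMetric ε n k • M l m + diagMetric ε m l • M n k
      - diagMetric ε n m • M l k - diagMetric ε k l • M n m) := fun l => by
      rw [ad_swap, h.ad_M_M, diagMetric_comm l m, diagMetric_comm l k]
    rw [ad_swap, e1]
    simp only [e3, con_add, con_sub, con_neg, con_zsmul, con_diagMetric a h.sq_eq_one, neg_neg]
  have e4 : ad (frozenD ε d M a c n) (frozenD ε d M a c m) = (4 * c ^ 2) •
      (a n • con ε a (fun k => M k m) - a m • con ε a (fun k => M k n)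
        - con ε a a • M n m) := by
    have e5 : ad (frozenD ε d M a c n) (d m) = 0 := by rw [ad_swap, h.ad_d_frozenD, neg_zero]
    have e6 : ad (frozenD ε d M a c n) (con ε a fun k => M k m) =
        -((2 * c) • ad (con ε a fun k => M k n) (con ε a fun k => M k m)) := by
      rw [ad_swap, frozenD, map_sub, ad_smul, ad_smul, ad_swap _ (d n), h.ad_d_con,
        ad_swap _ (con ε a fun k => M k n)]
      simp
    rw [frozenD.eq_def ε d M a c m, map_sub, ad_smul, ad_smul, e5, e6, e1]
    simp only [e2, con_add, con_sub, con_zsmul, con_smul, con_smul_const, h0, h1,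
      con_diagMetric a h.sq_eq_one]
    module
  rw [mul_eq_mul_add_ad, map_add, e4]
  simp only [map_smul, map_sub, map_con]

/-- The factors appear in reversed order because the bracket of the rotated translations and the
antisymmetric part of `covDer₂` have opposite signs. The order in `translSq` is chosen accordingly.
-/
theorem IsEvalAt.map_frameGen_mul_eq [IsAddTorsionFree A] [IsAddTorsionFree Q]
    (hπ : IsEvalAt x a π)
    (h : IsWeylSpin ε x d M) (hr : 4 * c * r ^ 2 = 1) (hγ : γ * (1 - c * con ε a a) = 1)
    (m n : Fin N) : π (frameGen ε x d M a r c γ n.castSucc (Fin.last N) *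
      frameGen ε x d M a r c γ m.castSucc (Fin.last N)) = π (r ^ 2 • covDer₂ ε x d M c m n) := by
  have e1 := hπ.map_ad_frameGen h hr hγ m n
  have e2 := hπ.map_frozenD_comm (a := a) (c := c) h m n
  have e3 : π (frozenD ε d M a c m) =
    (1 - c * con ε a a) • π (d m) - (2 * c) • con ε a fun k => π (M k m) := by
    simp only [frozenD, map_sub, map_smul, map_con]
  have e4 : π (M n m) = -π (M m n) := by rw [h.antisymm, map_neg]
  rw [hπ.map_frameGen_mul h hr hγ, mul_smul, e1, e2, map_smul, hπ.map_covDer₂ h, e3, e4,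
    diagMetric_comm n m]
  module

end Frame

/-! ### Comparison of polynomial expressions at a point -/

section Congr

variable {ι A S Q : Type*} [Ring A] [CommRing S] [Algebra S A] [AddCommGroup Q] [Module S Q]
  {x : ι → A} {a : ι → S} {π : A →ₗ[S] Q}

/-- Two operators with the same evaluation at a point, the second of which commutes with the
coordinates. -/
structure EvalEq (x : ι → A) (π : A →ₗ[S] Q) (y w : A) : Prop where
  map_eq : π y = π w
  commute : ∀ k, Commute (x k) w

theorem EvalEq.mul {y w y' w' : A} (hπ : IsEvalAt x a π) (h : EvalEq x π y w)
    (h' : EvalEq x π y' w') : EvalEq x π (y * y') (w * w') where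
  map_eq := by rw [hπ.mul_right _ _ _ h.map_eq, hπ.mul_left _ _ _ h.commute h'.map_eq]
  commute k := (h.commute k).mul_right (h'.commute k)

theorem EvalEq.map_mul {y w y' w' : A} (hπ : IsEvalAt x a π) (h : EvalEq x π y w)
    (h' : π y' = π w') : π (y * y') = π (w * w') := by
  rw [hπ.mul_right _ _ _ h.map_eq, hπ.mul_left _ _ _ h.commute h']

theorem EvalEq.zsmul {y w : A} (n : ℤ) (h : EvalEq x π y w) : EvalEq x π (n • y) (n • w) where
  map_eq := by rw [map_zsmul, map_zsmul, h.map_eq]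
  commute k := (h.commute k).smul_right n

theorem EvalEq.sum {κ : Type*} [Fintype κ] {f g : κ → A} (h : ∀ i, EvalEq x π (f i) (g i)) :
    EvalEq x π (∑ i, f i) (∑ i, g i) where
  map_eq := by rw [map_sum, map_sum, Finset.sum_congr rfl fun i _ => (h i).map_eq]
  commute k := Commute.sum_right _ _ _ fun i _ => (h i).commute k

variable {N : ℕ} {ε : Fin N → ℤ} {X Y E E' : Fin N → Fin N → A} {x : Fin N → A} {a : Fin N → S}

theorem EvalEq.spinTrace₂ (hπ : IsEvalAt x a π) (h : ∀ m n, EvalEq x π (X m n) (Y m n)) :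
    EvalEq x π (spinTrace₂ ε X) (spinTrace₂ ε Y) :=
  .sum fun m => .sum fun n => ((h m n).mul hπ (h n m)).zsmul _

theorem EvalEq.spinTrace₄ (hπ : IsEvalAt x a π) (h : ∀ m n, EvalEq x π (X m n) (Y m n)) :
    EvalEq x π (spinTrace₄ ε X) (spinTrace₄ ε Y) :=
  .sum fun m => .sum fun n => .sum fun k => .sum fun l =>
    ((((h m n).mul hπ (h n k)).mul hπ (h k l)).mul hπ (h l m)).zsmul _

theorem EvalEq.spinTrace₆ (hπ : IsEvalAt x a π) (h : ∀ m n, EvalEq x π (X m n) (Y m n)) :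
    EvalEq x π (spinTrace₆ ε X) (spinTrace₆ ε Y) :=
  .sum fun m => .sum fun n => .sum fun k => .sum fun l => .sum fun r => .sum fun s =>
    ((((((h m n).mul hπ (h n k)).mul hπ (h k l)).mul hπ (h l r)).mul hπ (h r s)).mul hπ
      (h s m)).zsmul _

theorem map_spinForm₀_congr (hE : ∀ m n, π (E m n) = π (E' m n)) :
    π (spinForm₀ ε E) = π (spinForm₀ ε E') := by
  simp only [spinForm₀, map_sum, map_zsmul, hE]

theorem map_spinForm₁_congr (hπ : IsEvalAt x a π) (h : ∀ m n, EvalEq x π (X m n) (Y m n))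
    (hE : ∀ m n, π (E m n) = π (E' m n)) : π (spinForm₁ ε X E) = π (spinForm₁ ε Y E') := by
  simp only [spinForm₁, map_sum, map_zsmul]
  refine Finset.sum_congr rfl fun k _ => Finset.sum_congr rfl fun m _ =>
    Finset.sum_congr rfl fun n _ => congrArg _ ?_
  exact ((h k m).mul hπ (h k n)).map_mul hπ (hE m n)

theorem map_spinForm₂_congr (hπ : IsEvalAt x a π) (h : ∀ m n, EvalEq x π (X m n) (Y m n))
    (hE : ∀ m n, π (E m n) = π (E' m n)) : π (spinForm₂ ε X E) = π (spinForm₂ ε Y E') := by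
  simp only [spinForm₂, map_sum, map_zsmul]
  refine Finset.sum_congr rfl fun k _ => Finset.sum_congr rfl fun d _ =>
    Finset.sum_congr rfl fun m _ => Finset.sum_congr rfl fun r _ =>
    Finset.sum_congr rfl fun n _ => congrArg _ ?_
  exact ((((h k d).mul hπ (h d m)).mul hπ (h k r)).mul hπ (h r n)).map_mul hπ (hE m n)

/-- In every monomial the spin operators, whose models `Y` commute with the coordinates, stand to
the left of at most one factor built from `E`. So the factors may be replaced successively under the
evaluation. -/
theorem map_casimirValue_congr (hπ : IsEvalAt x a π) (h : ∀ m n, EvalEq x π (X m n) (Y m n))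
    (hE : ∀ m n, π (E m n) = π (E' m n)) :
    π (casimirValue₁ ε X E) = π (casimirValue₁ ε Y E') ∧
    π (casimirValue₂ ε X E) = π (casimirValue₂ ε Y E') ∧
    π (casimirValue₃ ε X E) = π (casimirValue₃ ε Y E') := by
  have t2 := EvalEq.spinTrace₂ (ε := ε) hπ h
  have t4 := EvalEq.spinTrace₄ (ε := ε) hπ h
  have t6 := EvalEq.spinTrace₆ (ε := ε) hπ h
  have d0 := map_spinForm₀_congr (ε := ε) hE
  have d1 := map_spinForm₁_congr (ε := ε) hπ h hE
  have d2 := map_spinForm₂_congr (ε := ε) hπ h hE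
  refine ⟨?_, ?_, ?_⟩
  · simp only [casimirValue₁, map_sub, map_zsmul, t2.map_eq, d0]
  · simp only [casimirValue₂, map_sub, map_add, map_zsmul, t2.map_eq, t4.map_eq, d1,
      t2.map_mul hπ d0, (t2.mul hπ t2).map_eq]
  · simp only [casimirValue₃, map_sub, map_add, map_zsmul, t2.map_eq, t4.map_eq, t6.map_eq, d1, d2,
      t2.map_mul hπ d0, t4.map_mul hπ d0, t2.map_mul hπ d1, (t2.mul hπ t2).map_mul hπ d0,
      (t2.mul hπ t2).map_eq, ((t2.mul hπ t2).mul hπ t2).map_eq, (t2.mul hπ t4).map_eq]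

end Congr

/-! ### The Casimir sums at a point -/

section Point

variable {N : ℕ} {A Q 𝕜 : Type*} [Ring A] [Field 𝕜] [CharZero 𝕜] [Algebra 𝕜 A]
  [IsAddTorsionFree A] [AddCommGroup Q] [Module 𝕜 Q] [IsAddTorsionFree Q] {ε : Fin N → ℤ}
  {x d : Fin N → A} {M : Fin N → Fin N → A} {a : Fin N → 𝕜} {π : A →ₗ[𝕜] Q} {r c : 𝕜}

/-- The rotated generators satisfy the same relations, so `casimirSum_eq` applies to them, while
`casimirSum_rotate` identifies their Casimir sum with the original one. -/
theorem IsEvalAt.map_casimirSum (hπ : IsEvalAt x a π) (h : IsWeylSpin ε x d M)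
    (hr : 4 * c * r ^ 2 = 1) (ha : 1 - c * con ε a a ≠ 0) :
    π (casimirSum (ambSign ε) 1 (ambGen ε x d M r c)) =
      π (casimirValue₁ ε M fun m n => r ^ 2 • covDer₂ ε x d M c m n) ∧
    π (casimirSum (ambSign ε) 2 (ambGen ε x d M r c)) =
      π (casimirValue₂ ε M fun m n => r ^ 2 • covDer₂ ε x d M c m n) ∧
    π (casimirSum (ambSign ε) 3 (ambGen ε x d M r c)) =
      π (casimirValue₃ ε M fun m n => r ^ 2 • covDer₂ ε x d M c m n) := by
  have hγ : (1 - c * con ε a a)⁻¹ * (1 - c * con ε a a) = 1 := inv_mul_cancel₀ ha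
  have hsq : ∀ i, ambSign ε i * ambSign ε i = 1 := fun i => by
    refine Fin.lastCases ?_ (fun i => ?_) i
    · simp [ambSign]
    · simpa [ambSign] using h.sq_eq_one i
  have ho := frameMatrix_orthogonal (r := r) (a := a) h.sq_eq_one hr hγ
  have hso : IsMetricSO (ambSign ε) (frameGen ε x d M a r c (1 - c * con ε a a)⁻¹) :=
    (h.isMetricSO_ambGen hr).rotate ho
  have hv := casimirSum_eq 𝕜 hso hsq (by simp [ambSign])
  simp only [frameGen, casimirSum_rotate (orthogonal_transpose hsq ho)] at hv
  have hε : (fun i : Fin N => ambSign ε i.castSucc) = ε := by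
    funext i
    simp [ambSign]
  rw [hε] at hv
  have hc := map_casimirValue_congr (ε := ε) (Y := M) hπ
    (X := blockOf (frameGen ε x d M a r c (1 - c * con ε a a)⁻¹))
    (E := translSq (frameGen ε x d M a r c (1 - c * con ε a a)⁻¹))
    (fun m n => ⟨hπ.map_frameGen_castSucc h hr hγ m n, fun k => sub_eq_zero.mp (h.ad_x_M k m n)⟩)
    fun m n => hπ.map_frameGen_mul_eq h hr hγ m n
  exact ⟨(congrArg π hv.1).trans hc.1, (congrArg π hv.2.1).trans hc.2.1,
    (congrArg π hv.2.2).trans hc.2.2⟩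

end Point

/-! ### The right ideal of a point -/

section Ideal

variable {ι A S : Type*} [Ring A] [CommRing S] [Algebra S A]

/-- The right ideal generated by the differences `x_k - a_k`. -/
def coordIdeal (x : ι → A) (a : ι → S) : Submodule S A :=
  Submodule.span S {z | ∃ k w, z = x k * w - a k • w}

/-- Right multiplication preserves the spanning set. Left multiplication by `b` does so as well when
`b` can be moved past `x_k`. -/
theorem isEvalAt_mkQ (x : ι → A) (a : ι → S) : IsEvalAt x a (coordIdeal x a).mkQ where
  map_x_mul k z := by
    rw [← map_smul]
    exact (Submodule.Quotient.eq _).mpr (Submodule.subset_span ⟨k, z, rfl⟩)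
  mul_right z w v h := by
    have h1 := (Submodule.Quotient.eq _).mp h
    refine (Submodule.Quotient.eq _).mpr ?_
    rw [← sub_mul]
    generalize z - w = t at h1
    induction h1 using Submodule.span_induction with
    | mem y hy =>
      obtain ⟨k, u, rfl⟩ := hy
      exact Submodule.subset_span ⟨k, u * v, by rw [sub_mul, mul_assoc, smul_mul_assoc]⟩
    | zero => rw [zero_mul]; exact zero_mem _
    | add y z _ _ hy hz => rw [add_mul]; exact add_mem hy hz
    | smul r y _ hy => rw [smul_mul_assoc]; exact Submodule.smul_mem _ _ hy
  mul_left b z w hb h := by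
    have h1 := (Submodule.Quotient.eq _).mp h
    refine (Submodule.Quotient.eq _).mpr ?_
    rw [← mul_sub]
    generalize z - w = t at h1
    induction h1 using Submodule.span_induction with
    | mem y hy =>
      obtain ⟨k, u, rfl⟩ := hy
      exact Submodule.subset_span ⟨k, b * u, by
        rw [mul_sub, ← mul_assoc, ← (hb k).eq, mul_assoc, mul_smul_comm]⟩
    | zero => rw [mul_zero]; exact zero_mem _
    | add y z _ _ hy hz => rw [mul_add]; exact add_mem hy hz
    | smul r y _ hy => rw [mul_smul_comm]; exact Submodule.smul_mem _ _ hy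

end Ideal

theorem isAddTorsionFree_of_module (𝕜 V : Type*) [Field 𝕜] [CharZero 𝕜] [AddCommGroup V]
    [Module 𝕜 V] : IsAddTorsionFree V :=
  letI : Module ℚ V := Module.compHom V (algebraMap ℚ 𝕜)
  .of_module_rat _

/-! ### Coordinates and derivatives as operators on the function space -/

variable {p q : ℕ} {R : ℝ} {𝕜 : Type*} [RCLike 𝕜] {C : ChartDomain p q R} {Y : Type*}

theorem slice_apply (Ψ : C.carrier → Y → 𝕜) (y : Y) (x : C.carrier) : slice Ψ y x = Ψ x y :=
  Subtype.val_injective.extend_apply _ _ _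

theorem slice_mulX (f : (Fin (p + q) → ℝ) → ℝ) (Ψ : C.carrier → Y → 𝕜) (y : Y) :
    slice (mulX f Ψ) y = fun x => (f x : 𝕜) * slice Ψ y x := by
  funext x
  by_cases hx : x ∈ C.carrier
  · lift x to C.carrier using hx
    rw [slice_apply, slice_apply, mulX]
  · have h : ¬ ∃ a : C.carrier, a.1 = x := by
      rintro ⟨a, rfl⟩
      exact hx a.2
    simp [slice, Function.extend_apply' _ _ _ h]

theorem lowerCoord_eq (x : Fin (p + q) → ℝ) (n : Fin (p + q)) :
    lowerCoord x n = etaSign p q n * x n := by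
  rw [lowerCoord, raise_eta, zsmul_eq_mul]

theorem etaSign_mul_self (n : Fin (p + q)) : etaSign p q n * etaSign p q n = 1 := by
  rw [etaSign]
  split_ifs <;> rfl

theorem eta_eq (m n : Fin (p + q)) : eta p q m n = diagMetric (etaSign p q) m n := by
  rw [eta, Matrix.diagonal_apply, diagMetric, kd]
  split_ifs <;> simp

namespace FieldSpace

variable (F : FieldSpace 𝕜 C Y)

theorem op_ext {Z W : F.Op} (h : ∀ Ψ x y, (Z Ψ).1 x y = (W Ψ).1 x y) : Z = W := by
  ext Ψ x y
  exact h Ψ x y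

/-- An operator `(x_k - a_k) V` maps every function to one that vanishes at the point with
coordinates `a`. Congruent operators therefore produce functions with equal values there. -/
theorem eq_of_mkQ_eq {Z W : F.Op}
    (h : ∀ x : C.carrier, (coordIdeal F.coordOp fun k => (lowerCoord x.1 k : 𝕜)).mkQ Z =
      (coordIdeal F.coordOp fun k => (lowerCoord x.1 k : 𝕜)).mkQ W) : Z = W := by
  refine F.op_ext fun Ψ x y => ?_
  have h1 := (Submodule.Quotient.eq _).mp (h x)
  have h2 : ∀ U ∈ coordIdeal F.coordOp fun k => (lowerCoord x.1 k : 𝕜), (U Ψ).1 x y = 0 := by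
    intro U hU
    induction hU using Submodule.span_induction with
    | mem U hU =>
      obtain ⟨k, V, rfl⟩ := hU
      exact sub_self _
    | zero => rfl
    | add U V _ _ hU hV => exact (congrArg₂ (· + ·) hU hV).trans (add_zero 0)
    | smul r U _ hU => exact (congrArg (r * ·) hU).trans (mul_zero r)
  exact sub_eq_zero.mp (h2 _ h1)

theorem partialOp_apply (μ : Fin (p + q)) (Ψ : F.carrier) (x : C.carrier) (y : Y) :
    (F.partialOp μ Ψ).1 x y = pderiv μ (slice Ψ.1 y) x := rfl

theorem partialOp_coordOp (m n : Fin (p + q)) :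
    ad (F.partialOp m) (F.coordOp n) = diagMetric (etaSign p q) m n • 1 := by
  refine F.op_ext fun Ψ x y => ?_
  have h1 : HasFDerivAt (fun z : Fin (p + q) → ℝ => (lowerCoord z n : 𝕜))
      ((RCLike.ofRealCLM (K := 𝕜)).comp ((etaSign p q n : ℝ) •
        ContinuousLinearMap.proj (R := ℝ) (φ := fun _ : Fin (p + q) => ℝ) n)) x.1 := by
    have : (fun z : Fin (p + q) → ℝ => (lowerCoord z n : 𝕜)) =
        ((RCLike.ofRealCLM (K := 𝕜)).comp ((etaSign p q n : ℝ) •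
        ContinuousLinearMap.proj (R := ℝ) (φ := fun _ : Fin (p + q) => ℝ) n)) := by
      funext z
      simp [lowerCoord_eq]
    rw [this]
    exact ContinuousLinearMap.hasFDerivAt _
  have h2 := h1.mul (slice_differentiableAt F Ψ.2 y x).hasFDerivAt
  have h3 : (F.partialOp m (F.coordOp n Ψ)).1 x y = (lowerCoord x.1 n : 𝕜) *
      pderiv m (slice Ψ.1 y) x.1 + (diagMetric (etaSign p q) m n : 𝕜) * Ψ.1 x y := by
    rw [partialOp_apply]
    change fderiv ℝ (slice (mulX (fun x => lowerCoord x n) Ψ.1) y) x.1 (Pi.single m 1) = _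
    rw [slice_mulX]
    refine (congrArg (· (Pi.single m 1)) h2.fderiv).trans ?_
    rw [diagMetric_comm]
    simp [pderiv, diagMetric, slice_apply, kd, Pi.single_apply, RCLike.real_smul_eq_coe_mul,
      mul_comm]
  have h4 : (F.coordOp n (F.partialOp m Ψ)).1 x y = (lowerCoord x.1 n : 𝕜) *
      pderiv m (slice Ψ.1 y) x.1 := rfl
  change (F.partialOp m (F.coordOp n Ψ)).1 x y - (F.coordOp n (F.partialOp m Ψ)).1 x y =
    diagMetric (etaSign p q) m n • Ψ.1 x y
  rw [h3, h4, zsmul_eq_mul]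
  ring

theorem partialOp_comm (m n : Fin (p + q)) : ad (F.partialOp m) (F.partialOp n) = 0 := by
  refine sub_eq_zero.mpr (F.op_ext fun Ψ x y => ?_)
  have h1 : ∀ m n, (F.partialOp m (F.partialOp n Ψ)).1 x y =
      fderiv ℝ (fderiv ℝ (slice Ψ.1 y)) x (Pi.single m 1) (Pi.single n 1) := by
    intro m n
    have hf := (F.contDiffOn Ψ.1 Ψ.2 y).contDiffAt (C.isOpen.mem_nhds x.2)
    have hd : DifferentiableAt ℝ (fderiv ℝ (slice Ψ.1 y)) x :=
      (hf.fderiv_right (m := 1) (WithTop.coe_le_coe.mpr le_top)).differentiableAt one_ne_zero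
    -- The slice of a derivative is extended by zero, so it is identified with the derivative of the
    -- slice only on the domain; openness makes this enough.
    have he : slice (F.partialOp n Ψ).1 y =ᶠ[nhds x.1]
        fun z => fderiv ℝ (slice Ψ.1 y) z (Pi.single n 1) := by
      filter_upwards [C.isOpen.mem_nhds x.2] with z hz
      exact slice_apply _ y ⟨z, hz⟩
    rw [partialOp_apply, pderiv, he.fderiv_eq, fderiv_clm_apply hd (differentiableAt_const _)]
    simp
  have h2 := ((F.contDiffOn Ψ.1 Ψ.2 y).contDiffAt (C.isOpen.mem_nhds x.2)).isSymmSndFDerivAt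
    (by simpa using (WithTop.coe_le_coe.mpr le_top : (2 : WithTop ℕ∞) ≤ ∞))
  exact (h1 m n).trans ((h2 _ _).trans (h1 n m).symm)

end FieldSpace

/-! ### Contractions with the spin connection -/

section Abstract

variable {N : ℕ} {A S : Type*} [Ring A] [CommRing S] [Algebra S A] {ε : Fin N → ℤ} {x : Fin N → A}
  {c : S}

/-- The spin connection `w_{knm} = -2c (x_n η_{mk} - x_m η_{nk})`. -/
def spinConnGen (ε : Fin N → ℤ) (x : Fin N → A) (c : S) (k n m : Fin N) : A :=
  (-(2 * c)) • (diagMetric ε m k • x n - diagMetric ε n k • x m)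

/-- By the antisymmetry of `T` the two terms of the connection contribute equally, which turns `2 c`
into `4 c`. -/
theorem sum_spinConnGen_mul (hε : ∀ a, ε a * ε a = 1) {T : Fin N → Fin N → A}
    (hT : ∀ k l, T k l = -T l k) (n : Fin N) :
    ∑ k, ∑ l, spinConnGen ε x c n k l * raise₂ (Matrix.diagonal ε) T k l =
      (-(4 * c)) • dotOp ε x fun k => T k n := by
  have h1 : ∀ k l, spinConnGen ε x c n k l * raise₂ (Matrix.diagonal ε) T k l =
      (2 * c) • (ε l • (ε k • (diagMetric ε k n • (x l * T k l))))
      - (2 * c) • (ε k • (ε l • (diagMetric ε l n • (x k * T k l)))) := fun k l => by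
    rw [spinConnGen, raise₂_diagonal, mul_smul_comm, smul_mul_assoc, sub_mul,
      smul_mul_assoc, smul_mul_assoc]
    module
  have h2 : ∑ k, ∑ l, (2 * c) • (ε l • (ε k • (diagMetric ε k n • (x l * T k l)))) =
      (-(2 * c)) • dotOp ε x fun k => T k n := by
    rw [Finset.sum_comm, neg_smul, ← smul_neg, ← dotOp_neg, dotOp, Finset.smul_sum]
    refine Finset.sum_congr rfl fun l _ => ?_
    rw [← Finset.smul_sum, ← Finset.smul_sum, sum_diagMetric' hε n fun k => x l * T k l, hT]
  have h3 : ∑ k, ∑ l, (2 * c) • (ε k • (ε l • (diagMetric ε l n • (x k * T k l)))) =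
      (2 * c) • dotOp ε x fun k => T k n := by
    rw [dotOp, Finset.smul_sum]
    refine Finset.sum_congr rfl fun k _ => ?_
    rw [← Finset.smul_sum, ← Finset.smul_sum, sum_diagMetric' hε n fun l => x k * T k l]
  simp only [h1, Finset.sum_sub_distrib, h2, h3]
  module

theorem sum_spinConnGen_mul_raise (hε : ∀ a, ε a * ε a = 1) (m n : Fin N) (D : Fin N → A) :
    ∑ l, spinConnGen ε x c m n l * raise (Matrix.diagonal ε) D l =
      (-(2 * c)) • (x n * D m - diagMetric ε m n • dotOp ε x D) := by
  have h2 : ∀ l, spinConnGen ε x c m n l * raise (Matrix.diagonal ε) D l = (-(2 * c)) •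
      (ε l • (diagMetric ε l m • (x n * D l)) - diagMetric ε m n • (ε l • (x l * D l))) :=
    fun l => by
      rw [spinConnGen, raise_diagonal, mul_smul_comm, smul_mul_assoc, sub_mul,
        smul_mul_assoc, smul_mul_assoc, diagMetric_comm n m]
      module
  simp only [h2, ← Finset.smul_sum, Finset.sum_sub_distrib,
    sum_diagMetric' hε m fun l => x n * D l]
  rfl

theorem casimirSum_eq_of_separating {𝕜 P : Type*} [Field 𝕜] [CharZero 𝕜] [Algebra 𝕜 A]
    {d : Fin N → A} {M : Fin N → Fin N → A} {r c : 𝕜} (h : IsWeylSpin ε x d M)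
    (hr : 4 * c * r ^ 2 = 1) (a : P → Fin N → 𝕜) (ha : ∀ t, 1 - c * con ε (a t) (a t) ≠ 0)
    (hsep : ∀ Z W : A, (∀ t, (coordIdeal x (a t)).mkQ Z = (coordIdeal x (a t)).mkQ W) → Z = W) :
    casimirSum (ambSign ε) 1 (ambGen ε x d M r c) =
      casimirValue₁ ε M (fun m n => r ^ 2 • covDer₂ ε x d M c m n) ∧
    casimirSum (ambSign ε) 2 (ambGen ε x d M r c) =
      casimirValue₂ ε M (fun m n => r ^ 2 • covDer₂ ε x d M c m n) ∧
    casimirSum (ambSign ε) 3 (ambGen ε x d M r c) =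
      casimirValue₃ ε M (fun m n => r ^ 2 • covDer₂ ε x d M c m n) := by
  have := isAddTorsionFree_of_module 𝕜 A
  have hQ := fun t => isAddTorsionFree_of_module 𝕜 (A ⧸ coordIdeal x (a t))
  have key := fun t => (isEvalAt_mkQ x (a t)).map_casimirSum h hr (ha t)
  exact ⟨hsep _ _ fun t => (key t).1, hsep _ _ fun t => (key t).2.1, hsep _ _ fun t => (key t).2.2⟩

end Abstract

variable {p q : ℕ} {R : ℝ} {𝕜 : Type*} [RCLike 𝕜] {C : ChartDomain p q R} {Y : Type*}

/-! ### Identification of the concrete operators with the abstract ones -/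

namespace FieldSpace

variable (F : FieldSpace 𝕜 C Y) {M : Fin (p + q) → Fin (p + q) → F.Op}

theorem isWeylSpin (hM : F.IsSpinPart M) :
    IsWeylSpin (etaSign p q) F.coordOp F.partialOp M where
  sq_eq_one := etaSign_mul_self
  ad_x_x m n := sub_eq_zero.mpr (F.op_ext fun Ψ x y => mul_left_comm _ _ _)
  ad_d_d := F.partialOp_comm
  ad_d_x := F.partialOp_coordOp
  antisymm := hM.antisymm
  ad_x_M k m n := sub_eq_zero.mpr (hM.comm_coord m n k).symm
  ad_d_M k m n := sub_eq_zero.mpr (hM.comm_partial m n k).symm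
  ad_M_M m n k l := by
    simp only [← eta_eq]
    exact hM.bracket m n k l

/-- The constant `1 / (4 R²)`. -/
noncomputable def curv (𝕜 : Type*) [RCLike 𝕜] (R : ℝ) : 𝕜 := 1 / (4 * (R : 𝕜) ^ 2)

theorem con_lowerCoord (x : Fin (p + q) → ℝ) :
    con (etaSign p q) (fun k => (lowerCoord x k : 𝕜)) (fun k => (lowerCoord x k : 𝕜)) =
      (sqForm x : 𝕜) := by
  rw [sqForm_eq, con]
  push_cast
  refine Finset.sum_congr rfl fun k _ => ?_
  have : (etaSign p q k : 𝕜) * etaSign p q k = 1 := by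
    rw [← Int.cast_mul, etaSign_mul_self, Int.cast_one]
  simp only [lowerCoord_eq, smul_eq_mul]
  push_cast
  linear_combination (etaSign p q k : 𝕜) * (x k : 𝕜) ^ 2 * this

theorem dotOp_apply (V : Fin (p + q) → F.Op) (Ψ : F.carrier) (x : C.carrier) (y : Y) :
    (dotOp (etaSign p q) F.coordOp V Ψ).1 x y =
      con (etaSign p q) (fun k => (lowerCoord x.1 k : 𝕜)) fun k => (V k Ψ).1 x y := by
  simp only [dotOp, con, LinearMap.sum_apply, Submodule.coe_sum, Finset.sum_apply]
  refine Finset.sum_congr rfl fun k _ => ?_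
  change etaSign p q k • ((lowerCoord x.1 k : 𝕜) * (V k Ψ).1 x y) = _
  rw [zsmul_eq_mul, smul_eq_mul, mul_assoc]

theorem vielbein_eq (n : Fin (p + q)) : F.vielbein n = F.partialOp n
    - curv 𝕜 R • (dotOp (etaSign p q) F.coordOp F.coordOp * F.partialOp n) := by
  refine F.op_ext fun Ψ x y => ?_
  have h1 : (F.vielbein n Ψ).1 x y = (G R x.1 : 𝕜) * (F.partialOp n Ψ).1 x y := by
    simp only [vielbein, LinearMap.sum_apply, Submodule.coe_sum, Finset.sum_apply]
    rw [Finset.sum_eq_single n]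
    · change (frame R x.1 n n : 𝕜) * _ = _
      rw [frame, if_pos rfl]
    · intro μ _ hμ
      change (frame R x.1 μ n : 𝕜) * _ = _
      rw [frame, if_neg hμ, RCLike.ofReal_zero, zero_mul]
    · simp
  have h2 : ((F.partialOp n - curv 𝕜 R • (dotOp (etaSign p q) F.coordOp F.coordOp *
      F.partialOp n)) Ψ).1 x y = (F.partialOp n Ψ).1 x y - curv 𝕜 R *
        (dotOp (etaSign p q) F.coordOp F.coordOp (F.partialOp n Ψ)).1 x y := rfl
  have h3 : ∀ Φ : F.carrier, (dotOp (etaSign p q) F.coordOp F.coordOp Φ).1 x y =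
      (sqForm x.1 : 𝕜) * Φ.1 x y := fun Φ => by
    rw [dotOp_apply, ← con_lowerCoord, ← smul_eq_mul, ← con_smul_const]
    rfl
  rw [h1, h2, h3, G, curv]
  push_cast
  ring

theorem spinConnOp_eq :
    F.spinConnOp = spinConnGen (etaSign p q) F.coordOp (curv 𝕜 R) := by
  funext k n m
  refine F.op_ext fun Ψ x y => ?_
  change (spinConn R x.1 k n m : 𝕜) * Ψ.1 x y = (-(2 * curv 𝕜 R)) *
    (diagMetric (etaSign p q) m k • ((lowerCoord x.1 n : 𝕜) * Ψ.1 x y)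
      - diagMetric (etaSign p q) n k • ((lowerCoord x.1 m : 𝕜) * Ψ.1 x y))
  rw [spinConn_eq (C.G_ne_zero x.1 x.2), curv, eta_eq, eta_eq, zsmul_eq_mul, zsmul_eq_mul]
  push_cast
  ring

theorem sum_spinConnOp_mul {T : Fin (p + q) → Fin (p + q) → F.Op} (hT : ∀ k l, T k l = -T l k)
    (n : Fin (p + q)) :
    ∑ k, ∑ l, F.spinConnOp n k l * raise₂ (eta p q) T k l =
      (-(4 * curv 𝕜 R)) • dotOp (etaSign p q) F.coordOp fun k => T k n := by
  rw [spinConnOp_eq]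
  exact sum_spinConnGen_mul etaSign_mul_self hT n

theorem covD_eq (hM : F.IsSpinPart M) (n : Fin (p + q)) :
    F.covD M n = covDer (etaSign p q) F.coordOp F.partialOp M (curv 𝕜 R) n := by
  rw [covD, F.sum_spinConnOp_mul hM.antisymm, vielbein_eq, covDer, spinRot]
  module

theorem covD₂_eq (hM : F.IsSpinPart M) (m n : Fin (p + q)) :
    F.covD₂ M m n = covDer₂ (etaSign p q) F.coordOp F.partialOp M (curv 𝕜 R) m n := by
  have h1 : F.covD M = covDer (etaSign p q) F.coordOp F.partialOp M (curv 𝕜 R) :=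
    funext (F.covD_eq hM)
  have h2 : ∀ D : Fin (p + q) → F.Op, ∑ l, F.spinConnOp m n l * raise (eta p q) D l =
      (-(2 * curv 𝕜 R)) • (F.coordOp n * D m - diagMetric (etaSign p q) m n •
        dotOp (etaSign p q) F.coordOp D) := fun D => by
    rw [spinConnOp_eq]
    exact sum_spinConnGen_mul_raise etaSign_mul_self m n D
  rw [covD₂, covDer₂, h1, h2]
  module

theorem genJ_eq : F.genJ M = rotGen F.coordOp F.partialOp M := rfl

/-- The orbital part of the connection term adds `2 c (x² ∂_n - x_n x^k ∂_k)` to the `-c x² ∂_n` of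
the vielbein; together with the spin part this is `c` times the special conformal generator. -/
theorem genP_eq (hM : F.IsSpinPart M) (n : Fin (p + q)) :
    F.genP M n = translGen (etaSign p q) F.coordOp F.partialOp M (curv 𝕜 R) n := by
  have h := F.isWeylSpin hM
  have h1 : dotOp (etaSign p q) F.coordOp (fun k => rotGen F.coordOp F.partialOp M k n) =
      dotOp (etaSign p q) F.coordOp F.coordOp * F.partialOp n
        - F.coordOp n * dotOp (etaSign p q) F.coordOp F.partialOp
        + spinRot (etaSign p q) F.coordOp M n := by
    simp only [rotGen, dotOp_add, dotOp_sub, dotOp_mul, h.dotOp_mul_left, spinRot]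
  rw [genP, genJ_eq, F.sum_spinConnOp_mul h.rotGen_antisymm, vielbein_eq, h1, translGen,
    specialConf]
  module

theorem genAmb_eq (hM : F.IsSpinPart M) : F.genAmb M =
    ambGen (etaSign p q) F.coordOp F.partialOp M (R : 𝕜) (curv 𝕜 R) := by
  have h1 : F.genP M = translGen (etaSign p q) F.coordOp F.partialOp M (curv 𝕜 R) :=
    funext (F.genP_eq hM)
  unfold genAmb
  rw [h1]
  rfl

theorem casimirSum_genAmb (hR : 0 < R) (hM : F.IsSpinPart M) :
    casimirSum (ambSign (etaSign p q)) 1 (F.genAmb M) =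
      casimirValue₁ (etaSign p q) M (fun m n => (R : 𝕜) ^ 2 • F.covD₂ M m n) ∧
    casimirSum (ambSign (etaSign p q)) 2 (F.genAmb M) =
      casimirValue₂ (etaSign p q) M (fun m n => (R : 𝕜) ^ 2 • F.covD₂ M m n) ∧
    casimirSum (ambSign (etaSign p q)) 3 (F.genAmb M) =
      casimirValue₃ (etaSign p q) M (fun m n => (R : 𝕜) ^ 2 • F.covD₂ M m n) := by
  have h := F.isWeylSpin hM
  have hR' : (R : 𝕜) ≠ 0 := RCLike.ofReal_ne_zero.mpr hR.ne'
  have hr : 4 * curv 𝕜 R * (R : 𝕜) ^ 2 = 1 := by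
    rw [curv]
    field_simp
  have hx : ∀ x : C.carrier, 1 - curv 𝕜 R * con (etaSign p q) (fun k => (lowerCoord x.1 k : 𝕜))
      (fun k => (lowerCoord x.1 k : 𝕜)) ≠ 0 := fun x => by
    have h1 : 1 - curv 𝕜 R * (sqForm x.1 : 𝕜) = (G R x.1 : 𝕜) := by
      rw [G, curv]
      push_cast
      ring
    rw [con_lowerCoord, h1]
    exact RCLike.ofReal_ne_zero.mpr (C.G_ne_zero x.1 x.2)
  have key := casimirSum_eq_of_separating h hr
    (fun x : C.carrier => fun k => (lowerCoord x.1 k : 𝕜)) hx fun Z W => F.eq_of_mkQ_eq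
  simp only [← F.genAmb_eq hM, ← F.covD₂_eq hM] at key
  exact key

end FieldSpace

/-! ### Forms with explicitly raised indices -/

section Contractions

variable {N : ℕ} {A S : Type*} [Ring A] [CommRing S] [Algebra S A] (ε : Fin N → ℤ)
  (M E : Fin N → Fin N → A)

theorem spinTrace₂_eq :
    spinTrace₂ ε M = ∑ m, ∑ n, M m n * raise₂ (Matrix.diagonal ε) M n m := by
  refine Finset.sum_congr rfl fun m _ => Finset.sum_congr rfl fun n _ => ?_
  rw [raise₂_diagonal, mul_smul_comm, mul_comm]

theorem spinTrace₄_eq : spinTrace₄ ε M = ∑ m, ∑ n, ∑ k, ∑ l,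
    M m n * raise₂ (Matrix.diagonal ε) M n k * M k l * raise₂ (Matrix.diagonal ε) M l m := by
  refine Finset.sum_congr rfl fun m _ => Finset.sum_congr rfl fun n _ =>
    Finset.sum_congr rfl fun k _ => Finset.sum_congr rfl fun l _ => ?_
  simp only [raise₂_diagonal, mul_smul_comm, smul_mul_assoc, smul_smul]
  congr 1
  ring

theorem spinTrace₆_eq : spinTrace₆ ε M = ∑ m, ∑ n, ∑ k, ∑ l, ∑ r, ∑ s,
    M m n * raise₂ (Matrix.diagonal ε) M n k * M k l * raise₂ (Matrix.diagonal ε) M l r * M r s *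
      raise₂ (Matrix.diagonal ε) M s m := by
  refine Finset.sum_congr rfl fun m _ => Finset.sum_congr rfl fun n _ =>
    Finset.sum_congr rfl fun k _ => Finset.sum_congr rfl fun l _ =>
    Finset.sum_congr rfl fun r _ => Finset.sum_congr rfl fun s _ => ?_
  simp only [raise₂_diagonal, mul_smul_comm, smul_mul_assoc, smul_smul]
  congr 1
  ring

theorem spinForm₀_eq : spinForm₀ ε E = ∑ m, ∑ n, Matrix.diagonal ε m n • E m n := by
  refine Finset.sum_congr rfl fun m _ => ?_
  simp [Matrix.diagonal_apply]

theorem spinForm₁_eq : spinForm₁ ε M E = ∑ k, ∑ m, ∑ n,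
    raise₂ (Matrix.diagonal ε) M k m * raise (Matrix.diagonal ε) (M k) n * E m n := by
  refine Finset.sum_congr rfl fun k _ => Finset.sum_congr rfl fun m _ =>
    Finset.sum_congr rfl fun n _ => ?_
  simp only [raise₂_diagonal, raise_diagonal, mul_smul_comm, smul_mul_assoc, smul_smul]
  congr 1
  ring

theorem spinForm₂_eq : spinForm₂ ε M E = ∑ k, ∑ d, ∑ m, ∑ r, ∑ n,
    raise (Matrix.diagonal ε) (fun a => M a d) k * raise₂ (Matrix.diagonal ε) M d m * M k r *
      raise₂ (Matrix.diagonal ε) M r n * E m n := by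
  refine Finset.sum_congr rfl fun k _ => Finset.sum_congr rfl fun d _ =>
    Finset.sum_congr rfl fun m _ => Finset.sum_congr rfl fun r _ =>
    Finset.sum_congr rfl fun n _ => ?_
  simp only [raise₂_diagonal, raise_diagonal, mul_smul_comm, smul_mul_assoc, smul_smul]
  congr 1
  ring

theorem spinForm₀_smul (s : S) : spinForm₀ ε (fun m n => s • E m n) = s • spinForm₀ ε E := by
  simp only [spinForm₀, Finset.smul_sum, smul_comm s]

theorem spinForm₁_smul (s : S) : spinForm₁ ε M (fun m n => s • E m n) = s • spinForm₁ ε M E := by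
  simp only [spinForm₁, Finset.smul_sum, smul_comm s, mul_smul_comm]

theorem spinForm₂_smul (s : S) : spinForm₂ ε M (fun m n => s • E m n) = s • spinForm₂ ε M E := by
  simp only [spinForm₂, Finset.smul_sum, smul_comm s, mul_smul_comm]

end Contractions

/-! ### Normalisation of the Casimir operators -/

section Normalization

variable {N : ℕ} {A 𝕜 : Type*} [Field 𝕜] [CharZero 𝕜] [Ring A] [Algebra 𝕜 A] {ε : Fin N → ℤ}
  {M E : Fin N → Fin N → A} {J : Fin (N + 1) → Fin (N + 1) → A} {r : 𝕜}

/-- In the three orders the divisor `(2ⁿ n!)²` is `4`, `64` and `2304`. -/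
theorem casimir_one_eq (s : ℕ) (h : casimirSum (ambSign ε) 1 J =
    casimirValue₁ ε M (fun m n => r ^ 2 • E m n)) :
    casimir 𝕜 (Matrix.diagonal (ambSign ε)) (s + 1) 1 J =
      (-1 : 𝕜) ^ s • (r ^ 2 • spinForm₀ ε E + (1 / 2 : 𝕜) • spinTrace₂ ε M) := by
  change _ • casimirSum (ambSign ε) 1 J = _
  rw [h, casimirValue₁, spinForm₀_smul]
  have h1 : ((-1) ^ (s + 1) / (2 ^ 1 * ((1 : ℕ).factorial : 𝕜)) ^ 2 : 𝕜) =
      (-1) ^ s * (-(1 / 4)) := by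
    norm_num [Nat.factorial, pow_succ]
    ring
  rw [h1]
  module

theorem casimir_two_eq (s : ℕ) (h : casimirSum (ambSign ε) 2 J =
    casimirValue₂ ε M (fun m n => r ^ 2 • E m n)) :
    casimir 𝕜 (Matrix.diagonal (ambSign ε)) (s + 1) 2 J =
      ((-1 : 𝕜) ^ (s + 1) * r ^ 2) •
        (spinForm₁ ε M E + (1 / 2 : 𝕜) • (spinTrace₂ ε M * spinForm₀ ε E)) +
      (-1 : 𝕜) ^ (s + 1) • ((((N : 𝕜) - 2) * ((N : 𝕜) + 1) / 8) • spinTrace₂ ε M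
        + (1 / 8 : 𝕜) • spinTrace₂ ε M ^ 2 - (1 / 4 : 𝕜) • spinTrace₄ ε M) := by
  change _ • casimirSum (ambSign ε) 2 J = _
  rw [h, casimirValue₂, spinForm₀_smul, spinForm₁_smul, mul_smul_comm, sq (spinTrace₂ ε M)]
  have h1 : ((-1) ^ (s + 1) / (2 ^ 2 * ((2 : ℕ).factorial : 𝕜)) ^ 2 : 𝕜) =
      (-1) ^ (s + 1) * (1 / 64) := by
    norm_num [Nat.factorial]
    ring
  rw [h1]
  module

theorem casimir_three_eq (s : ℕ) (h : casimirSum (ambSign ε) 3 J =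
    casimirValue₃ ε M (fun m n => r ^ 2 • E m n)) :
    casimir 𝕜 (Matrix.diagonal (ambSign ε)) (s + 1) 3 J =
      ((-1 : 𝕜) ^ s * r ^ 2) •
        (spinForm₂ ε M E + (1 / 8 : 𝕜) • (spinTrace₂ ε M ^ 2 * spinForm₀ ε E)
          - (1 / 4 : 𝕜) • (spinTrace₄ ε M * spinForm₀ ε E)
          + (1 / 2 : 𝕜) • (spinTrace₂ ε M * spinForm₁ ε M E)
          + (((N : 𝕜) ^ 2 - 5 * (N : 𝕜) + 10) / 8) • (spinTrace₂ ε M * spinForm₀ ε E)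
          + (1 : 𝕜) • spinForm₁ ε M E)
      - (-1 : 𝕜) ^ s • (
          (-((N : 𝕜) ^ 4 - 6 * (N : 𝕜) ^ 3 + 13 * (N : 𝕜) ^ 2 - 8 * (N : 𝕜) - 4) / 12) •
            spinTrace₂ ε M
          + ((-3 * (N : 𝕜) ^ 2 + (N : 𝕜) - 2) / 48) • spinTrace₂ ε M ^ 2
          + ((2 * (N : 𝕜) ^ 2 - 5 * (N : 𝕜) + 5) / 6) • spinTrace₄ ε M
          - (1 / 48 : 𝕜) • spinTrace₂ ε M ^ 3
          + (1 / 8 : 𝕜) • (spinTrace₂ ε M * spinTrace₄ ε M)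
          - (1 / 6 : 𝕜) • spinTrace₆ ε M) := by
  change _ • casimirSum (ambSign ε) 3 J = _
  rw [h, casimirValue₃, spinForm₀_smul, spinForm₁_smul, spinForm₂_smul, mul_smul_comm,
    mul_smul_comm, mul_smul_comm, mul_smul_comm, pow_succ (spinTrace₂ ε M) 2, sq (spinTrace₂ ε M)]
  have h1 : ((-1) ^ (s + 1) / (2 ^ 3 * ((3 : ℕ).factorial : 𝕜)) ^ 2 : 𝕜) =
      (-1) ^ s * (-(1 / 2304)) := by
    norm_num [Nat.factorial, pow_succ]
    ring
  rw [h1]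
  module

end Normalization

namespace FieldSpace

variable {p q : ℕ} {R : ℝ} {𝕜 : Type*} [RCLike 𝕜] {C : ChartDomain p q R} {Y : Type*}
  (F : FieldSpace 𝕜 C Y) (M : Fin (p + q) → Fin (p + q) → F.Op)

theorem spin₂_eq : F.spin₂ M = spinTrace₂ (etaSign p q) M := (spinTrace₂_eq _ M).symm

theorem spin₄_eq : F.spin₄ M = spinTrace₄ (etaSign p q) M := (spinTrace₄_eq _ M).symm

theorem spin₆_eq : F.spin₆ M = spinTrace₆ (etaSign p q) M := (spinTrace₆_eq _ M).symm

theorem covDSq_eq : F.covDSq M = spinForm₀ (etaSign p q) (F.covD₂ M) :=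
  (spinForm₀_eq _ (F.covD₂ M)).symm

theorem covDSq₁_eq : F.covDSq₁ M = spinForm₁ (etaSign p q) M (F.covD₂ M) :=
  (spinForm₁_eq _ M (F.covD₂ M)).symm

theorem covDSq₂_eq : F.covDSq₂ M = spinForm₂ (etaSign p q) M (F.covD₂ M) :=
  (spinForm₂_eq _ M (F.covD₂ M)).symm

end FieldSpace

end Pseudosphere

theorem mainTheorem4 {𝕜 : Type*} [RCLike 𝕜] (p q : ℕ) (R : ℝ) (hR : 0 < R)
    (C : Pseudosphere.ChartDomain p q R) {Y : Type*} (F : Pseudosphere.FieldSpace 𝕜 C Y)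
    (M : Fin (p + q) → Fin (p + q) → F.Op) (hM : F.IsSpinPart M) :
    F.casimirOp M 1 = (-1 : 𝕜) ^ p • ((R : 𝕜) ^ 2 • F.covDSq M + (1 / 2 : 𝕜) • F.spin₂ M) ∧
    F.casimirOp M 2 =
      ((-1 : 𝕜) ^ (p + 1) * (R : 𝕜) ^ 2) •
        (F.covDSq₁ M + (1 / 2 : 𝕜) • (F.spin₂ M * F.covDSq M)) + F.spinO₄ M ∧
    F.casimirOp M 3 =
      ((-1 : 𝕜) ^ p * (R : 𝕜) ^ 2) •
        (F.covDSq₂ M + (1 / 8 : 𝕜) • (F.spin₂ M ^ 2 * F.covDSq M)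
          - (1 / 4 : 𝕜) • (F.spin₄ M * F.covDSq M)
          + (1 / 2 : 𝕜) • (F.spin₂ M * F.covDSq₁ M)
          + ((((p : 𝕜) + q) ^ 2 - 5 * ((p : 𝕜) + q) + 10) / 8) • (F.spin₂ M * F.covDSq M)
          + (1 : 𝕜) • F.covDSq₁ M)
        - F.spinO₆ M := by
  obtain ⟨h1, h2, h3⟩ := F.casimirSum_genAmb hR hM
  rw [F.spin₂_eq, F.covDSq_eq, F.covDSq₁_eq, F.covDSq₂_eq, F.spin₄_eq, Pseudosphere.FieldSpace.spinO₄,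
    Pseudosphere.FieldSpace.spinO₆, F.spin₂_eq, F.spin₄_eq, F.spin₆_eq, ← Nat.cast_add]
  exact ⟨Pseudosphere.casimir_one_eq p h1, Pseudosphere.casimir_two_eq p h2,
    Pseudosphere.casimir_three_eq p h3⟩
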